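/- Let $a=(a_0,a_1,a_2,\dots)$ be parameters in a commutative $\mathbb{Q}$-algebra $R$ (for instance $R=\mathbb{Q}[a_1,a_2,\dots]$ with $a_1,a_2,\dots$ indeterminates), and let $x_1,\dots,x_n$ be indeterminates, $n\ge 0$. **Notation.** A strict partition $\lambda$ of length $l=l(\lambda)$ is a sequence of integers $\lambda_1>\dots>\lambda_l>0$; $\mu\subset\lambda$ means $l(\mu)\le l(\lambda)$ and $\mu_i\le\lambda_i$ for $1 \le i\le l(\mu)$, and $\mu^0=(\mu_1,\dots,\mu_{l(\mu)},0)$. Put $\tilde g_0(x)=1$ and $\tilde g_d(x)=2(x^d-x^{-d})\frac{x+x^{-1}}{x-x^{-1}}$ for $d\ge1$. With $u_i=x_i+x_i^{-1}$, let $\tilde A=\left(\frac{u_j-u_i}{u_j+u_i}\right)_{1\le i,j\le n}$, $\tilde\Delta=\prod_{1\le i<j\le n}\frac{u_j-u_i}{u_j+u_i}$ and $\tilde W_\alpha=(\tilde g_{\alpha_j}(x_i))_{i,j}$. **Universal symplectic $Q$-functions.** For a strict partition $\lambda$ the symplectic $Q$-function is $$Q^C_\lambda(x_1,\dots,x_n)=\frac1{\tilde\Delta}\operatorname{Pf}\begin{pmatrix}\tilde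 A&\tilde W_{\lambda^*}\\-{}^t\tilde W_{\lambda^*}&O\end{pmatrix},$$ where $\lambda^*=\lambda$ if $n+l(\lambda)$ is even and $\lambda^*=\lambda^0$ if it is odd. Let $\Lambda_R$ be the ring of symmetric functions over $R$ in infinitely many variables $X$ (symmetric formal power series of bounded degree) and let $$\tilde\pi_n:\Lambda_R\to R[x_1^{\pm1},\dots,x_n^{\pm1}],\qquad f\mapsto f(x_1,\dots,x_n,x_1^{-1},\dots,x_n^{-1},0,0,\dots).$$ The universal symplectic $Q$-function $\mathbf Q^C_\lambda(X)\in\Lambda_{\mathbb{Q}}$ is the unique symmetric function with $\tilde\pi_n(\mathbf Q^C_\lambda(X))=Q^C_\lambda(x_1,\dots,x_n)$ for all $n$. The universal factorial symplectic $Q$-function is $$\mathbf Q^C_\lambda(X|a)=\sum_\mu\det\bigl(e_{\lambda_i-\mu_j}(a_0,\dots,a_{\lambda_i-1})\bigr)_{1\le i,j\le l(\lambda)}\,\mathbf Q^C_\mu(X)\in\Lambda_R,$$ where $\mu$ runs over the strict partitions with $\mu\subset\lambda$ and $l(\mu)=l(\lambda)$, and $e_d$ is the $d$-th elementary symmetric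 polynomial ($e_d=0$ for $d<0$). For one row, $\mathbf Q^C_{(r)}(X|a)$ depends only on $a_0,\dots,a_{r-1}$ and is written $\mathbf Q^C_{(r)}(X|a_0,\dots,a_{r-1})$. One puts $\mathbf Q^C_{(s,r)}(X|a)=-\mathbf Q^C_{(r,s)}(X|a)$ for $r>s>0$ and $\mathbf Q^C_{(r,r)}(X|a)=0$. **Skew functions.** For integers $r,k\ge0$ let $\mathbf R_{r/k}(X|a)$ be $\mathbf Q^C_{(r)}(X|a_0,\dots,a_{r-1})$ if $k=0<r$, $\mathbf Q^C_{(r-k)}(X|0,a_{k+1},\dots,a_{r-1})$ if $1\le k\le r-1$, $1$ if $k=r$, and $0$ if $k>r$. For strict partitions $\lambda,\mu$ put $$\mathbf Q^C_{\lambda/\mu}(X|a)=\operatorname{Pf}\begin{pmatrix}K&M\\-{}^tM&O\end{pmatrix},\qquad K=\bigl(\mathbf Q^C_{(\lambda_i,\lambda_j)}(X|a)\bigr)_{1\le i,j\le l(\lambda)},\quad M=\bigl(\mathbf R_{\lambda_i/\beta_{s+1-j}}(X|a)\bigr)_{1\le i\le l(\lambda),\,1\le j\le s},$$ where $\beta=(\beta_1,\dots,\beta_s)$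 is $\mu$ if $l(\lambda)+l(\mu)$ is even and $\mu^0$ if it is odd. The skew factorial symplectic $Q$-function is $Q^C_{\lambda/\mu}(x_1,\dots,x_n|a)=\tilde\pi_n(\mathbf Q^C_{\lambda/\mu}(X|a))$. **Tableaux.** Let $S(\lambda)=\{(i,j):1\le i\le l(\lambda),\ i\le j\le\lambda_i+i-1\}$ be the shifted diagram of $\lambda$, and put $S(\lambda/\mu)=S(\lambda)\setminus S(\mu)$ for $\mu\subset\lambda$. A symplectic primed shifted tableau of shape $\lambda/\mu$ is a filling $T$ of the boxes of $S(\lambda/\mu)$ with letters from $$1'<1<\bar1'<\bar1<2'<2<\bar2'<\bar2<\dots<n'<n<\bar n'<\bar n$$ such that the entries weakly increase along rows and down columns and, for each $k$: each row contains at most one $k'$ and at most one $\bar k'$; each column contains at most one $k$ and at most one $\bar k$; and the main diagonal $\{(i,i)\}$ contains at most one entry from $\{k',k,\bar k',\bar k\}$. Let $\mathrm{QTab}^C_n(\lambda/\mu)$ be the set of these tableaux; it is empty if $\mu\not\subset\lambda$. The factorial weight of $T$ is $(x|a)^T=\prod_{(i,j)\in S(\lambda/\mu)}w(T_{i,j};i,j)$,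 where $w(k';i,j)=x_k-a_{j-i}$, $w(k;i,j)=x_k+a_{j-i}$, $w(\bar k';i,j)=x_k^{-1}-a_{j-i}$ and $w(\bar k;i,j)=x_k^{-1}+a_{j-i}$. **Theorem.** Assume $a_0=0$. For all strict partitions $\lambda$ and $\mu$, $$Q^C_{\lambda/\mu}(x_1,\dots,x_n|a)=\sum_{T\in\mathrm{QTab}^C_n(\lambda/\mu)}(x|a)^T\quad\text{in } R[x_1^{\pm1},\dots,x_n^{\pm1}].$$ -/

import Mathlib

open scoped Nat

noncomputable section

namespace SymplecticQ

/-! ## Pfaffians -/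

/-- The Pfaffian of a skew-symmetric matrix of size `N = 2m` over a commutative `ℚ`-algebra:
`(2 ^ m * m!)⁻¹ * ∑ σ, sign σ * ∏ i, A (σ (2 i)) (σ (2 i + 1))`, the sum being over all
permutations of the `N` indices `0, …, N - 1`. It is `0` by convention for odd `N`. -/
def pfaffian {S : Type*} [CommRing S] [Algebra ℚ S] {N : ℕ} (A : Matrix (Fin N) (Fin N) S) : S :=
  if Even N then
    ((2 ^ (N / 2) * (N / 2)! : ℚ)⁻¹) •
      ∑ σ : Equiv.Perm (Fin N), ((Equiv.Perm.sign σ : ℤ) : S) *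
        ∏ i : Fin (N / 2), A (σ ⟨2 * i, by omega⟩) (σ ⟨2 * i + 1, by omega⟩)
  else 0

/-- The Pfaffian of the block matrix with blocks `K`, `M`, `-Mᵀ`, `0`, the rows of `K` coming
first. -/
def blockPfaffian {S : Type*} [CommRing S] [Algebra ℚ S] {l m : ℕ}
    (K : Matrix (Fin l) (Fin l) S) (M : Matrix (Fin l) (Fin m) S) : S :=
  pfaffian (Matrix.reindex finSumFinEquiv finSumFinEquiv
    (Matrix.fromBlocks K M (-M.transpose) 0))

/-! ## Strict partitions -/

/-- A strict partition of length `l`, written as the sequence of its `l` nonzero parts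
`lam 0 > lam 1 > … > lam (l - 1) > 0`. -/
def IsStrictPartition {l : ℕ} (lam : Fin l → ℕ) : Prop :=
  StrictAnti lam ∧ ∀ i, 0 < lam i

/-! ## Laurent polynomials -/

/-- The ring of Laurent polynomials `R[x₁^{±1}, …, x_n^{±1}]`. -/
abbrev Laurent (R : Type*) [CommRing R] (n : ℕ) : Type _ := AddMonoidAlgebra R (Fin n →₀ ℤ)

/-- The indeterminate `x_k`. -/
def lx (R : Type*) [CommRing R] (n : ℕ) (k : Fin n) : Laurent R n :=
  AddMonoidAlgebra.single (Finsupp.single k 1) 1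

/-- The inverse `x_k⁻¹` of the indeterminate `x_k`. -/
def lxInv (R : Type*) [CommRing R] (n : ℕ) (k : Fin n) : Laurent R n :=
  AddMonoidAlgebra.single (Finsupp.single k (-1)) 1

theorem lx_mul_lxInv (R : Type*) [CommRing R] (n : ℕ) (k : Fin n) :
    lx R n k * lxInv R n k = 1 := by
  simp [lx, lxInv, AddMonoidAlgebra.single_mul_single, AddMonoidAlgebra.one_def]

/-! ## Symmetric functions in infinitely many variables -/

/-- The ring `Λ` of symmetric functions with coefficients in `R`: the formal power series of bounded
degree in variables indexed by `ℕ` that are invariant under all permutations of the variables. -/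
def SymFun (R : Type*) [CommRing R] : Subalgebra R (MvPowerSeries ℕ R) where
  carrier := {f | (∃ N : ℕ, ∀ m : ℕ →₀ ℕ, MvPowerSeries.coeff m f ≠ 0 → m.degree ≤ N) ∧
    ∀ σ : Equiv.Perm ℕ, MvPowerSeries.renameEquiv R σ f = f}
  mul_mem' := by
    classical
    rintro f g ⟨⟨N, hN⟩, hf⟩ ⟨⟨M, hM⟩, hg⟩
    refine ⟨⟨N + M, fun m hm => ?_⟩, fun σ => by rw [map_mul, hf, hg]⟩
    rw [MvPowerSeries.coeff_mul] at hm
    obtain ⟨p, hp, hne⟩ := Finset.exists_ne_zero_of_sum_ne_zero hm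
    rw [← Finset.HasAntidiagonal.mem_antidiagonal.mp hp, map_add]
    exact add_le_add (hN _ (left_ne_zero_of_mul hne)) (hM _ (right_ne_zero_of_mul hne))
  add_mem' := by
    rintro f g ⟨⟨N, hN⟩, hf⟩ ⟨⟨M, hM⟩, hg⟩
    refine ⟨⟨max N M, fun m hm => ?_⟩, fun σ => by rw [map_add, hf, hg]⟩
    by_cases h : MvPowerSeries.coeff m f = 0
    · refine le_trans (hM m fun h' => hm ?_) (le_max_right _ _)
      rw [map_add, h, h', add_zero]
    · exact le_trans (hN m h) (le_max_left _ _)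
  algebraMap_mem' := by
    classical
    intro r
    refine ⟨⟨0, fun m hm => ?_⟩, fun σ => (MvPowerSeries.renameEquiv R σ).commutes r⟩
    rw [MvPowerSeries.algebraMap_apply, MvPowerSeries.coeff_C] at hm
    by_cases h : m = 0
    · simp [h]
    · simp [h] at hm

/-- Extension of coefficients `Λ_ℚ → Λ_R`. -/
def SymFun.ofRat (R : Type*) [CommRing R] [Algebra ℚ R] (f : SymFun ℚ) : SymFun R :=
  ⟨MvPowerSeries.map (algebraMap ℚ R) f.1, by
    obtain ⟨⟨N, hN⟩, hf⟩ := f.2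
    refine ⟨⟨N, fun m hm => hN m fun h => hm ?_⟩, fun σ => ?_⟩
    · rw [MvPowerSeries.coeff_map, h, map_zero]
    · have h := congrArg (MvPowerSeries.map (algebraMap ℚ R)) (hf σ)
      rw [MvPowerSeries.renameEquiv_apply, RingHom.toFun_eq_coe] at h ⊢
      exact (MvPowerSeries.rename_map (f := σ) (algebraMap ℚ R) f.1).trans h⟩

/-- The embedding of `2n` variables into the infinite set of variables. -/
def varEmb (n : ℕ) : Fin n ⊕ Fin n ↪ ℕ :=
  finSumFinEquiv.toEmbedding.trans Fin.valEmbedding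

/-- The polynomial obtained from a symmetric function by setting all the variables but the first
`2n` to `0`. -/
def SymFun.restrictFun {R : Type*} [CommRing R] (n : ℕ) (f : SymFun R) :
    MvPolynomial (Fin n ⊕ Fin n) R :=
  AddMonoidAlgebra.ofCoeff (Finsupp.ofSupportFinite
    (fun m => MvPowerSeries.coeff m (MvPowerSeries.killCompl (varEmb n) f.1)) (by
      obtain ⟨⟨N, hN⟩, -⟩ := f.2
      refine (Finsupp.finite_of_degree_le (σ := Fin n ⊕ Fin n) N).subset fun m hm => ?_
      rw [Function.mem_support, MvPowerSeries.coeff_killCompl] at hm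
      have h := hN _ hm
      rw [Finsupp.embDomain_eq_mapDomain, Finsupp.degree_mapDomain] at h
      exact h))

theorem SymFun.coe_restrictFun {R : Type*} [CommRing R] (n : ℕ) (f : SymFun R) :
    (SymFun.restrictFun n f : MvPowerSeries (Fin n ⊕ Fin n) R) =
      MvPowerSeries.killCompl (varEmb n) f.1 := by
  ext m
  rw [MvPolynomial.coeff_coe]
  rfl

/-- `SymFun.restrictFun` as a homomorphism of algebras. -/
def SymFun.restrict (R : Type*) [CommRing R] (n : ℕ) :
    SymFun R →ₐ[R] MvPolynomial (Fin n ⊕ Fin n) R where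
  toFun := SymFun.restrictFun n
  map_one' := by
    apply MvPolynomial.coe_injective
    rw [SymFun.coe_restrictFun, MvPolynomial.coe_one]
    exact map_one _
  map_mul' f g := by
    apply MvPolynomial.coe_injective
    rw [MvPolynomial.coe_mul]
    simp only [SymFun.coe_restrictFun]
    exact map_mul _ _ _
  map_zero' := by
    apply MvPolynomial.coe_injective
    rw [SymFun.coe_restrictFun, MvPolynomial.coe_zero]
    exact map_zero _
  map_add' f g := by
    apply MvPolynomial.coe_injective
    rw [MvPolynomial.coe_add]
    simp only [SymFun.coe_restrictFun]
    exact map_add _ _ _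
  commutes' r := by
    apply MvPolynomial.coe_injective
    rw [SymFun.coe_restrictFun, MvPolynomial.algebraMap_eq, MvPolynomial.coe_C]
    exact (MvPowerSeries.killCompl (varEmb n)).commutes r

/-- The homomorphism `π̃_n : Λ → R[x₁^{±1}, …, x_n^{±1}]`,
`f ↦ f(x₁, …, x_n, x₁⁻¹, …, x_n⁻¹, 0, 0, …)`. -/
def proj (R : Type*) [CommRing R] (n : ℕ) : SymFun R →ₐ[R] Laurent R n :=
  (MvPolynomial.aeval (Sum.elim (lx R n) (lxInv R n))).comp (SymFun.restrict R n)

/-! ## Symplectic `Q`-functions in `n` variables -/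

/-- The field `ℚ(x₁, …, x_n)`, the field of fractions of the ring of Laurent polynomials. -/
abbrev RatFun (n : ℕ) : Type := FractionRing (Laurent ℚ n)

/-- The indeterminate `x_k` as an element of `ℚ(x₁, …, x_n)`. -/
def fx (n : ℕ) (k : Fin n) : RatFun n := algebraMap (Laurent ℚ n) (RatFun n) (lx ℚ n k)

/-- `g̃_d(x)`, which is `1` for `d = 0` and
`2 (x^d - x^{-d}) (x + x⁻¹) / (x - x⁻¹)` for `d ≥ 1`. -/
def gTilde {K : Type*} [Field K] (d : ℕ) (x : K) : K :=
  if d = 0 then 1 else 2 * (x ^ d - x⁻¹ ^ d) * (x + x⁻¹) / (x - x⁻¹)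

/-- The entries of the matrix `Ã(x)`, namely
`((x_j + x_j⁻¹) - (x_i + x_i⁻¹)) / ((x_j + x_j⁻¹) + (x_i + x_i⁻¹))`. -/
def matA (n : ℕ) : Matrix (Fin n) (Fin n) (RatFun n) := Matrix.of fun i j =>
  ((fx n j + (fx n j)⁻¹) - (fx n i + (fx n i)⁻¹)) / ((fx n j + (fx n j)⁻¹) + (fx n i + (fx n i)⁻¹))

/-- `Δ̃(x)`, the product of the entries of `Ã(x)` strictly above the diagonal. -/
def deltaTilde (n : ℕ) : RatFun n := ∏ i : Fin n, ∏ j ∈ Finset.Ioi i, matA n i j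

/-- `W̃_α(x) = (g̃_{α_j}(x_i))`. -/
def matW (n : ℕ) {l : ℕ} (α : Fin l → ℕ) : Matrix (Fin n) (Fin l) (RatFun n) :=
  Matrix.of fun i j => gTilde (α j) (fx n i)

/-- The symplectic `Q`-function `Q^C_α(x₁, …, x_n)`, by the Nimmo-type formula. If `n + l(α)` is
odd, a zero part is appended to `α`. -/
def symplecticQ (n : ℕ) {l : ℕ} (α : Fin l → ℕ) : RatFun n :=
  if Even (n + l) then blockPfaffian (matA n) (matW n α) / deltaTilde n
  else blockPfaffian (matA n) (matW n (Fin.snoc α 0 : Fin (l + 1) → ℕ)) / deltaTilde n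

/-! ## Universal symplectic `Q`-functions -/

/-- `f` is a universal symplectic `Q`-function for `α`:
`π̃_n(f) = Q^C_α(x₁, …, x_n)` for all `n`. -/
def IsUniversalQ {l : ℕ} (α : Fin l → ℕ) (f : SymFun ℚ) : Prop :=
  ∀ n : ℕ, algebraMap (Laurent ℚ n) (RatFun n) (proj ℚ n f) = symplecticQ n α

/-- The universal symplectic `Q`-function `𝐐^C_α(X) ∈ Λ`: the symmetric function `f` with
`π̃_n(f) = Q^C_α(x₁, …, x_n)` for all `n`. -/
def universalQ {l : ℕ} (α : Fin l → ℕ) : SymFun ℚ :=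
  Classical.epsilon (IsUniversalQ α)

/-- `e_{p-q}(a_0, …, a_{p-1})`, which is `0` for `p < q`. -/
def elemSym {R : Type*} [CommRing R] (a : ℕ → R) (p q : ℕ) : R :=
  if q ≤ p then ((Multiset.range p).map a).esymm (p - q) else 0

/-- The coefficient `d_{λ,μ} = det (e_{λ_i - μ_j}(a_0, …, a_{λ_i - 1}))`. -/
def dCoeff {R : Type*} [CommRing R] (a : ℕ → R) {l : ℕ} (lam mu : Fin l → ℕ) : R :=
  Matrix.det (Matrix.of fun i j => elemSym a (lam i) (mu j))

open Classical in
/-- The strict partitions `μ ⊂ λ` with `l(μ) = l(λ) = l`. -/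
def strictBelow {l : ℕ} (lam : Fin l → ℕ) : Finset (Fin l → ℕ) :=
  (Fintype.piFinset fun i => Finset.Icc 1 (lam i)).filter IsStrictPartition

/-- The universal factorial symplectic `Q`-function
`𝐐^C_λ(X|a) = ∑_μ d_{λ,μ} 𝐐^C_μ(X)`, where `μ` runs over the strict partitions `μ ⊂ λ` with
`l(μ) = l(λ)`. -/
def universalFacQ {R : Type*} [CommRing R] [Algebra ℚ R] (a : ℕ → R) {l : ℕ} (lam : Fin l → ℕ) :
    SymFun R :=
  ∑ mu ∈ strictBelow lam, dCoeff a lam mu • SymFun.ofRat R (universalQ mu)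

/-- `𝐐^C_{(r,s)}(X|a)` for nonnegative integers `r` and `s`, with the usual conventions
`𝐐_{(r,0)} = 𝐐_{(r)}`, `𝐐_{(s,r)} = -𝐐_{(r,s)}`, `𝐐_{(r,r)} = 0`. -/
def pairQ {R : Type*} [CommRing R] [Algebra ℚ R] (a : ℕ → R) (r s : ℕ) : SymFun R :=
  if r = s then 0
  else if s = 0 then universalFacQ a ![r]
  else if r = 0 then -universalFacQ a ![s]
  else if s < r then universalFacQ a ![r, s]
  else -universalFacQ a ![s, r]

/-- `𝐑^C_{r/k}(X|a)`: it is `𝐐^C_{(r)}(X|a_0, …, a_{r-1})` for `k = 0`,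
`𝐐^C_{(r-k)}(X|0, a_{k+1}, …, a_{r-1})` for `1 ≤ k ≤ r - 1`, `1` for `k = r` and `0` for `k > r`. -/
def universalR {R : Type*} [CommRing R] [Algebra ℚ R] (a : ℕ → R) (r k : ℕ) : SymFun R :=
  if k = r then 1
  else if k = 0 then universalFacQ a ![r]
  else if k < r then universalFacQ (fun i => if i = 0 then 0 else a (k + i)) ![r - k]
  else 0

/-- `K̃_α(X|a) = (𝐐^C_{(α_i, α_j)}(X|a))`. -/
def matK {R : Type*} [CommRing R] [Algebra ℚ R] (a : ℕ → R) {l : ℕ} (α : Fin l → ℕ) :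
    Matrix (Fin l) (Fin l) (SymFun R) :=
  Matrix.of fun i j => pairQ a (α i) (α j)

/-- `M̃_{α/β}(X|a) = (𝐑^C_{α_i / β_{s+1-j}}(X|a))`, where `s` is the length of `β`. -/
def matM {R : Type*} [CommRing R] [Algebra ℚ R] (a : ℕ → R) {l s : ℕ} (α : Fin l → ℕ)
    (β : Fin s → ℕ) : Matrix (Fin l) (Fin s) (SymFun R) :=
  Matrix.of fun i j => universalR a (α i) (β j.rev)

/-- The universal skew factorial symplectic `Q`-function `𝐐^C_{λ/μ}(X|a)`. -/
def universalSkewQ {R : Type*} [CommRing R] [Algebra ℚ R] (a : ℕ → R) {l m : ℕ}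
    (lam : Fin l → ℕ) (mu : Fin m → ℕ) : SymFun R :=
  if Even (l + m) then blockPfaffian (matK a lam) (matM a lam mu)
  else blockPfaffian (matK a lam) (matM a lam (Fin.snoc mu 0 : Fin (m + 1) → ℕ))

/-- The skew factorial symplectic `Q`-function `Q^C_{λ/μ}(x₁, …, x_n|a)`. -/
def skewFacQ {R : Type*} [CommRing R] [Algebra ℚ R] (n : ℕ) (a : ℕ → R) {l m : ℕ}
    (lam : Fin l → ℕ) (mu : Fin m → ℕ) : Laurent R n :=
  proj R n (universalSkewQ a lam mu)

/-! ## Symplectic primed shifted tableaux -/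

/-- The shifted diagram `S(λ)`. Rows and columns are numbered from `0`: the row `i` consists of the
boxes `(i, i), (i, i + 1), …, (i, i + λ_i - 1)`. -/
def shiftedDiagram {l : ℕ} (lam : Fin l → ℕ) : Finset (ℕ × ℕ) :=
  Finset.univ.biUnion fun i : Fin l => (Finset.range (lam i)).image fun c => ((i : ℕ), (i : ℕ) + c)

/-- The skew shifted diagram `S(λ/μ)`. -/
def skewDiagram {l m : ℕ} (lam : Fin l → ℕ) (mu : Fin m → ℕ) : Finset (ℕ × ℕ) :=
  shiftedDiagram lam \ shiftedDiagram mu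

/-- The alphabet `1' < 1 < 1̄' < 1̄ < 2' < 2 < 2̄' < 2̄ < … < n' < n < n̄' < n̄`, ordered
lexicographically: the first component is the number (counted from `0`), the second one
tells whether the letter is barred, and the third one is `false` for primed letters and `true` for
unprimed letters. -/
abbrev Letter (n : ℕ) : Type := Fin n ×ₗ Bool ×ₗ Bool

/-- The number `k` of the letter `k'`, `k`, `k̄'` or `k̄`. -/
def Letter.index {n : ℕ} (γ : Letter n) : Fin n := (ofLex γ).1

/-- The letter is `k̄'` or `k̄`. -/
def Letter.barred {n : ℕ} (γ : Letter n) : Bool := (ofLex (ofLex γ).2).1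

/-- The letter is `k` or `k̄`. -/
def Letter.unprimed {n : ℕ} (γ : Letter n) : Bool := (ofLex (ofLex γ).2).2

/-- A filling `T` of the set of boxes `D` is a symplectic primed shifted tableau. -/
structure IsTableau {n : ℕ} {D : Finset (ℕ × ℕ)} (T : D → Letter n) : Prop where
  /-- The entries are weakly increasing along each row. -/
  row_weak : ∀ p q : D, p.1.1 = q.1.1 → p.1.2 ≤ q.1.2 → T p ≤ T q
  /-- The entries are weakly increasing down each column. -/
  col_weak : ∀ p q : D, p.1.2 = q.1.2 → p.1.1 ≤ q.1.1 → T p ≤ T q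
  /-- Each row contains at most one `k'` and at most one `k̄'` for each `k`. -/
  row_primed : ∀ p q : D, p.1.1 = q.1.1 → T p = T q → (T p).unprimed = false → p = q
  /-- Each column contains at most one `k` and at most one `k̄` for each `k`. -/
  col_unprimed : ∀ p q : D, p.1.2 = q.1.2 → T p = T q → (T p).unprimed = true → p = q
  /-- At most one of the letters `k'`, `k`, `k̄'`, `k̄` appears on the main diagonal, and at most
  once, for each `k`. -/
  diag : ∀ p q : D, p.1.1 = p.1.2 → q.1.1 = q.1.2 → (T p).index = (T q).index → p = q

open Classical in
/-- The set `QTab^C_n(λ/μ)` of symplectic primed shifted tableaux of shape `λ/μ`, which is empty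
unless `μ ⊂ λ`. -/
def tableaux (n : ℕ) {l m : ℕ} (lam : Fin l → ℕ) (mu : Fin m → ℕ) :
    Finset (skewDiagram lam mu → Letter n) :=
  if shiftedDiagram mu ⊆ shiftedDiagram lam then Finset.univ.filter IsTableau else ∅

/-- The weight of the letter `γ` in a box `(i, j)` with `j - i = c`: it is `x_k - a_c` for
`γ = k'`, `x_k + a_c` for `γ = k`, `x_k⁻¹ - a_c` for `γ = k̄'` and `x_k⁻¹ + a_c` for `γ = k̄`. -/
def letterWeight {R : Type*} [CommRing R] (a : ℕ → R) {n : ℕ} (γ : Letter n) (c : ℕ) :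
    Laurent R n :=
  (if γ.barred then lxInv R n γ.index else lx R n γ.index) +
    algebraMap R (Laurent R n) (if γ.unprimed then a c else -a c)

/-- The factorial weight `(x|a)^T`, the product over the boxes `(i, j)` of the weights of the
entries. All boxes of a shifted diagram satisfy `i ≤ j`. -/
def facWeight {R : Type*} [CommRing R] (a : ℕ → R) {n : ℕ} {D : Finset (ℕ × ℕ)}
    (T : D → Letter n) : Laurent R n :=
  ∏ p : D, letterWeight a (T p) (p.1.2 - p.1.1)

end SymplecticQ

end

/-! Both sides satisfy the same transfer-matrix recursion in the number of pairs `x_k, x_k⁻¹`, and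
they agree when there are no variables.

Tableau side. Fix the number `l` of rows and encode a shape by a strictly decreasing sequence of
length `l` whose last entry may be `0`. Deleting the boxes of the largest letter leaves such a
sequence again, and the weight of the deleted strip is an `l × l` determinant of one-row weights
(`det_stepWeight`). The diagonal rule is built into this encoding: only the last entry can be `0`,
so the four letters of one index together create at most one new diagonal box. This gives
`skewSum_succ`.

Pfaffian side. A row of length `r` is represented by the factorial power `(X + a_0) ⋯ (X +
a_{r-1})`. A power series `Q` acts on polynomials by multiplication with `Q(X⁻¹)` followed by
removal of the negative powers. In the basis of factorial powers the series `(1 + x z) / (1 - x z)`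
acts by the product of the one-row matrices of an unprimed and a primed letter (`sum_rowWeight`), so
a pair `x_k, x_k⁻¹` contributes exactly four letters. The entries of `M` are the matrix of this
action for the product of all series (`facCoord_truncMul`), and the entries of `K` are values of an
alternating form `pairForm` which grows by a simple correction with each pair. Minor summation
(`blockPfaffian_expand`) turns the change of basis into the same sum of determinants as for
tableaux. The correction is invisible on positive parts because `a_0 = 0` kills the constant terms,
and a zero last part can be dropped (`skewPf_snoc_zero`). The induction is `partialPf_eq`.

Identification of the entries. Only one-row and two-row functions enter the skew Pfaffian. Their
Nimmo formulas are evaluated with Schur's Pfaffian and Lagrange interpolation at the nodes `x_i +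
x_i⁻¹`. The two-row functions are then seen to satisfy a recursion `twoRow` with the one-row
functions as input. `pairForm` satisfies the same recursion on powers of `X`, and expanding
factorial powers into powers supplies the factorial versions. -/

open scoped Nat

noncomputable section

namespace SymplecticQ

set_option linter.unusedSectionVars false

/-! ### Pfaffians: row expansion, alternating maps, minor summation -/

section Pfaffian

variable {S : Type*} [CommRing S] [Algebra ℚ S]

/-- The signed product attached to a permutation in the Pfaffian. -/
def pfTerm {N : ℕ} (A : Matrix (Fin N) (Fin N) S) (σ : Equiv.Perm (Fin N)) : S :=
  ((Equiv.Perm.sign σ : ℤ) : S) *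
    ∏ i : Fin (N / 2), A (σ ⟨2 * i, by omega⟩) (σ ⟨2 * i + 1, by omega⟩)

theorem pfaffian_eq {N : ℕ} (A : Matrix (Fin N) (Fin N) S) :
    pfaffian A = if Even N then
      ((2 ^ (N / 2) * (N / 2)! : ℚ)⁻¹) • ∑ σ : Equiv.Perm (Fin N), pfTerm A σ else 0 := rfl

theorem pfaffian_submatrix_perm {N : ℕ} (A : Matrix (Fin N) (Fin N) S)
    (σ : Equiv.Perm (Fin N)) :
    pfaffian (A.submatrix σ σ) = ((Equiv.Perm.sign σ : ℤ) : S) * pfaffian A := by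
  rw [pfaffian_eq, pfaffian_eq]
  split_ifs
  · rw [mul_smul_comm, Finset.mul_sum, ← Equiv.sum_comp (Equiv.mulLeft σ) (fun τ => _ * pfTerm A τ)]
    congr 1
    refine Finset.sum_congr rfl fun τ _ => ?_
    simp only [pfTerm, Equiv.coe_mulLeft, Equiv.Perm.sign_mul, Matrix.submatrix_apply,
      Equiv.Perm.mul_apply, ← mul_assoc]
    congr 1
    rcases Int.units_eq_one_or (Equiv.Perm.sign σ) with h | h <;> simp [h]
  · simp

theorem pfaffian_cast {N N' : ℕ} (h : N = N') (A : Matrix (Fin N') (Fin N') S) :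
    pfaffian (A.submatrix (Fin.cast h) (Fin.cast h)) = pfaffian A := by
  subst h; rfl

theorem pfTerm_mul_swap_zero_one {M : ℕ} (A : Matrix (Fin (M + 2)) (Fin (M + 2)) S)
    (hA : ∀ i j, A i j = -A j i) (σ : Equiv.Perm (Fin (M + 2))) :
    pfTerm A (σ * Equiv.swap 0 1) = pfTerm A σ := by
  have h0 : 0 < (M + 2) / 2 := by omega
  simp only [pfTerm]
  rw [← Finset.mul_prod_erase _ _ (Finset.mem_univ (⟨0, h0⟩ : Fin ((M + 2) / 2))),
    ← Finset.mul_prod_erase (a := (⟨0, h0⟩ : Fin ((M + 2) / 2))) Finset.univ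
      (fun i : Fin ((M + 2) / 2) => A (σ ⟨2 * i, by omega⟩) (σ ⟨2 * i + 1, by omega⟩))
      (Finset.mem_univ _)]
  have e0 : (⟨2 * ((⟨0, h0⟩ : Fin ((M + 2) / 2)) : ℕ), by simp⟩ : Fin (M + 2)) = 0 := rfl
  have e1 : (⟨2 * ((⟨0, h0⟩ : Fin ((M + 2) / 2)) : ℕ) + 1, by simp⟩ : Fin (M + 2)) = 1 := rfl
  rw [e0, e1]
  have hp : ∏ i ∈ Finset.univ.erase (⟨0, h0⟩ : Fin ((M + 2) / 2)),
      A ((σ * Equiv.swap 0 1 : Equiv.Perm _) ⟨2 * i, by omega⟩)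
        ((σ * Equiv.swap 0 1 : Equiv.Perm _) ⟨2 * i + 1, by omega⟩) =
      ∏ i ∈ Finset.univ.erase (⟨0, h0⟩ : Fin ((M + 2) / 2)),
        A (σ ⟨2 * i, by omega⟩) (σ ⟨2 * i + 1, by omega⟩) := by
    refine Finset.prod_congr rfl fun i hi => ?_
    have hi0 : (i : ℕ) ≠ 0 := fun h => Finset.ne_of_mem_erase hi (Fin.ext h)
    rw [Equiv.Perm.mul_apply, Equiv.Perm.mul_apply,
      Equiv.swap_apply_of_ne_of_ne, Equiv.swap_apply_of_ne_of_ne] <;>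
      (rw [Ne, Fin.ext_iff]; simp; try omega)
  rw [hp]
  simp only [Equiv.Perm.mul_apply, Equiv.swap_apply_left, Equiv.swap_apply_right,
    Equiv.Perm.sign_mul]
  rw [hA (σ 1) (σ 0), Equiv.Perm.sign_swap (by simp)]
  simp

/-- Exchanging the pair of positions `{0, 1}` with the pair `{2k, 2k + 1}` is an even permutation
which merely permutes the factors of the product. -/
theorem pfTerm_mul_swap_swap {M : ℕ} (A : Matrix (Fin (M + 2)) (Fin (M + 2)) S)
    (k : Fin ((M + 2) / 2)) (σ : Equiv.Perm (Fin (M + 2))) :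
    pfTerm A (σ * (Equiv.swap 0 ⟨2 * k, by omega⟩ * Equiv.swap 1 ⟨2 * k + 1, by omega⟩)) =
      pfTerm A σ := by
  have h0 : 0 < (M + 2) / 2 := by omega
  by_cases hk : (k : ℕ) = 0
  · have e1 : (⟨2 * (k : ℕ), by omega⟩ : Fin (M + 2)) = 0 := Fin.ext (by simp [hk])
    have e2 : (⟨2 * (k : ℕ) + 1, by omega⟩ : Fin (M + 2)) = 1 := Fin.ext (by simp [hk])
    rw [e1, e2, Equiv.swap_self, Equiv.swap_self]
    rfl
  simp only [pfTerm]
  congr 1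
  · rw [Equiv.Perm.sign_mul, Equiv.Perm.sign_mul, Equiv.Perm.sign_swap, Equiv.Perm.sign_swap]
    · simp
    · rw [Ne, Fin.ext_iff]; simp; omega
    · rw [Ne, Fin.ext_iff]; simp; omega
  · rw [← Equiv.prod_comp (Equiv.swap (⟨0, h0⟩ : Fin ((M + 2) / 2)) k)
      (fun i : Fin ((M + 2) / 2) => A (σ ⟨2 * i, by omega⟩) (σ ⟨2 * i + 1, by omega⟩))]
    refine Finset.prod_congr rfl fun i _ => ?_
    have key : ∀ i : Fin ((M + 2) / 2),
      (Equiv.swap (0 : Fin (M + 2)) ⟨2 * k, by omega⟩ *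
        Equiv.swap 1 ⟨2 * k + 1, by omega⟩ : Equiv.Perm _)
        ⟨2 * i, by omega⟩ = ⟨2 * (Equiv.swap (⟨0, h0⟩ : Fin ((M + 2) / 2)) k i : ℕ), by omega⟩ ∧
      (Equiv.swap (0 : Fin (M + 2)) ⟨2 * k, by omega⟩ *
        Equiv.swap 1 ⟨2 * k + 1, by omega⟩ : Equiv.Perm _)
        ⟨2 * i + 1, by omega⟩ =
        ⟨2 * (Equiv.swap (⟨0, h0⟩ : Fin ((M + 2) / 2)) k i : ℕ) + 1, by omega⟩ := by
      intro i
      have hk' : k ≠ ⟨0, h0⟩ := fun h => hk (by rw [h])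
      simp only [Equiv.Perm.mul_apply, Equiv.swap_apply_def, Fin.ext_iff]
      constructor <;> split_ifs <;> simp_all [Fin.ext_iff] <;> omega
    have e1 := congrArg σ (key i).1
    have e2 := congrArg σ (key i).2
    exact congrArg₂ A e1 e2

/-- Exchanges of pairs, combined with the flip inside the first pair, leave every term fixed and act
transitively on the positions. This allows the position of any index to be normalised to `0`. -/
theorem exists_pfTerm_invariant {M : ℕ} (hM : Even M) (A : Matrix (Fin (M + 2)) (Fin (M + 2)) S)
    (hA : ∀ i j, A i j = -A j i) (p : Fin (M + 2)) :
    ∃ ρ : Equiv.Perm (Fin (M + 2)), ρ 0 = p ∧ ∀ σ, pfTerm A (σ * ρ) = pfTerm A σ := by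
  obtain ⟨m, rfl⟩ := hM
  have hk : (p : ℕ) / 2 < (m + m + 2) / 2 := by omega
  have hS := pfTerm_mul_swap_swap A ⟨p / 2, hk⟩
  rcases Nat.even_or_odd' (p : ℕ) with ⟨c, hc | hc⟩
  · refine ⟨_, ?_, hS⟩
    rw [Equiv.Perm.mul_apply, Equiv.swap_apply_of_ne_of_ne (a := 1), Equiv.swap_apply_left]
    · exact Fin.ext (by simp; omega)
    · rw [Ne, Fin.ext_iff]; simp
    · rw [Ne, Fin.ext_iff]; simp
  · refine ⟨Equiv.swap 0 ⟨2 * (p / 2), by omega⟩ * Equiv.swap 1 ⟨2 * (p / 2) + 1, by omega⟩ *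
      Equiv.swap 0 1, ?_, fun σ => ?_⟩
    rotate_left
    · rw [← mul_assoc, pfTerm_mul_swap_zero_one A hA, hS]
    · rw [Equiv.Perm.mul_apply, Equiv.swap_apply_left, Equiv.Perm.mul_apply,
        Equiv.swap_apply_left, Equiv.swap_apply_of_ne_of_ne]
      · exact Fin.ext (by simp; omega)
      · rw [Ne, Fin.ext_iff]; simp
      · rw [Ne, Fin.ext_iff]; simp

/-- A permutation factors uniquely as a cycle carrying `0` to its value there, times a permutation
fixing `0`. The cycle has sign `(-1) ^ j`, which becomes the sign in the row expansion. -/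
theorem sum_perm_succ {M : ℕ} {T : Type*} [AddCommMonoid T]
    (h : Equiv.Perm (Fin (M + 1)) → T) :
    ∑ τ, h τ = ∑ j : Fin (M + 1), ∑ ρ : Equiv.Perm (Fin M),
      h (j.cycleRange.symm * Equiv.Perm.decomposeFin.symm (0, ρ)) := by
  rw [← Fintype.sum_prod_type']
  symm
  refine Fintype.sum_bijective
    (fun x : Fin (M + 1) × Equiv.Perm (Fin M) =>
      (x.1.cycleRange.symm * Equiv.Perm.decomposeFin.symm (0, x.2) : Equiv.Perm _)) ?_ _ _
    fun x => rfl
  rw [Fintype.bijective_iff_injective_and_card]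
  refine ⟨?_, by simp [Fintype.card_perm, Nat.factorial_succ]⟩
  rintro ⟨j, ρ⟩ ⟨j', ρ'⟩ h
  have h0 : j = j' := by
    have := congrArg (fun e : Equiv.Perm (Fin (M + 1)) => e 0) h
    simpa using this
  subst h0
  have := mul_left_cancel h
  simpa using this

/-- By invariance all `M + 2` possible positions of the index `0` contribute equally. Once `0` sits
in the first position, the terms are grouped by its partner. -/
theorem sum_pfTerm {M : ℕ} (hM : Even M) (A : Matrix (Fin (M + 2)) (Fin (M + 2)) S)
    (hA : ∀ i j, A i j = -A j i) :
    ∑ σ, pfTerm A σ = (M + 2 : ℕ) * ∑ j : Fin (M + 1), (-1) ^ (j : ℕ) * A 0 j.succ *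
      ∑ ρ, pfTerm (A.submatrix (fun i => (j.succAbove i).succ)
        (fun i => (j.succAbove i).succ)) ρ := by
  choose ρ hρ0 hρ using exists_pfTerm_invariant hM A hA
  -- Sorting the permutations by the position `p` of the index `0`.
  have h1 : ∑ σ, pfTerm A σ = ∑ p : Fin (M + 2), ∑ σ : Equiv.Perm (Fin (M + 2)),
      if σ p = 0 then pfTerm A σ else 0 := by
    rw [Finset.sum_comm]
    refine Finset.sum_congr rfl fun σ _ => ?_
    rw [Finset.sum_eq_single (σ.symm 0)]
    · simp
    · intro p _ hp
      rw [if_neg]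
      rintro h
      exact hp (by rw [← h, Equiv.symm_apply_apply])
    · simp
  have h2 : ∀ p : Fin (M + 2), (∑ σ : Equiv.Perm (Fin (M + 2)),
      if σ p = 0 then pfTerm A σ else 0) = ∑ σ : Equiv.Perm (Fin (M + 2)),
      if σ 0 = 0 then pfTerm A σ else 0 := by
    intro p
    rw [← Equiv.sum_comp (Equiv.mulRight (ρ p)⁻¹)
      (fun σ : Equiv.Perm (Fin (M + 2)) => if σ p = 0 then pfTerm A σ else 0)]
    refine Finset.sum_congr rfl fun σ _ => ?_
    have e1 : pfTerm A (σ * (ρ p)⁻¹) = pfTerm A σ := by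
      rw [← hρ p (σ * (ρ p)⁻¹), inv_mul_cancel_right]
    have e2 : (ρ p)⁻¹ p = 0 := by rw [Equiv.Perm.inv_eq_iff_eq, hρ0]
    rw [Equiv.coe_mulRight, e1, Equiv.Perm.mul_apply, e2]
  have h3 : (∑ σ : Equiv.Perm (Fin (M + 2)), if σ 0 = 0 then pfTerm A σ else 0) =
      ∑ τ : Equiv.Perm (Fin (M + 1)), pfTerm A (Equiv.Perm.decomposeFin.symm (0, τ)) := by
    rw [← Equiv.sum_comp Equiv.Perm.decomposeFin.symm, Fintype.sum_prod_type,
      Finset.sum_eq_single 0]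
    · simp
    · intro b _ hb
      simp [hb]
    · simp
  rw [h1, Finset.sum_congr rfl fun p _ => h2 p, Finset.sum_const, Finset.card_univ, Fintype.card_fin,
    nsmul_eq_mul, h3, sum_perm_succ]
  congr 1
  refine Finset.sum_congr rfl fun j _ => ?_
  rw [Finset.mul_sum]
  refine Finset.sum_congr rfl fun ρ' _ => ?_
  have hd : (M + 2) / 2 = M / 2 + 1 := by omega
  simp only [pfTerm]
  rw [← Equiv.prod_comp (finCongr hd.symm), Fin.prod_univ_succ]
  have v0 : (Equiv.Perm.decomposeFin.symm ((0 : Fin (M + 2)),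
      j.cycleRange.symm * Equiv.Perm.decomposeFin.symm (0, ρ'))) 0 = 0 := by simp
  have v1 : ∀ i : Fin (M + 1), (Equiv.Perm.decomposeFin.symm ((0 : Fin (M + 2)),
      j.cycleRange.symm * Equiv.Perm.decomposeFin.symm (0, ρ'))) i.succ =
      (j.cycleRange.symm (Equiv.Perm.decomposeFin.symm (0, ρ') i)).succ := by simp
  have v2 : (Equiv.Perm.decomposeFin.symm ((0 : Fin (M + 1)), ρ')) 0 = 0 := by simp
  have v3 : ∀ i : Fin M, (Equiv.Perm.decomposeFin.symm ((0 : Fin (M + 1)), ρ')) i.succ =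
      (ρ' i).succ := by simp
  have w0 : (⟨2 * ((finCongr hd.symm 0 : Fin ((M + 2) / 2)) : ℕ), by simp⟩ : Fin (M + 2)) = 0 := rfl
  have w1 : (⟨2 * ((finCongr hd.symm 0 : Fin ((M + 2) / 2)) : ℕ) + 1, by simp⟩ : Fin (M + 2)) =
    (0 : Fin (M + 1)).succ := rfl
  have w2 : ∀ i : Fin (M / 2), (⟨2 * ((finCongr hd.symm i.succ : Fin ((M + 2) / 2)) : ℕ),
      by simp; omega⟩ : Fin (M + 2)) = (⟨2 * i, by omega⟩ : Fin M).succ.succ :=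
    fun i => Fin.ext (by simp; ring)
  have w3 : ∀ i : Fin (M / 2), (⟨2 * ((finCongr hd.symm i.succ : Fin ((M + 2) / 2)) : ℕ) + 1,
      by simp; omega⟩ : Fin (M + 2)) = (⟨2 * i + 1, by omega⟩ : Fin M).succ.succ :=
    fun i => Fin.ext (by simp; ring)
  rw [w0, w1, v0, v1, v2, Fin.cycleRange_symm_zero]
  simp only [w2, w3, v1, v3, Fin.cycleRange_symm_succ, Matrix.submatrix_apply]
  rw [Equiv.Perm.decomposeFin.symm_sign, Equiv.Perm.sign_mul, Equiv.Perm.decomposeFin.symm_sign,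
    Equiv.Perm.sign_symm, Fin.sign_cycleRange]
  simp only [if_true, one_mul, Units.val_mul, Units.val_pow_eq_pow_val, Units.val_neg,
    Units.val_one, Int.cast_mul, Int.cast_pow, Int.cast_neg, Int.cast_one]
  ring

theorem pfaffian_expand_zero {M : ℕ} (A : Matrix (Fin (M + 2)) (Fin (M + 2)) S)
    (hA : ∀ i j, A i j = -A j i) :
    pfaffian A = ∑ j : Fin (M + 1), (-1) ^ (j : ℕ) * A 0 j.succ *
      pfaffian (A.submatrix (fun i => (j.succAbove i).succ) (fun i => (j.succAbove i).succ)) := by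
  by_cases hM : Even M
  · have hM2 : Even (M + 2) := by simpa [Nat.even_add] using hM
    simp only [pfaffian_eq, if_pos hM, if_pos hM2]
    rw [sum_pfTerm hM A hA, Finset.mul_sum, Finset.smul_sum]
    refine Finset.sum_congr rfl fun j _ => ?_
    rw [mul_smul_comm, ← nsmul_eq_mul, ← Nat.cast_smul_eq_nsmul ℚ, smul_smul]
    congr 1
    obtain ⟨m, rfl⟩ := hM
    have e1 : (m + m + 2) / 2 = m + 1 := by omega
    have e2 : (m + m) / 2 = m := by omega
    rw [e1, e2, Nat.factorial_succ]
    have := Nat.factorial_ne_zero m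
    push_cast
    field_simp
    ring
  · have hM2 : ¬ Even (M + 2) := by simpa [Nat.even_add] using hM
    simp [pfaffian_eq, hM, hM2]

/-- Expansion of a Pfaffian along an arbitrary row. -/
theorem pfaffian_expand {M : ℕ} (A : Matrix (Fin (M + 2)) (Fin (M + 2)) S)
    (hA : ∀ i j, A i j = -A j i) (p : Fin (M + 2)) :
    pfaffian A = (-1) ^ (p : ℕ) * ∑ j : Fin (M + 1), (-1) ^ (j : ℕ) * A p (p.succAbove j) *
      pfaffian (A.submatrix (fun i => p.succAbove (j.succAbove i))
        (fun i => p.succAbove (j.succAbove i))) := by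
  have h := pfaffian_submatrix_perm A p.cycleRange.symm
  rw [pfaffian_expand_zero (A.submatrix p.cycleRange.symm p.cycleRange.symm)
    (fun i j => hA _ _), Equiv.Perm.sign_symm, Fin.sign_cycleRange] at h
  -- The sign of the cycle bringing row `p` to the top is moved to the other side, being its own
  -- inverse.
  have h2 : pfaffian A = (-1) ^ (p : ℕ) * ((((-1 : ℤˣ) ^ (p : ℕ) : ℤˣ) : ℤ) * pfaffian A) := by
    rw [← mul_assoc]
    simp [← mul_pow]
  rw [h2, ← h]
  simp only [Matrix.submatrix_apply, Fin.cycleRange_symm_zero, Fin.cycleRange_symm_succ,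
    Matrix.submatrix_submatrix, Function.comp_def]

theorem pfaffian_eq_zero_of_row {N : ℕ} (A : Matrix (Fin N) (Fin N) S)
    (hA : ∀ i j, A i j = -A j i) (p : Fin N) (hp : ∀ j, A p j = 0) : pfaffian A = 0 := by
  match N with
  | 0 => exact p.elim0
  | 1 => simp [pfaffian]
  | M + 2 => rw [pfaffian_expand A hA p]; simp [hp]

theorem pfaffian_expand_single {M : ℕ} (A : Matrix (Fin (M + 2)) (Fin (M + 2)) S)
    (hA : ∀ i j, A i j = -A j i) (p : Fin (M + 2)) (j : Fin (M + 1))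
    (hp : ∀ j', j' ≠ j → A p (p.succAbove j') = 0) :
    pfaffian A = (-1) ^ (p + j : ℕ) * A p (p.succAbove j) *
      pfaffian (A.submatrix (fun i => p.succAbove (j.succAbove i))
        (fun i => p.succAbove (j.succAbove i))) := by
  rw [pfaffian_expand A hA p, Finset.sum_eq_single j, pow_add]
  · ring
  · intro b _ hb
    rw [hp b hb]; ring
  · simp

/-! ### The Pfaffian as an alternating map -/

variable {V : Type*} [AddCommGroup V] [Module S V]

/-- The vector in position `p` occurs only in the factor number `p / 2`, on which it acts linearly
through one of the two arguments of `B`. This is the multilinearity needed for `pairProd`. -/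
theorem exists_prod_update (B : V →ₗ[S] V →ₗ[S] S) {N : ℕ} (hN : Even N) (v : Fin N → V)
    (p : Fin N) : ∃ f : V →ₗ[S] S, ∀ x, ∏ i : Fin (N / 2),
      B (Function.update v p x ⟨2 * i, by omega⟩) (Function.update v p x ⟨2 * i + 1, by omega⟩) =
      f x := by
  obtain ⟨m, rfl⟩ := hN
  have hp : (p : ℕ) / 2 < (m + m) / 2 := by omega
  have hrest : ∀ x, ∏ i ∈ Finset.univ.erase (⟨p / 2, hp⟩ : Fin ((m + m) / 2)),
      B (Function.update v p x ⟨2 * i, by omega⟩) (Function.update v p x ⟨2 * i + 1, by omega⟩) =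
      ∏ i ∈ Finset.univ.erase (⟨p / 2, hp⟩ : Fin ((m + m) / 2)),
        B (v ⟨2 * i, by omega⟩) (v ⟨2 * i + 1, by omega⟩) := by
    intro x
    refine Finset.prod_congr rfl fun i hi => ?_
    have hi0 : (i : ℕ) ≠ p / 2 := fun h => Finset.ne_of_mem_erase hi (Fin.ext h)
    rw [Function.update_of_ne, Function.update_of_ne] <;>
      (rw [Ne, Fin.ext_iff]; simp only; omega)
  rcases Nat.even_or_odd' (p : ℕ) with ⟨c, hc | hc⟩
  · refine ⟨(∏ i ∈ Finset.univ.erase (⟨p / 2, hp⟩ : Fin ((m + m) / 2)),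
        B (v ⟨2 * i, by omega⟩) (v ⟨2 * i + 1, by omega⟩)) •
        B.flip (v ⟨2 * (p / 2) + 1, by omega⟩), fun x => ?_⟩
    have e1 : (⟨2 * ((⟨p / 2, hp⟩ : Fin ((m + m) / 2)) : ℕ), by simp; omega⟩ : Fin (m + m)) = p :=
      Fin.ext (by simp; omega)
    rw [← Finset.mul_prod_erase _ _ (Finset.mem_univ (⟨p / 2, hp⟩ : Fin ((m + m) / 2))), hrest, e1,
      Function.update_self, Function.update_of_ne, LinearMap.smul_apply, LinearMap.flip_apply,
      smul_eq_mul, mul_comm]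
    rw [Ne, Fin.ext_iff]; simp only; omega
  · refine ⟨(∏ i ∈ Finset.univ.erase (⟨p / 2, hp⟩ : Fin ((m + m) / 2)),
        B (v ⟨2 * i, by omega⟩) (v ⟨2 * i + 1, by omega⟩)) •
        B (v ⟨2 * (p / 2), by omega⟩), fun x => ?_⟩
    have e1 : (⟨2 * ((⟨p / 2, hp⟩ : Fin ((m + m) / 2)) : ℕ) + 1, by simp; omega⟩ : Fin (m + m)) =
      p := Fin.ext (by simp; omega)
    rw [← Finset.mul_prod_erase _ _ (Finset.mem_univ (⟨p / 2, hp⟩ : Fin ((m + m) / 2))), hrest, e1,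
      Function.update_self, Function.update_of_ne, LinearMap.smul_apply,
      smul_eq_mul, mul_comm]
    rw [Ne, Fin.ext_iff]; simp only; omega

/-- The product of the values of a bilinear form on consecutive pairs of vectors. -/
def pairProd (B : V →ₗ[S] V →ₗ[S] S) {N : ℕ} (hN : Even N) :
    MultilinearMap S (fun _ : Fin N => V) S :=
  MultilinearMap.mk' (fun v => ∏ i : Fin (N / 2), B (v ⟨2 * i, by omega⟩) (v ⟨2 * i + 1, by omega⟩))
    (fun v p x y => by
      obtain ⟨f, hf⟩ := exists_prod_update B hN v p
      rw [hf, hf, hf, map_add])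
    (fun v p c x => by
      obtain ⟨f, hf⟩ := exists_prod_update B hN v p
      rw [hf, hf, map_smul])

/-- The Pfaffian of the Gram matrix of a family of vectors with respect to a bilinear form, as an
alternating map. -/
def pfAlt (B : V →ₗ[S] V →ₗ[S] S) (N : ℕ) : V [⋀^Fin N]→ₗ[S] S :=
  if hN : Even N then
    algebraMap ℚ S ((2 ^ (N / 2) * (N / 2)! : ℚ)⁻¹) •
      MultilinearMap.alternatization (pairProd B hN)
  else 0

theorem pfAlt_apply (B : V →ₗ[S] V →ₗ[S] S) {N : ℕ} (v : Fin N → V) :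
    pfAlt B N v = pfaffian (Matrix.of fun i j => B (v i) (v j)) := by
  rw [pfAlt, pfaffian_eq]
  split_ifs with hN
  · rw [AlternatingMap.smul_apply, MultilinearMap.alternatization_apply, algebraMap_smul]
    congr 1
    refine Finset.sum_congr rfl fun σ _ => ?_
    rw [pfTerm, Units.smul_def, zsmul_eq_mul]
    rfl
  · rfl

/-- The strictly decreasing sequences of length `l` of natural numbers less than `P`. -/
def antiSeq (l P : ℕ) : Finset (Fin l → ℕ) := by
  classical
  exact (Fintype.piFinset fun _ => Finset.range P).filter StrictAnti

theorem mem_antiSeq {l P : ℕ} {nu : Fin l → ℕ} :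
    nu ∈ antiSeq l P ↔ (∀ i, nu i < P) ∧ StrictAnti nu := by
  simp [antiSeq]

theorem strictAnti_eq_of_range_eq {l : ℕ} {f g : Fin l → ℕ} (hf : StrictAnti f)
    (hg : StrictAnti g) (h : Set.range f = Set.range g) : f = g := by
  have := (StrictMono.range_inj (f := OrderDual.toDual ∘ f) (g := OrderDual.toDual ∘ g)
    hf.dual_right hg.dual_right).1 (by rw [Set.range_comp, Set.range_comp, h])
  exact this

/-- The Cauchy–Binet expansion of an alternating map. -/
theorem alternating_expand {l : ℕ} (F : V [⋀^Fin l]→ₗ[S] S) (e : ℕ → V) (T : Fin l → ℕ → S)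
    (P : ℕ) :
    F (fun i => ∑ k ∈ Finset.range P, T i k • e k) =
      ∑ nu ∈ antiSeq l P, Matrix.det (Matrix.of fun i j => T i (nu j)) * F (e ∘ nu) := by
  classical
  have h1 := MultilinearMap.map_sum_finset F.toMultilinearMap (fun i k => T i k • e k)
    (fun _ : Fin l => Finset.range P)
  rw [AlternatingMap.coe_multilinearMap] at h1
  rw [h1]
  have h2 : ∀ r : Fin l → ℕ, F (fun i => T i (r i) • e (r i)) = (∏ i, T i (r i)) * F (e ∘ r) := by
    intro r
    have := F.toMultilinearMap.map_smul_univ (fun i => T i (r i)) (e ∘ r)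
    simpa using this
  simp only [h2]
  have h3 : ∀ nu ∈ antiSeq l P, Matrix.det (Matrix.of fun i j => T i (nu j)) * F (e ∘ nu) =
      ∑ σ : Equiv.Perm (Fin l), (∏ i, T i (nu (σ i))) * F (e ∘ (nu ∘ σ)) := by
    intro nu _
    rw [← Matrix.det_transpose, Matrix.det_apply', Finset.sum_mul]
    refine Finset.sum_congr rfl fun σ _ => ?_
    rw [← Function.comp_assoc, F.map_perm, Units.smul_def, zsmul_eq_mul]
    simp only [Matrix.transpose_apply, Matrix.of_apply]
    ring
  rw [Finset.sum_congr rfl h3, ← Finset.sum_product']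
  symm
  refine Finset.sum_of_injOn (fun x : (Fin l → ℕ) × Equiv.Perm (Fin l) => x.1 ∘ x.2) ?_ ?_ ?_ ?_
  · rintro ⟨nu, σ⟩ h ⟨nu', σ'⟩ h' heq
    simp only [Finset.coe_product, Set.mem_prod, Finset.mem_coe, mem_antiSeq] at h h' heq
    have : nu = nu' := by
      refine strictAnti_eq_of_range_eq h.1.2 h'.1.2 ?_
      have := congrArg Set.range heq
      rwa [EquivLike.range_comp, EquivLike.range_comp] at this
    subst this
    refine Prod.ext rfl (Equiv.ext fun i => h.1.2.injective (congrFun heq i))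
  · rintro ⟨nu, σ⟩ h
    simp only [Finset.coe_product, Set.mem_prod, Finset.mem_coe, mem_antiSeq] at h
    simp [h.1.1]
  · intro r hr hr'
    -- Sequences with a repetition contribute nothing. An injective one is uniquely a decreasing
    -- sequence composed with a permutation, found by sorting and then reversing.
    rw [AlternatingMap.map_eq_zero_of_not_injective, mul_zero]
    intro hinj
    have hinj : Function.Injective r := hinj.of_comp
    apply hr'
    set ρ := Tuple.sort r with hρ
    have hm : StrictMono (r ∘ ρ) :=
      (Tuple.monotone_sort r).strictMono_of_injective (hinj.comp ρ.injective)
    refine ⟨(r ∘ ρ ∘ Fin.revPerm, (ρ * Fin.revPerm)⁻¹), ?_, ?_⟩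
    · simp only [Finset.coe_product, Set.mem_prod, Finset.mem_coe, mem_antiSeq, Finset.coe_univ,
        Set.mem_univ, and_true]
      refine ⟨fun i => ?_, fun i j hij => hm (Fin.rev_lt_rev.2 hij)⟩
      simp only [Fintype.mem_piFinset, Finset.mem_range] at hr
      exact hr _
    · funext i
      have : (ρ * Fin.revPerm : Equiv.Perm _) ((ρ * Fin.revPerm : Equiv.Perm _)⁻¹ i) = i :=
        Equiv.apply_symm_apply (ρ * Fin.revPerm : Equiv.Perm _) i
      exact congrArg r this
  · rintro ⟨nu, σ⟩ _
    rfl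

/-- Row of `ℕ ⊕ ι` indices of the matrix `(K, M; -Mᵗ, 0)`. -/
def blockIdx {ι : Type*} {l s : ℕ} (nu : Fin l → ℕ) (c : Fin s → ι) : Fin (l + s) → ℕ ⊕ ι :=
  Fin.append (Sum.inl ∘ nu) (Sum.inr ∘ c)

/-- The matrix `(K, M; -Mᵗ, 0)` with rows and columns indexed by `ℕ ⊕ ι`. -/
def blockForm {ι : Type*} (K : ℕ → ℕ → S) (M : ℕ → ι → S) : ℕ ⊕ ι → ℕ ⊕ ι → S
  | .inl i, .inl j => K i j
  | .inl i, .inr j => M i j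
  | .inr i, .inl j => -M j i
  | .inr _, .inr _ => 0

/-- This exhibits the block matrix as a Gram matrix of one form on `ℕ ⊕ ι` restricted to a list of
indices, so that deletions and repetitions of indices can be treated uniformly. -/
theorem blockPfaffian_eq {ι : Type*} {l s : ℕ} (K : ℕ → ℕ → S) (M : ℕ → ι → S) (nu : Fin l → ℕ)
    (c : Fin s → ι) :
    blockPfaffian (Matrix.of fun i j => K (nu i) (nu j)) (Matrix.of fun i j => M (nu i) (c j)) =
      pfaffian (Matrix.of fun i j => blockForm K M (blockIdx nu c i) (blockIdx nu c j)) := by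
  rw [blockPfaffian]
  congr 1
  ext i j
  refine Fin.addCases (fun i => ?_) (fun i => ?_) i <;>
    refine Fin.addCases (fun j => ?_) (fun j => ?_) j <;>
    simp [blockIdx, blockForm]

/-- An alternating map with the last arguments fixed. -/
def fixRight {l s : ℕ} (F : V [⋀^Fin (l + s)]→ₗ[S] S) (b : Fin s → V) : V [⋀^Fin l]→ₗ[S] S where
  toFun v := F (Fin.append v b)
  map_update_add' v i x y := by
    rename_i inst
    have h : ∀ z, Fin.append (Function.update v i z) b =
        Function.update (Fin.append v b) (Fin.castAdd s i) z := by
      intro z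
      funext k
      refine Fin.addCases (fun k => ?_) (fun k => ?_) k
      · by_cases hk : k = i
        · subst hk; simp
        · rw [Fin.append_left, Function.update_of_ne hk, Function.update_of_ne, Fin.append_left]
          simpa using hk
      · rw [Fin.append_right, Function.update_of_ne, Fin.append_right]
        rw [Ne, Fin.ext_iff]; simp; omega
    rw [h, h, h, F.map_update_add]
  map_update_smul' v i c x := by
    rename_i inst
    have h : ∀ z, Fin.append (Function.update v i z) b =
        Function.update (Fin.append v b) (Fin.castAdd s i) z := by
      intro z
      funext k
      refine Fin.addCases (fun k => ?_) (fun k => ?_) k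
      · by_cases hk : k = i
        · subst hk; simp
        · rw [Fin.append_left, Function.update_of_ne hk, Function.update_of_ne, Fin.append_left]
          simpa using hk
      · rw [Fin.append_right, Function.update_of_ne, Fin.append_right]
        rw [Ne, Fin.ext_iff]; simp; omega
    rw [h, h, F.map_update_smul]
  map_eq_zero_of_eq' v i j h hij := by
    refine F.map_eq_zero_of_eq _ (i := Fin.castAdd s i) (j := Fin.castAdd s j) ?_ ?_
    · rw [Fin.append_left, Fin.append_left, h]
    · simpa using hij

/-- The bilinear form on `(ℕ ⊕ ι) →₀ S` with a given matrix. -/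
def matrixForm {ι : Type*} (G : ι → ι → S) : (ι →₀ S) →ₗ[S] (ι →₀ S) →ₗ[S] S :=
  Finsupp.lsum S fun i => LinearMap.toSpanSingleton S _ (Finsupp.lsum S fun j =>
    LinearMap.toSpanSingleton S S (G i j))

theorem matrixForm_single {ι : Type*} (G : ι → ι → S) (i j : ι) (a b : S) :
    matrixForm G (Finsupp.single i a) (Finsupp.single j b) = a * (b * G i j) := by
  simp [matrixForm]

/-- Minor summation: a Pfaffian under a change of basis in the first block. -/
theorem blockPfaffian_expand {ι : Type*} {l s : ℕ} (K : ℕ → ℕ → S) (M : ℕ → ι → S)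
    (T : Fin l → ℕ → S) (c : Fin s → ι) (P : ℕ) :
    blockPfaffian
      (Matrix.of fun i j => ∑ k ∈ Finset.range P, ∑ k' ∈ Finset.range P, T i k * T j k' * K k k')
      (Matrix.of fun i j => ∑ k ∈ Finset.range P, T i k * M k (c j)) =
      ∑ nu ∈ antiSeq l P, Matrix.det (Matrix.of fun i j => T i (nu j)) *
        blockPfaffian (Matrix.of fun i j => K (nu i) (nu j))
          (Matrix.of fun i j => M (nu i) (c j)) := by
  -- The Pfaffian is an alternating function of the first `l` vectors when the vectors of the second
  -- block are fixed, so the Cauchy–Binet expansion applies to it.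
  set B := matrixForm (blockForm K M) with hB
  have h := alternating_expand (fixRight (pfAlt B (l + s))
    (fun j => Finsupp.single (Sum.inr (c j)) 1)) (fun k => Finsupp.single (Sum.inl k) 1) T P
  have hfix : ∀ v, fixRight (pfAlt B (l + s)) (fun j => Finsupp.single (Sum.inr (c j)) 1) v =
    pfAlt B (l + s) (Fin.append v fun j => Finsupp.single (Sum.inr (c j)) 1) := fun _ => rfl
  simp only [hfix, pfAlt_apply] at h
  refine Eq.trans ?_ (h.trans (Finset.sum_congr rfl fun nu _ => ?_))
  · rw [blockPfaffian]
    congr 1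
    ext i j
    refine Fin.addCases (fun i => ?_) (fun i => ?_) i <;>
      refine Fin.addCases (fun j => ?_) (fun j => ?_) j <;>
      simp [hB, matrixForm_single, blockForm, mul_assoc]
    rw [Finset.sum_comm]
  · rw [blockPfaffian_eq]
    congr 2
    ext i j
    refine Fin.addCases (fun i => ?_) (fun i => ?_) i <;>
      refine Fin.addCases (fun j => ?_) (fun j => ?_) j <;>
      simp [hB, matrixForm_single, blockIdx]

end Pfaffian

/-! ### One-letter transition determinants -/

section Letters

variable {S : Type*} [CommRing S]

/-- The transition weight of an unprimed letter from a row of length `k` to one of length `r`. -/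
def rowWeight (w : ℕ → S) (r k : ℕ) : S :=
  if k ≤ r then ∏ c ∈ Finset.Ico k r, w c else 0

/-- The transition weight of a primed letter from a row of length `k` to one of length `r`. -/
def boxWeight (w : ℕ → S) (r k : ℕ) : S :=
  if r ≤ k + 1 then rowWeight w r k else 0

theorem rowWeight_of_lt (w : ℕ → S) {r k : ℕ} (h : r < k) : rowWeight w r k = 0 :=
  if_neg (not_le.2 h)

theorem rowWeight_self (w : ℕ → S) (r : ℕ) : rowWeight w r r = 1 := by simp [rowWeight]

theorem rowWeight_mul (w : ℕ → S) {r j k : ℕ} (h1 : k ≤ j) (h2 : j ≤ r) :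
    rowWeight w r j * rowWeight w j k = rowWeight w r k := by
  rw [rowWeight, rowWeight, rowWeight, if_pos h1, if_pos h2, if_pos (h1.trans h2), mul_comm,
    Finset.prod_Ico_consecutive _ h1 h2]

/-- A nonzero term needs `nu (σ i)` to be `lam i` or `lam i - 1` for every `i`. Since both sequences
decrease strictly, this forces `σ` to be monotone, hence the identity. -/
theorem det_boxWeight (w : ℕ → S) {l : ℕ} {lam nu : Fin l → ℕ} (hl : StrictAnti lam)
    (hn : StrictAnti nu) :
    Matrix.det (Matrix.of fun i j => boxWeight w (lam i) (nu j)) =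
      ∏ i, boxWeight w (lam i) (nu i) := by
  rw [← Matrix.det_transpose, Matrix.det_apply', Finset.sum_eq_single 1]
  · simp
  · intro σ _ hσ
    by_contra hne
    apply hσ
    have hp : ∀ i, boxWeight w (lam i) (nu (σ i)) ≠ 0 := by
      intro i h0
      apply hne
      rw [Finset.prod_eq_zero (Finset.mem_univ i) (by simpa using h0), mul_zero]
    have hb : ∀ i, lam i ≤ nu (σ i) + 1 ∧ nu (σ i) ≤ lam i := by
      intro i
      have := hp i
      rw [boxWeight] at this
      split_ifs at this with h1
      · refine ⟨h1, ?_⟩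
        by_contra h2
        exact this (rowWeight_of_lt w (not_le.1 h2))
      · exact absurd rfl this
    have hm : Monotone σ := by
      intro i j hij
      rcases hij.eq_or_lt with rfl | hij
      · exact le_rfl
      · refine hn.le_iff_ge.1 ?_
        have h1 := hl hij
        have h2 := (hb i).1
        have h3 := (hb j).2
        omega
    have hs := hm.strictMono_of_injective σ.injective
    ext i
    have := (Subsingleton.elim (OrderIso.ofSurjective (OrderEmbedding.ofStrictMono σ hs)
      σ.surjective) (OrderIso.refl _) : _)
    have h2 := congrArg (fun e : Fin l ≃o Fin l => e i) this
    exact congrArg Fin.val h2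
  · simp

/-- If the sequences interlace, the matrix is upper triangular. Otherwise one row is a multiple of a
later one, because the weight of a row is multiplicative along intermediate lengths
(`rowWeight_mul`). -/
theorem det_rowWeight (w : ℕ → S) {l : ℕ} {lam nu : Fin l → ℕ} (hl : StrictAnti lam)
    (hn : StrictAnti nu) :
    Matrix.det (Matrix.of fun i j => rowWeight w (lam i) (nu j)) =
      if ∀ i j : Fin l, i < j → lam j < nu i then ∏ i, rowWeight w (lam i) (nu i) else 0 := by
  classical
  split_ifs with h
  · rw [Matrix.det_of_isUpperTriangular]
    · rfl
    · intro i j hij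
      exact rowWeight_of_lt w (h j i (by simpa using hij))
  · push Not at h
    -- The first violating row `i` is chosen, with `nu i ≤ lam j`. Columns with `nu c ≤ lam j` are
    -- proportional by multiplicativity; any other column lies before `i`, where minimality makes
    -- both entries vanish.
    obtain ⟨i, ⟨j, hij, hj⟩, hmin⟩ := WellFounded.has_min (wellFounded_lt (α := Fin l))
      {i | ∃ j, i < j ∧ nu i ≤ lam j} h
    rw [← Matrix.det_updateRow_add_smul_self _ hij.ne (-rowWeight w (lam i) (lam j))]
    apply Matrix.det_eq_zero_of_row_eq_zero i
    intro c
    simp only [Matrix.updateRow_self, Pi.add_apply, Pi.smul_apply, Matrix.of_apply, smul_eq_mul]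
    by_cases hc : nu c ≤ lam j
    · rw [neg_mul, rowWeight_mul w hc (hl hij).le, add_neg_cancel]
    · have hci : c < i := by
        by_contra hci
        exact hc ((hn.antitone (not_lt.1 hci)).trans hj)
      have : lam i < nu c := by
        by_contra h2
        exact hmin c ⟨i, hci, not_lt.1 h2⟩ hci
      rw [rowWeight_of_lt w this, rowWeight_of_lt w (not_le.1 hc), mul_zero, add_zero]


/-- The skew shape `lam / nu` is a strip which may be filled with a single letter. -/
def IsStrip {l : ℕ} (unprimed : Bool) (lam nu : Fin l → ℕ) : Prop :=
  (∀ i, nu i ≤ lam i) ∧ (unprimed = true → ∀ i j : Fin l, i < j → lam j < nu i) ∧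
    (unprimed = false → ∀ i, lam i ≤ nu i + 1)

/-- The transition weight of a letter. -/
def stepWeight (unprimed : Bool) (w : ℕ → S) : ℕ → ℕ → S :=
  if unprimed then rowWeight w else boxWeight w

open Classical in
theorem det_stepWeight (b : Bool) (w : ℕ → S) {l : ℕ} {lam nu : Fin l → ℕ} (hl : StrictAnti lam)
    (hn : StrictAnti nu) :
    Matrix.det (Matrix.of fun i j => stepWeight b w (lam i) (nu j)) =
      if IsStrip b lam nu then ∏ i, ∏ c ∈ Finset.Ico (nu i) (lam i), w c else 0 := by
  by_cases hle : ∀ i, nu i ≤ lam i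
  · cases b
    · simp only [stepWeight, IsStrip, Bool.false_eq_true, if_false, det_boxWeight w hl hn]
      split_ifs with h
      · refine Finset.prod_congr rfl fun i _ => ?_
        rw [boxWeight, if_pos (h.2.2 trivial i), rowWeight, if_pos (h.1 i)]
      · have : ∃ i, ¬ lam i ≤ nu i + 1 := by
          by_contra h2
          push Not at h2
          exact h ⟨hle, by simp, fun _ => h2⟩
        obtain ⟨i, hi⟩ := this
        exact Finset.prod_eq_zero (Finset.mem_univ i) (if_neg hi)
    · simp only [stepWeight, IsStrip, if_true, det_rowWeight w hl hn]
      by_cases h : ∀ i j : Fin l, i < j → lam j < nu i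
      · rw [if_pos h, if_pos ⟨hle, fun _ => h, by simp⟩]
        exact Finset.prod_congr rfl fun i _ => if_pos (hle i)
      · rw [if_neg h, if_neg fun h2 => h (h2.2.1 trivial)]
  · rw [if_neg fun h => hle h.1]
    push Not at hle
    obtain ⟨i, hi⟩ := hle
    cases b
    · simp only [stepWeight, Bool.false_eq_true, if_false, det_boxWeight w hl hn]
      refine Finset.prod_eq_zero (Finset.mem_univ i) ?_
      rw [boxWeight, rowWeight_of_lt w hi, ite_self]
    · simp only [stepWeight, if_true, det_rowWeight w hl hn]
      split_ifs
      · exact Finset.prod_eq_zero (Finset.mem_univ i) (rowWeight_of_lt w hi)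
      · rfl

end Letters

/-! ### Shifted diagrams -/

theorem mem_shiftedDiagram {l : ℕ} {lam : Fin l → ℕ} {p : ℕ × ℕ} :
    p ∈ shiftedDiagram lam ↔ ∃ i : Fin l, p.1 = i ∧ p.1 ≤ p.2 ∧ p.2 < i + lam i := by
  simp only [shiftedDiagram, Finset.mem_biUnion, Finset.mem_univ, true_and, Finset.mem_image,
    Finset.mem_range]
  constructor
  · rintro ⟨i, c, hc, rfl⟩
    exact ⟨i, rfl, by simp, by simpa using hc⟩
  · rintro ⟨i, h1, h2, h3⟩
    exact ⟨i, p.2 - i, by omega, Prod.ext (by simp [h1]) (by simp; omega)⟩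

theorem mk_mem_shiftedDiagram {l : ℕ} {lam : Fin l → ℕ} {i : Fin l} {j : ℕ} :
    ((i : ℕ), j) ∈ shiftedDiagram lam ↔ (i : ℕ) ≤ j ∧ j < i + lam i := by
  rw [mem_shiftedDiagram]
  constructor
  · rintro ⟨i', h1, h2, h3⟩
    have : i = i' := Fin.ext h1
    subst this
    exact ⟨h2, h3⟩
  · rintro ⟨h2, h3⟩
    exact ⟨i, rfl, h2, h3⟩

/-- The right ends of the rows of a shifted diagram move weakly to the left from one row to the
next. -/
theorem add_le_add_of_strictAnti {l : ℕ} {lam : Fin l → ℕ} (h : StrictAnti lam) {i j : Fin l}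
    (hij : i ≤ j) : (j : ℕ) + lam j ≤ i + lam i := by
  obtain ⟨j, hj⟩ := j
  obtain ⟨i, hi⟩ := i
  replace hij : i ≤ j := hij
  induction j, hij using Nat.le_induction with
  | base => exact le_rfl
  | succ j hij ih =>
    have h1 := ih (by omega)
    have h2 := h (show (⟨j, by omega⟩ : Fin l) < ⟨j + 1, hj⟩ from Fin.mk_lt_mk.2 (Nat.lt_succ_self j))
    change j + lam ⟨j, by omega⟩ ≤ i + lam ⟨i, hi⟩ at h1
    change j + 1 + lam ⟨j + 1, hj⟩ ≤ i + lam ⟨i, hi⟩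
    omega

/-- Shifted diagrams are closed under moving up (inside the region `i ≤ j`) and to the left. -/
theorem mem_shiftedDiagram_of_le {l : ℕ} {lam : Fin l → ℕ} (h : StrictAnti lam) {i j i' j' : ℕ}
    (hm : (i, j) ∈ shiftedDiagram lam) (hi : i' ≤ i) (hj : j' ≤ j) (hij : i' ≤ j') :
    (i', j') ∈ shiftedDiagram lam := by
  obtain ⟨k, h1, h2, h3⟩ := mem_shiftedDiagram.1 hm
  simp only at h1 h2 h3
  have hk : i' < l := by omega
  have := add_le_add_of_strictAnti h (i := ⟨i', hk⟩) (j := k) (Fin.le_def.2 (by simp; omega))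
  simp only at this
  exact mem_shiftedDiagram.2 ⟨⟨i', hk⟩, rfl, hij, by simp only; omega⟩

theorem shiftedDiagram_subset {l : ℕ} {lam nu : Fin l → ℕ} :
    shiftedDiagram nu ⊆ shiftedDiagram lam ↔ ∀ i, nu i ≤ lam i := by
  constructor
  · intro h i
    by_contra hi
    have h1 : ((i : ℕ), (i : ℕ) + lam i) ∈ shiftedDiagram nu :=
      mk_mem_shiftedDiagram.2 ⟨by omega, by omega⟩
    have h2 := (mk_mem_shiftedDiagram.1 (h h1)).2
    omega
  · intro h p hp
    obtain ⟨i, h1, h2, h3⟩ := mem_shiftedDiagram.1 hp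
    exact mem_shiftedDiagram.2 ⟨i, h1, h2, h3.trans_le (by have := h i; omega)⟩

/-- The box at offset `c` in row `i` of a shifted diagram is `(i, i + c)`, so the index `j - i` of
the parameter is the offset in the row. This is why the weights of a strip factor over rows. -/
theorem prod_shiftedDiagram_sdiff {S : Type*} [CommRing S] {l : ℕ} {lam nu : Fin l → ℕ}
    (w : ℕ → S) :
    ∏ p ∈ shiftedDiagram lam \ shiftedDiagram nu, w (p.2 - p.1) =
      ∏ i, ∏ c ∈ Finset.Ico (nu i) (lam i), w c := by
  rw [Finset.prod_sigma']
  symm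
  refine Finset.prod_bij (fun x _ => ((x.1 : ℕ), (x.1 : ℕ) + x.2)) ?_ ?_ ?_ ?_
  · rintro ⟨i, c⟩ h
    simp only [Finset.mem_sigma, Finset.mem_univ, true_and, Finset.mem_Ico] at h
    rw [Finset.mem_sdiff, mk_mem_shiftedDiagram, mk_mem_shiftedDiagram]
    simp only
    omega
  · rintro ⟨i, c⟩ _ ⟨i', c'⟩ _ h
    simp only [Prod.mk.injEq] at h
    obtain ⟨h1, h2⟩ := h
    have : i = i' := Fin.ext h1
    subst this
    have : c = c' := by omega
    subst this
    rfl
  · rintro ⟨i, j⟩ h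
    rw [Finset.mem_sdiff] at h
    obtain ⟨k, h1, h2, h3⟩ := mem_shiftedDiagram.1 h.1
    simp only at h1 h2 h3
    subst h1
    have h4 := h.2
    rw [mk_mem_shiftedDiagram] at h4
    refine ⟨⟨k, j - k⟩, ?_, ?_⟩
    · simp only [Finset.mem_sigma, Finset.mem_univ, true_and, Finset.mem_Ico]
      omega
    · simp only [Prod.mk.injEq, true_and]; omega
  · rintro ⟨i, c⟩ _
    simp

/-! ### Letters -/

/-- The position of a letter in the alphabet. -/
def Letter.code {n : ℕ} (γ : Letter n) : ℕ :=
  4 * (γ.index : ℕ) + 2 * γ.barred.toNat + γ.unprimed.toNat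

theorem Letter.code_lt_code {n : ℕ} {γ δ : Letter n} : γ.code < δ.code ↔ γ < δ := by
  have h : γ < δ ↔ γ.index < δ.index ∨ γ.index = δ.index ∧
      (γ.barred < δ.barred ∨ γ.barred = δ.barred ∧ γ.unprimed < δ.unprimed) := by
    rw [Prod.Lex.lt_iff, Prod.Lex.lt_iff]
    rfl
  have key : ∀ (i j : ℕ) (b b' c c' : Bool), 4 * i + 2 * b.toNat + c.toNat <
      4 * j + 2 * b'.toNat + c'.toNat ↔ i < j ∨ i = j ∧ (b < b' ∨ b = b' ∧ c < c') := by
    intro i j b b' c c'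
    have htf : ¬ (true < false) := by decide
    cases b <;> cases b' <;> cases c <;> cases c' <;> simp [htf] <;> omega
  rw [h, Fin.ext_iff]
  exact key _ _ _ _ _ _

theorem Letter.code_injective {n : ℕ} : Function.Injective (Letter.code (n := n)) := by
  intro γ δ h
  rcases lt_trichotomy γ δ with h1 | h1 | h1
  · exact absurd h (Letter.code_lt_code.2 h1).ne
  · exact h1
  · exact absurd h (Letter.code_lt_code.2 h1).ne'

theorem Letter.code_le_code {n : ℕ} {γ δ : Letter n} : γ.code ≤ δ.code ↔ γ ≤ δ := by
  rw [← not_lt, ← not_lt, Letter.code_lt_code]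

theorem Letter.index_lt_iff {n : ℕ} {γ : Letter n} {k : ℕ} :
    (γ.index : ℕ) < k ↔ γ.code < 4 * k := by
  have h1 := Bool.toNat_le γ.barred
  have h2 := Bool.toNat_le γ.unprimed
  rw [Letter.code]
  omega


/-! ### Splitting off the largest letter -/

section Tableaux

variable {R : Type*} [CommRing R] (a : ℕ → R) {n : ℕ}

/-- Tableaux with the first `N` letters in which every diagonal box outside the last row of a shape
with `l` rows has index less than `k`. -/
def IsPartialTableau (N k l : ℕ) {D : Finset (ℕ × ℕ)} (T : D → Letter n) : Prop :=
  IsTableau T ∧ (∀ p, (T p).code < N) ∧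
    ∀ p : D, p.1.1 = p.1.2 → p.1.1 + 1 < l → ((T p).index : ℕ) < k

open Classical in
/-- The sum of the weights of the tableaux `IsPartialTableau`. -/
def partialSum (n N k l : ℕ) (D : Finset (ℕ × ℕ)) : Laurent R n :=
  ∑ T : D → Letter n with IsPartialTableau N k l T, facWeight a T

open Classical in
/-- `partialSum` for the skew shape `lam / mu`, which is zero unless `mu ⊆ lam`. -/
def skewSum (n N k : ℕ) {l m : ℕ} (lam : Fin l → ℕ) (mu : Fin m → ℕ) : Laurent R n :=
  if shiftedDiagram mu ⊆ shiftedDiagram lam then partialSum a n N k l (skewDiagram lam mu) else 0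

/-- The shape `nu` is the part of a filling `T` of `lam / mu` with the first `N` letters. -/
def IsInnerShape (N : ℕ) {l m : ℕ} (lam : Fin l → ℕ) (mu : Fin m → ℕ)
    (T : skewDiagram lam mu → Letter n) (nu : Fin l → ℕ) : Prop :=
  shiftedDiagram nu ⊆ shiftedDiagram lam ∧ shiftedDiagram mu ⊆ shiftedDiagram nu ∧
    ∀ p, (T p).code < N ↔ p.1 ∈ shiftedDiagram nu

variable {N k l m : ℕ} {lam nu : Fin l → ℕ} {mu : Fin m → ℕ}

theorem IsInnerShape.unique {T : skewDiagram lam mu → Letter n} {nu' : Fin l → ℕ}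
    (h : IsInnerShape N lam mu T nu) (h' : IsInnerShape N lam mu T nu') : nu = nu' := by
  have key : ∀ {nu nu' : Fin l → ℕ}, IsInnerShape N lam mu T nu → IsInnerShape N lam mu T nu' →
      shiftedDiagram nu ⊆ shiftedDiagram nu' := by
    intro nu nu' h h' p hp
    by_cases hm : p ∈ shiftedDiagram mu
    · exact h'.2.1 hm
    · exact (h'.2.2 ⟨p, Finset.mem_sdiff.2 ⟨h.1 hp, hm⟩⟩).1
        ((h.2.2 ⟨p, Finset.mem_sdiff.2 ⟨h.1 hp, hm⟩⟩).2 hp)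
  have h1 := shiftedDiagram_subset.1 (key h h')
  have h2 := shiftedDiagram_subset.1 (key h' h)
  exact funext fun i => le_antisymm (h1 i) (h2 i)

/-- The boxes of `mu` together with those carrying one of the first `N` letters form a set closed
under moves to the left and upwards, hence a shifted diagram. Strictness with exactly `l` rows is
where the diagonal clause of `IsPartialTableau` is needed. -/
theorem exists_isInnerShape (hl : StrictAnti lam) (hm : StrictAnti mu)
    (hsub : shiftedDiagram mu ⊆ shiftedDiagram lam) (hN : 4 * k ≤ N)
    {T : skewDiagram lam mu → Letter n} {N' : ℕ} (hT : IsPartialTableau N' k l T) :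
    ∃ nu : Fin l → ℕ, StrictAnti nu ∧ IsInnerShape N lam mu T nu := by
  classical
  set P : ℕ × ℕ → Prop := fun p => p ∈ shiftedDiagram mu ∨
    ∃ h : p ∈ skewDiagram lam mu, (T ⟨p, h⟩).code < N with hP
  have hrow : ∀ i j j' : ℕ, P (i, j) → i ≤ j' → j' ≤ j → P (i, j') := by
    rintro i j j' (h | ⟨h, hc⟩) h1 h2
    · exact Or.inl (mem_shiftedDiagram_of_le hm h le_rfl h2 h1)
    · by_cases hmu : (i, j') ∈ shiftedDiagram mu
      · exact Or.inl hmu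
      · refine Or.inr ⟨Finset.mem_sdiff.2 ⟨mem_shiftedDiagram_of_le hl
          (Finset.mem_sdiff.1 h).1 le_rfl h2 h1, hmu⟩, lt_of_le_of_lt ?_ hc⟩
        exact Letter.code_le_code.2 (hT.1.row_weak ⟨(i, j'), _⟩ ⟨(i, j), _⟩ rfl h2)
  have hcol : ∀ i i' j : ℕ, P (i, j) → i' ≤ i → i ≤ j → P (i', j) := by
    rintro i i' j (h | ⟨h, hc⟩) h1 h2
    · exact Or.inl (mem_shiftedDiagram_of_le hm h h1 le_rfl (h1.trans h2))
    · by_cases hmu : (i', j) ∈ shiftedDiagram mu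
      · exact Or.inl hmu
      · refine Or.inr ⟨Finset.mem_sdiff.2 ⟨mem_shiftedDiagram_of_le hl
          (Finset.mem_sdiff.1 h).1 h1 le_rfl (h1.trans h2), hmu⟩, lt_of_le_of_lt ?_ hc⟩
        exact Letter.code_le_code.2 (hT.1.col_weak ⟨(i', j), _⟩ ⟨(i, j), _⟩ rfl h1)
  -- Closure under moves to the left makes the selected offsets an initial segment, so their number
  -- is the row length.
  set nu : Fin l → ℕ := fun i =>
    ((Finset.range (lam i)).filter fun c => P ((i : ℕ), (i : ℕ) + c)).card with hnu
  have hnu2 : ∀ (i : Fin l) (c : ℕ), c < nu i ↔ c < lam i ∧ P ((i : ℕ), (i : ℕ) + c) := by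
    intro i c
    set s := (Finset.range (lam i)).filter fun c => P ((i : ℕ), (i : ℕ) + c) with hs
    have hlow : ∀ c ∈ s, ∀ c' ≤ c, c' ∈ s := by
      intro c hc c' hc'
      rw [hs, Finset.mem_filter, Finset.mem_range] at hc ⊢
      exact ⟨by omega, hrow _ _ _ hc.2 (by omega) (by omega)⟩
    have hiff : c < s.card ↔ c ∈ s := by
      constructor
      · intro h
        by_contra hc
        have : s ⊆ Finset.range c := fun x hx =>
          Finset.mem_range.2 (by by_contra h2; exact hc (hlow x hx c (not_lt.1 h2)))
        have := Finset.card_le_card this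
        rw [Finset.card_range] at this
        omega
      · intro h
        have : Finset.range (c + 1) ⊆ s := fun x hx =>
          hlow c h x (Nat.lt_succ_iff.1 (Finset.mem_range.1 hx))
        have := Finset.card_le_card this
        rw [Finset.card_range] at this
        omega
    rw [show nu i = s.card from rfl, hiff, hs, Finset.mem_filter, Finset.mem_range]
  have hPlam : ∀ p, P p → p ∈ shiftedDiagram lam := by
    rintro p (h | ⟨h, -⟩)
    · exact hsub h
    · exact (Finset.mem_sdiff.1 h).1
  have hmem : ∀ p, p ∈ shiftedDiagram nu ↔ P p := by
    rintro ⟨i, j⟩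
    constructor
    · intro h
      obtain ⟨i', h1, h2, h3⟩ := mem_shiftedDiagram.1 h
      simp only at h1 h2 h3
      subst h1
      have := ((hnu2 i' (j - i')).1 (by omega)).2
      rwa [Nat.add_sub_cancel' h2] at this
    · intro h
      obtain ⟨i', h1, h2, h3⟩ := mem_shiftedDiagram.1 (hPlam _ h)
      simp only at h1 h2 h3
      subst h1
      rw [mk_mem_shiftedDiagram]
      have := (hnu2 i' (j - i')).2 ⟨by omega, by rwa [Nat.add_sub_cancel' h2]⟩
      omega
  refine ⟨nu, fun i j hij => ?_, fun p hp => hPlam p ((hmem p).1 hp),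
    fun p hp => (hmem p).2 (Or.inl hp), fun p => ?_⟩
  · have hij' : (i : ℕ) < j := hij
    have hlij := hl hij
    rcases Nat.eq_zero_or_pos (nu j) with h0 | h0
    -- If row `j` is empty, row `i` must not be. Its diagonal box is not in the last row, so its
    -- letter has index less than `k`, and `4 * k ≤ N` puts it among the first `N` letters.
    · rw [h0, hnu2]
      refine ⟨by omega, ?_⟩
      by_cases hmu : ((i : ℕ), (i : ℕ) + 0) ∈ shiftedDiagram mu
      · exact Or.inl hmu
      · have hD : ((i : ℕ), (i : ℕ) + 0) ∈ skewDiagram lam mu :=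
          Finset.mem_sdiff.2 ⟨mk_mem_shiftedDiagram.2 ⟨by omega, by omega⟩, hmu⟩
        refine Or.inr ⟨hD, ?_⟩
        have := hT.2.2 ⟨_, hD⟩ rfl (by simp only; omega)
        exact (Letter.index_lt_iff.1 this).trans_le hN
    · have h1 := (hnu2 j (nu j - 1)).1 (by omega)
      have h2 := hcol _ i _ h1.2 hij'.le (by omega)
      have h3 := (hmem _).2 h2
      rw [mk_mem_shiftedDiagram] at h3
      omega
  · rw [hmem]
    constructor
    · intro h
      exact Or.inr ⟨p.2, h⟩
    · rintro (h | ⟨_, h⟩)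
      · exact absurd h (Finset.mem_sdiff.1 p.2).2
      · exact h

/-- The boxes outside the inner shape all carry `γ`. Two of them in one column (for unprimed `γ`) or
in one row (for primed `γ`) would violate the tableau rules. -/
theorem IsInnerShape.isStrip (hl : StrictAnti lam) (hn : StrictAnti nu)
    {T : skewDiagram lam mu → Letter n} {γ : Letter n} (hT : IsPartialTableau (γ.code + 1) k l T)
    (h : IsInnerShape γ.code lam mu T nu) : IsStrip γ.unprimed lam nu := by
  have hγ : ∀ p, p.1 ∉ shiftedDiagram nu → T p = γ := by
    intro p hp
    have h1 := hT.2.1 p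
    have h2 := mt (h.2.2 p).1 hp
    exact Letter.code_injective (by omega)
  have hD : ∀ {i : Fin l} {j : ℕ}, (i : ℕ) + nu i ≤ j → j < i + lam i →
      ((i : ℕ), j) ∈ skewDiagram lam mu ∧ ((i : ℕ), j) ∉ shiftedDiagram nu := by
    intro i j h1 h2
    have h3 : ((i : ℕ), j) ∉ shiftedDiagram nu := by rw [mk_mem_shiftedDiagram]; omega
    exact ⟨Finset.mem_sdiff.2 ⟨mk_mem_shiftedDiagram.2 ⟨by omega, h2⟩, fun h4 => h3 (h.2.1 h4)⟩, h3⟩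
  refine ⟨shiftedDiagram_subset.1 h.1, fun hu i j hij => ?_, fun hu i => ?_⟩
  · by_contra hlt
    have h1 := add_le_add_of_strictAnti hl hij.le
    have h2 := hn hij
    have hij' : (i : ℕ) < j := hij
    obtain ⟨d1, e1⟩ := hD (i := i) (j := j + lam j - 1) (by omega) (by omega)
    obtain ⟨d2, e2⟩ := hD (i := j) (j := j + lam j - 1) (by omega) (by omega)
    have := hT.1.col_unprimed ⟨_, d1⟩ ⟨_, d2⟩ rfl (by rw [hγ _ e1, hγ _ e2]) (by rwa [hγ _ e1])
    simp only [Subtype.mk.injEq, Prod.mk.injEq] at this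
    omega
  · by_contra hlt
    obtain ⟨d1, e1⟩ := hD (i := i) (j := i + nu i) (by omega) (by omega)
    obtain ⟨d2, e2⟩ := hD (i := i) (j := i + nu i + 1) (by omega) (by omega)
    have := hT.1.row_primed ⟨_, d1⟩ ⟨_, d2⟩ rfl (by rw [hγ _ e1, hγ _ e2]) (by rwa [hγ _ e1])
    simp only [Subtype.mk.injEq, Prod.mk.injEq] at this
    omega

theorem skewDiagram_subset (h : shiftedDiagram nu ⊆ shiftedDiagram lam) :
    skewDiagram nu mu ⊆ skewDiagram lam mu :=
  Finset.sdiff_subset_sdiff h le_rfl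

theorem IsPartialTableau.restrict {D' D : Finset (ℕ × ℕ)} (hD : D' ⊆ D) {T : D → Letter n}
    {N' : ℕ} (hT : IsPartialTableau N' k l T) (hc : ∀ p : D', (T ⟨p.1, hD p.2⟩).code < N) :
    IsPartialTableau N k l fun p : D' => T ⟨p.1, hD p.2⟩ := by
  obtain ⟨⟨h1, h2, h3, h4, h5⟩, -, h6⟩ := hT
  refine ⟨⟨fun p q e1 e2 => h1 _ _ e1 e2, fun p q e1 e2 => h2 _ _ e1 e2, fun p q e1 e2 e3 => ?_,
    fun p q e1 e2 e3 => ?_, fun p q e1 e2 e3 => ?_⟩, hc, fun p e1 e2 => h6 ⟨p.1, hD p.2⟩ e1 e2⟩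
  · have := h3 ⟨p.1, hD p.2⟩ ⟨q.1, hD q.2⟩ e1 e2 e3
    exact Subtype.ext (congrArg (fun x : D => x.1) this)
  · have := h4 ⟨p.1, hD p.2⟩ ⟨q.1, hD q.2⟩ e1 e2 e3
    exact Subtype.ext (congrArg (fun x : D => x.1) this)
  · have := h5 ⟨p.1, hD p.2⟩ ⟨q.1, hD q.2⟩ e1 e2 e3
    exact Subtype.ext (congrArg (fun x : D => x.1) this)

open Classical in
/-- The filling of `D` which extends a filling of `D'` by a constant letter. -/
def extendFilling (γ : Letter n) {D' : Finset (ℕ × ℕ)} (D : Finset (ℕ × ℕ)) (T : D' → Letter n)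
    (p : D) : Letter n :=
  if h : p.1 ∈ D' then T ⟨p.1, h⟩ else γ

/-- The strip conditions give the row and column rules for the new letter. For the diagonal rule,
strictness of `nu` leaves room for a new diagonal box only in the last row, and every other diagonal
letter has index less than `k`, the index of `γ`. -/
theorem IsPartialTableau.extend (hl : StrictAnti lam) (hn : StrictAnti nu) {γ : Letter n}
    (hγ : (γ.index : ℕ) = k) (hs : IsStrip γ.unprimed lam nu) {D D' : Finset (ℕ × ℕ)}
    (hD : D = skewDiagram lam mu) (hDD : D' = skewDiagram nu mu) {T : D' → Letter n}
    (hT : IsPartialTableau γ.code k l T) :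
    IsPartialTableau (γ.code + 1) k l (extendFilling γ D T) := by
  have hDm : ∀ p : D, p.1 ∈ shiftedDiagram lam ∧ p.1 ∉ shiftedDiagram mu := by
    subst hD
    exact fun p => Finset.mem_sdiff.1 p.2
  set U := extendFilling γ D T with hU
  have hin : ∀ (p : D) (h : p.1 ∈ D'), U p = T ⟨p.1, h⟩ := fun p h => dif_pos h
  have hout : ∀ p : D, p.1 ∉ D' → U p = γ := fun p h => dif_neg h
  have hD' : ∀ p : D, p.1 ∈ D' ↔ p.1 ∈ shiftedDiagram nu := by
    intro p
    rw [hDD, skewDiagram, Finset.mem_sdiff]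
    exact and_iff_left (hDm p).2
  have hle : ∀ p : D, U p ≤ γ := by
    intro p
    by_cases h : p.1 ∈ D'
    · rw [hin p h]
      exact (Letter.code_lt_code.1 (hT.2.1 _)).le
    · rw [hout p h]
  have hne : ∀ (p : D), U p = γ → p.1 ∉ D' := by
    intro p h1 h2
    rw [hin p h2] at h1
    have := hT.2.1 ⟨p.1, h2⟩
    rw [h1] at this
    exact lt_irrefl _ this
  have hpos : ∀ p : D, ∃ i : Fin l, p.1.1 = i ∧ p.1.1 ≤ p.1.2 ∧ p.1.2 < i + lam i := fun p =>
    mem_shiftedDiagram.1 (hDm p).1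
  have hlow : ∀ p q : D, q.1 ∈ D' → p.1.1 ≤ q.1.1 → p.1.2 ≤ q.1.2 → p.1 ∈ D' := by
    intro p q hq h1 h2
    rw [hD'] at hq ⊢
    obtain ⟨i, e1, e2, e3⟩ := hpos p
    exact mem_shiftedDiagram_of_le hn hq h1 h2 e2
  have hweak : ∀ p q : D, p.1.1 ≤ q.1.1 → p.1.2 ≤ q.1.2 →
      (p.1.1 = q.1.1 ∨ p.1.2 = q.1.2) → U p ≤ U q := by
    intro p q h1 h2 h3
    by_cases hq : q.1 ∈ D'
    · have hp := hlow p q hq h1 h2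
      rw [hin p hp, hin q hq]
      rcases h3 with h3 | h3
      · exact hT.1.row_weak ⟨p.1, hp⟩ ⟨q.1, hq⟩ h3 h2
      · exact hT.1.col_weak ⟨p.1, hp⟩ ⟨q.1, hq⟩ h3 h1
    · rw [hout q hq]
      exact hle p
  have houtpos : ∀ p : D, p.1 ∉ D' → ∃ i : Fin l, p.1.1 = i ∧ i + nu i ≤ p.1.2 ∧
      p.1.2 < i + lam i := by
    intro p hp
    obtain ⟨i, e1, e2, e3⟩ := hpos p
    refine ⟨i, e1, ?_, e3⟩
    rw [hD', show p.1 = ((i : ℕ), p.1.2) from Prod.ext e1 rfl, mk_mem_shiftedDiagram] at hp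
    omega
  -- A row other than the last has positive length in a strictly decreasing sequence, so its
  -- diagonal box is already in the inner shape or in `mu`.
  have hdiag : ∀ p : D, p.1.1 = p.1.2 → p.1.1 + 1 < l → p.1 ∈ D' := by
    intro p h1 h2
    by_contra hp
    obtain ⟨i, e1, e2, e3⟩ := houtpos p hp
    have := hn (show i < ⟨i + 1, by omega⟩ from Fin.lt_def.2 (by simp))
    omega
  refine ⟨⟨fun p q h1 h2 => hweak p q h1.le h2 (Or.inl h1),
    fun p q h1 h2 => hweak p q h2 h1.le (Or.inr h1), fun p q h1 h2 h3 => ?_,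
    fun p q h1 h2 h3 => ?_, fun p q h1 h2 h3 => ?_⟩, fun p => ?_, fun p h1 h2 => ?_⟩
  · by_cases hp : p.1 ∈ D'
    · have hq : q.1 ∈ D' := by
        by_contra hq
        exact hne p (h2.trans (hout q hq)) hp
      rw [hin p hp] at h2 h3
      rw [hin q hq] at h2
      have := hT.1.row_primed ⟨p.1, hp⟩ ⟨q.1, hq⟩ h1 h2 h3
      exact Subtype.ext (congrArg (fun x : D' => x.1) this)
    · have hq : q.1 ∉ D' := hne q (h2.symm.trans (hout p hp))
      rw [hout p hp] at h3
      obtain ⟨i, e1, e2, e3⟩ := houtpos p hp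
      obtain ⟨i', e1', e2', e3'⟩ := houtpos q hq
      have : i = i' := Fin.ext (by omega)
      subst this
      have := hs.2.2 h3 i
      exact Subtype.ext (Prod.ext h1 (by omega))
  · by_cases hp : p.1 ∈ D'
    · have hq : q.1 ∈ D' := by
        by_contra hq
        exact hne p (h2.trans (hout q hq)) hp
      rw [hin p hp] at h2 h3
      rw [hin q hq] at h2
      have := hT.1.col_unprimed ⟨p.1, hp⟩ ⟨q.1, hq⟩ h1 h2 h3
      exact Subtype.ext (congrArg (fun x : D' => x.1) this)
    · have hq : q.1 ∉ D' := hne q (h2.symm.trans (hout p hp))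
      rw [hout p hp] at h3
      have key : ∀ p q : D, p.1 ∉ D' → q.1 ∉ D' → p.1.2 = q.1.2 → ¬ p.1.1 < q.1.1 := by
        intro p q hp hq h1 hlt
        obtain ⟨i, e1, e2, e3⟩ := houtpos p hp
        obtain ⟨j, e1', e2', e3'⟩ := houtpos q hq
        have hi : (i : ℕ) + 1 < l := by omega
        have f1 := hs.2.1 h3 i ⟨i + 1, hi⟩ (Fin.lt_def.2 (by simp))
        have f2 := add_le_add_of_strictAnti hl (i := ⟨i + 1, hi⟩) (j := j)
          (Fin.le_def.2 (by simp only; omega))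
        simp only at f2
        omega
      have k1 := key p q hp hq h1
      have k2 := key q p hq hp h1.symm
      exact Subtype.ext (Prod.ext (by omega) h1)
  · have hlast : ∀ p q : D, p.1.1 = p.1.2 → q.1.1 = q.1.2 → (U p).index = (U q).index →
        p.1 ∉ D' → p = q := by
      intro p q h1 h2 h3 hp
      rw [hout p hp] at h3
      by_contra hpq
      have hp1 : ¬ p.1.1 + 1 < l := fun h => hp (hdiag p h1 h)
      obtain ⟨i, e1, e2, e3⟩ := hpos p
      obtain ⟨j, f1, f2, f3⟩ := hpos q
      have hij : p.1.1 ≠ q.1.1 := fun h => hpq (Subtype.ext (Prod.ext h (by omega)))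
      have hq1 : q.1.1 + 1 < l := by omega
      have hq := hdiag q h2 hq1
      have := hT.2.2 ⟨q.1, hq⟩ h2 hq1
      rw [hin q hq] at h3
      rw [← h3, hγ] at this
      exact lt_irrefl _ this
    by_cases hp : p.1 ∈ D'
    · by_cases hq : q.1 ∈ D'
      · rw [hin p hp, hin q hq] at h3
        have := hT.1.diag ⟨p.1, hp⟩ ⟨q.1, hq⟩ h1 h2 h3
        exact Subtype.ext (congrArg (fun x : D' => x.1) this)
      · exact (hlast q p h2 h1 h3.symm hq).symm
    · exact hlast p q h1 h2 h3 hp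
  · exact Nat.lt_succ_of_le (Letter.code_le_code.2 (hle p))
  · have hp := hdiag p h1 h2
    rw [hin p hp]
    exact hT.2.2 ⟨p.1, hp⟩ h1 h2

theorem facWeight_extendFilling {D D' : Finset (ℕ × ℕ)} (hD : D' ⊆ D) (γ : Letter n)
    (T : D' → Letter n) :
    facWeight a (extendFilling γ D T) =
      (∏ p ∈ D \ D', letterWeight a γ (p.2 - p.1)) * facWeight a T := by
  classical
  set F : ℕ × ℕ → Laurent R n := fun p =>
    if h : p ∈ D' then letterWeight a (T ⟨p, h⟩) (p.2 - p.1) else letterWeight a γ (p.2 - p.1)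
    with hF
  have h1 : facWeight a (extendFilling γ D T) = ∏ p ∈ D, F p := by
    rw [facWeight, ← Finset.prod_coe_sort D F]
    refine Finset.prod_congr rfl fun p _ => ?_
    by_cases h : p.1 ∈ D' <;> simp [extendFilling, hF, h]
  have h2 : facWeight a T = ∏ p ∈ D', F p := by
    rw [facWeight, ← Finset.prod_coe_sort D' F]
    refine Finset.prod_congr rfl fun p _ => ?_
    simp [hF]
  rw [h1, h2, ← Finset.prod_sdiff hD]
  congr 1
  refine Finset.prod_congr rfl fun p hp => ?_
  exact dif_neg (Finset.mem_sdiff.1 hp).2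

-- Restriction to the inner shape and extension by `γ` are mutually inverse, and the extension
-- multiplies the weight by that of the strip, which is the determinant.
open Classical in
theorem sum_innerShape (hl : StrictAnti lam) (hn : StrictAnti nu) {γ : Letter n}
    (hγ : (γ.index : ℕ) = k) :
    ∑ T : skewDiagram lam mu → Letter n with
      IsPartialTableau (γ.code + 1) k l T ∧ IsInnerShape γ.code lam mu T nu, facWeight a T =
    Matrix.det (Matrix.of fun i j => stepWeight γ.unprimed (letterWeight a γ) (lam i) (nu j)) *
      skewSum a n γ.code k nu mu := by
  rw [det_stepWeight _ _ hl hn, skewSum, partialSum]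
  by_cases hs : IsStrip γ.unprimed lam nu
  swap
  · rw [if_neg hs, zero_mul, Finset.sum_eq_zero]
    intro T hT
    rw [Finset.mem_filter] at hT
    exact absurd (hT.2.2.isStrip hl hn hT.2.1) hs
  by_cases hmu : shiftedDiagram mu ⊆ shiftedDiagram nu
  swap
  · rw [if_neg hmu, mul_zero, Finset.sum_eq_zero]
    intro T hT
    rw [Finset.mem_filter] at hT
    exact absurd hT.2.2.2.1 hmu
  rw [if_pos hs, if_pos hmu, Finset.mul_sum]
  have hsub : shiftedDiagram nu ⊆ shiftedDiagram lam := shiftedDiagram_subset.2 hs.1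
  have hD : skewDiagram nu mu ⊆ skewDiagram lam mu := skewDiagram_subset hsub
  have hmem : ∀ p : skewDiagram lam mu, p.1 ∈ skewDiagram nu mu ↔ p.1 ∈ shiftedDiagram nu :=
    fun p => by
      rw [skewDiagram, Finset.mem_sdiff]
      exact and_iff_left (Finset.mem_sdiff.1 p.2).2
  have hext : ∀ T : skewDiagram lam mu → Letter n, IsPartialTableau (γ.code + 1) k l T →
      IsInnerShape γ.code lam mu T nu →
      extendFilling γ (skewDiagram lam mu)
        (fun p : skewDiagram nu mu => T ⟨p.1, hD p.2⟩) = T := by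
    intro T h1 h2
    funext p
    by_cases hp : p.1 ∈ skewDiagram nu mu
    · exact dif_pos hp
    · refine (dif_neg hp).trans (Letter.code_injective ?_)
      have h3 := h1.2.1 p
      have h4 := mt (h2.2.2 p).1 (mt (hmem p).2 hp)
      omega
  have hw : ∀ T : skewDiagram nu mu → Letter n,
      facWeight a (extendFilling γ (skewDiagram lam mu) T) =
      (∏ i, ∏ c ∈ Finset.Ico (nu i) (lam i), letterWeight a γ c) * facWeight a T := by
    intro T
    rw [facWeight_extendFilling a hD, ← prod_shiftedDiagram_sdiff]
    congr 2
    ext p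
    have h1 := @hsub p
    have h2 := @hmu p
    simp only [skewDiagram, Finset.mem_sdiff]
    tauto
  refine Finset.sum_bij' (fun T _ p => T ⟨p.1, hD p.2⟩)
    (fun T _ => extendFilling γ (skewDiagram lam mu) T) ?_ ?_ ?_ ?_ ?_
  · intro T hT
    rw [Finset.mem_filter] at hT ⊢
    exact ⟨Finset.mem_univ _, hT.2.1.restrict hD fun p => (hT.2.2.2.2 _).2 (Finset.mem_sdiff.1 p.2).1⟩
  · intro T hT
    rw [Finset.mem_filter] at hT ⊢
    refine ⟨Finset.mem_univ _, hT.2.extend hl hn hγ hs rfl rfl, hsub, hmu, fun p => ?_⟩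
    rw [← hmem]
    by_cases hp : p.1 ∈ skewDiagram nu mu
    · have : extendFilling γ (skewDiagram lam mu) T p = T ⟨p.1, hp⟩ := dif_pos hp
      rw [this]
      exact iff_of_true (hT.2.2.1 _) hp
    · have : extendFilling γ (skewDiagram lam mu) T p = γ := dif_neg hp
      rw [this]
      exact iff_of_false (lt_irrefl _) hp
  · intro T hT
    rw [Finset.mem_filter] at hT
    exact hext T hT.2.1 hT.2.2
  · intro T hT
    funext p
    exact dif_pos p.2
  · intro T hT
    rw [Finset.mem_filter] at hT
    rw [← hw, hext T hT.2.1 hT.2.2]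

/-- Splitting off the largest letter of a tableau. -/
theorem skewSum_succ (hl : StrictAnti lam) (hm : StrictAnti mu) {P : ℕ} (hP : ∀ i, lam i < P)
    {γ : Letter n} (hγ : (γ.index : ℕ) = k) :
    skewSum a n (γ.code + 1) k lam mu = ∑ nu ∈ antiSeq l P,
      Matrix.det (Matrix.of fun i j => stepWeight γ.unprimed (letterWeight a γ) (lam i) (nu j)) *
        skewSum a n γ.code k nu mu := by
  classical
  have hk : 4 * k ≤ γ.code := by rw [Letter.code]; omega
  have h1 : ∀ nu ∈ antiSeq l P, _ := fun nu hnu =>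
    (sum_innerShape a (mu := mu) hl (mem_antiSeq.1 hnu).2 hγ).symm
  rw [Finset.sum_congr rfl h1, skewSum]
  simp only [Finset.sum_filter]
  rw [Finset.sum_comm]
  split_ifs with hsub
  · rw [partialSum, Finset.sum_filter]
    refine Finset.sum_congr rfl fun T _ => ?_
    split_ifs with hT
    · obtain ⟨nu, hnu, hin⟩ := exists_isInnerShape hl hm hsub hk hT
      rw [Finset.sum_eq_single nu]
      · rw [if_pos ⟨hT, hin⟩]
      · intro nu' _ hne
        rw [if_neg fun h => hne (h.2.unique hin)]
      · intro h
        refine absurd (mem_antiSeq.2 ⟨fun i => ?_, hnu⟩) h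
        exact (shiftedDiagram_subset.1 hin.1 i).trans_lt (hP i)
    · symm
      exact Finset.sum_eq_zero fun nu _ => if_neg fun h => hT h.1
  · symm
    refine Finset.sum_eq_zero fun T _ => Finset.sum_eq_zero fun nu _ => if_neg fun h => hsub ?_
    exact h.2.2.1.trans h.2.1

open Classical in
/-- The generating function of the tableaux with letters of index less than `k`. -/
def tableauSum (n k : ℕ) (D : Finset (ℕ × ℕ)) : Laurent R n :=
  ∑ T : D → Letter n with IsTableau T ∧ ∀ p, (T p).code < 4 * k, facWeight a T

-- When only letters of index less than `k` are available, the diagonal clause holds automatically,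
-- and the number of rows used to encode the shape no longer matters.
open Classical in
theorem skewSum_eq_tableauSum (n k : ℕ) (nu : Fin l → ℕ) (mu : Fin m → ℕ) :
    skewSum a n (4 * k) k nu mu =
      if shiftedDiagram mu ⊆ shiftedDiagram nu then tableauSum a n k (skewDiagram nu mu) else 0 := by
  rw [skewSum, partialSum, tableauSum]
  refine if_congr Iff.rfl (Finset.sum_congr (Finset.filter_congr fun T _ => ?_) fun _ _ => rfl) rfl
  constructor
  · exact fun h => ⟨h.1, h.2.1⟩
  · exact fun h => ⟨h.1, h.2, fun p _ _ => Letter.index_lt_iff.2 (h.2 p)⟩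

-- With all parts positive, the diagonal rule for index `k` turns into the diagonal clause of
-- `IsPartialTableau`. A diagonal box above the last row has a letter no larger than the one in the
-- last diagonal box, whose index is at most `k`, and the two indices differ.
open Classical in
theorem skewSum_eq_tableauSum_succ (n k : ℕ) (hl : StrictAnti lam) (hpos : ∀ i, 0 < lam i)
    (hm : StrictAnti mu) :
    skewSum a n (4 * k + 4) k lam mu =
      if shiftedDiagram mu ⊆ shiftedDiagram lam then tableauSum a n (k + 1) (skewDiagram lam mu)
      else 0 := by
  rw [skewSum, partialSum, tableauSum]
  refine if_congr Iff.rfl (Finset.sum_congr (Finset.filter_congr fun T _ => ?_) fun _ _ => rfl) rfl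
  constructor
  · exact fun h => ⟨h.1, h.2.1⟩
  · refine fun h => ⟨h.1, h.2, fun p h1 h2 => ?_⟩
    obtain ⟨⟨i, j⟩, hp⟩ := p
    simp only at h1 h2
    subst h1
    have hp2 := (Finset.mem_sdiff.1 hp).2
    have hmu : ∀ i' j', i ≤ i' → i ≤ j' → (i', j') ∉ shiftedDiagram mu := by
      intro i' j' h1 h2 h3
      exact hp2 (mem_shiftedDiagram_of_le hm h3 h1 h2 le_rfl)
    have hll : (l - 1, l - 1) ∈ shiftedDiagram lam := by
      have := hpos ⟨l - 1, by omega⟩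
      exact mem_shiftedDiagram.2 ⟨⟨l - 1, by omega⟩, rfl, le_rfl, by simp only; omega⟩
    -- The comparison goes from `(i, i)` along its row to `(i, l - 1)` and then down to the corner
    -- `(l - 1, l - 1)`. None of these boxes is in `mu`, since `(i, i)` is not.
    have d1 : (i, l - 1) ∈ skewDiagram lam mu := Finset.mem_sdiff.2
      ⟨mem_shiftedDiagram_of_le hl hll (by omega) le_rfl (by omega), hmu _ _ le_rfl (by omega)⟩
    have d2 : (l - 1, l - 1) ∈ skewDiagram lam mu := Finset.mem_sdiff.2
      ⟨hll, hmu _ _ (by omega) (by omega)⟩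
    have e1 := h.1.row_weak ⟨_, hp⟩ ⟨_, d1⟩ rfl (by simp only; omega)
    have e2 := h.1.col_weak ⟨_, d1⟩ ⟨_, d2⟩ rfl (by simp only; omega)
    have e3 := Letter.code_le_code.2 (e1.trans e2)
    have e4 : (T ⟨_, hp⟩).index ≠ (T ⟨_, d2⟩).index := by
      intro h5
      have := h.1.diag ⟨_, hp⟩ ⟨_, d2⟩ rfl rfl h5
      simp only [Subtype.mk.injEq, Prod.mk.injEq] at this
      omega
    have e5 : ((T ⟨_, d2⟩).index : ℕ) < k + 1 := Letter.index_lt_iff.2 (h.2 _)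
    have e6 : ((T ⟨_, hp⟩).index : ℕ) < (T ⟨_, d2⟩).index + 1 := by
      rw [Letter.index_lt_iff]
      have := Letter.index_lt_iff.1 (Nat.lt_succ_self ((T ⟨_, d2⟩).index : ℕ))
      omega
    have e7 : ((T ⟨_, hp⟩).index : ℕ) ≠ (T ⟨_, d2⟩).index := fun h => e4 (Fin.ext h)
    omega

open Classical in
theorem sum_tableaux (n : ℕ) (lam : Fin l → ℕ) (mu : Fin m → ℕ) :
    ∑ T ∈ tableaux n lam mu, facWeight a T =
      if shiftedDiagram mu ⊆ shiftedDiagram lam then tableauSum a n n (skewDiagram lam mu)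
      else 0 := by
  rw [tableaux, tableauSum]
  split_ifs
  · refine Finset.sum_congr (Finset.filter_congr fun T _ => ?_) fun _ _ => rfl
    exact ⟨fun h => ⟨h, fun p => Letter.index_lt_iff.1 (T p).index.2⟩, fun h => h.1⟩
  · rfl

theorem tableauSum_zero (n : ℕ) (D : Finset (ℕ × ℕ)) :
    tableauSum a n 0 D = if D = ∅ then 1 else 0 := by
  classical
  rw [tableauSum]
  split_ifs with h
  · subst h
    rw [Finset.filter_true_of_mem, Finset.univ_unique, Finset.sum_singleton]
    · simp [facWeight]
    · intro T _
      refine ⟨⟨?_, ?_, ?_, ?_, ?_⟩, ?_⟩ <;> rintro ⟨p, hp⟩ <;> exact absurd hp (Finset.notMem_empty p)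
  · obtain ⟨p, hp⟩ := Finset.nonempty_of_ne_empty h
    refine Finset.sum_eq_zero fun T hT => ?_
    exact absurd ((Finset.mem_filter.1 hT).2.2 ⟨p, hp⟩) (by simp)

end Tableaux

/-! ### Power series acting on polynomials, and the factorial basis -/

section Operators

open Polynomial

variable {S : Type*} [CommRing S]

/-- The linear map on polynomials with prescribed values on the powers of `X`. -/
def powMap {V : Type*} [AddCommGroup V] [Module S V] (v : ℕ → V) : S[X] →ₗ[S] V :=
  (Polynomial.basisMonomials S).constr S v

theorem powMap_X_pow {V : Type*} [AddCommGroup V] [Module S V] (v : ℕ → V) (i : ℕ) :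
    powMap (S := S) v (X ^ i) = v i := by
  have := (Polynomial.basisMonomials S).constr_basis S v i
  rw [Polynomial.coe_basisMonomials] at this
  rwa [Polynomial.X_pow_eq_monomial]

theorem linearMap_ext_X_pow {V : Type*} [AddCommGroup V] [Module S V] {f g : S[X] →ₗ[S] V}
    (h : ∀ i, f (X ^ i) = g (X ^ i)) : f = g := by
  refine (Polynomial.basisMonomials S).ext fun i => ?_
  rw [Polynomial.coe_basisMonomials]
  simpa only [Polynomial.X_pow_eq_monomial] using h i

/-- Multiplication by `X` as a linear map. -/
def mulX : S[X] →ₗ[S] S[X] := LinearMap.mulLeft S X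

theorem mulX_apply (f : S[X]) : mulX f = X * f := rfl

/-- The constant coefficient as a linear map. -/
def constCoeff : S[X] →ₗ[S] S := lcoeff S 0

theorem constCoeff_apply (f : S[X]) : constCoeff f = f.coeff 0 := rfl

/-- The constant polynomials as the image of a linear map. -/
def constPoly : S →ₗ[S] S[X] := Algebra.linearMap S S[X]

theorem constPoly_apply (c : S) : constPoly c = C c := rfl

/-- The linear functional `X ^ i ↦ q_i`. -/
def evalSeries (Q : PowerSeries S) : S[X] →ₗ[S] S := powMap fun i => PowerSeries.coeff i Q

theorem evalSeries_X_pow (Q : PowerSeries S) (i : ℕ) :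
    evalSeries Q (X ^ i) = PowerSeries.coeff i Q := powMap_X_pow _ i

theorem evalSeries_one (Q : PowerSeries S) : evalSeries Q 1 = PowerSeries.coeff 0 Q := by
  rw [← pow_zero X, evalSeries_X_pow]

theorem evalSeries_C (Q : PowerSeries S) (c : S) :
    evalSeries Q (C c) = c * PowerSeries.coeff 0 Q := by
  rw [← evalSeries_one, ← smul_eq_mul, ← map_smul, smul_eq_C_mul, mul_one]

/-- The polynomial part of the product of `f(X)` and `Q(X⁻¹)`. -/
def truncMul (Q : PowerSeries S) : S[X] →ₗ[S] S[X] :=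
  powMap fun i => ∑ p ∈ Finset.HasAntidiagonal.antidiagonal i, PowerSeries.coeff p.1 Q • X ^ p.2

theorem truncMul_X_pow (Q : PowerSeries S) (i : ℕ) :
    truncMul Q (X ^ i) = ∑ p ∈ Finset.HasAntidiagonal.antidiagonal i, PowerSeries.coeff p.1 Q • X ^ p.2 :=
  powMap_X_pow _ i

/-- Multiplication by `X` before truncation brings back exactly one discarded term, the one of
degree `-1`, which becomes the constant term. -/
theorem truncMul_X_mul (Q : PowerSeries S) (f : S[X]) :
    truncMul Q (X * f) = X * truncMul Q f + C (evalSeries Q (X * f)) := by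
  have : (truncMul Q).comp mulX = mulX.comp (truncMul Q) +
      constPoly.comp ((evalSeries Q).comp mulX) := by
    refine linearMap_ext_X_pow fun i => ?_
    simp only [LinearMap.comp_apply, LinearMap.add_apply, mulX_apply, constPoly_apply,
      ← pow_succ']
    rw [truncMul_X_pow, truncMul_X_pow, evalSeries_X_pow, Finset.Nat.antidiagonal_succ',
      Finset.sum_cons, Finset.sum_map, Finset.mul_sum, add_comm]
    congr 1
    · refine Finset.sum_congr rfl fun p _ => ?_
      simp [pow_succ']
    · simp [smul_eq_C_mul]
  exact LinearMap.congr_fun this f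

theorem truncMul_one (Q : PowerSeries S) : truncMul Q 1 = C (PowerSeries.coeff 0 Q) := by
  rw [← pow_zero X, truncMul_X_pow]
  simp [smul_eq_C_mul]

theorem truncMul_C (Q : PowerSeries S) (c : S) :
    truncMul Q (C c) = C (c * PowerSeries.coeff 0 Q) := by
  rw [← mul_one (C c), ← smul_eq_C_mul, map_smul, truncMul_one, smul_eq_C_mul, C_mul]

/-- `Q(X⁻¹)` contains no positive powers of `X`, so the negative powers discarded after the first
multiplication cannot influence the polynomial part later. -/
theorem truncMul_mul (Q Q' : PowerSeries S) (f : S[X]) :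
    truncMul (Q * Q') f = truncMul Q (truncMul Q' f) := by
  have : truncMul (Q * Q') = (truncMul Q).comp (truncMul Q') := by
    refine linearMap_ext_X_pow fun i => ?_
    rw [LinearMap.comp_apply]
    induction i with
    | zero =>
      rw [pow_zero, truncMul_one, truncMul_one, truncMul_C, PowerSeries.coeff_mul]
      simp [mul_comm]
    | succ i ih =>
      -- The constant terms of both sides are compared: this is the convolution formula for the
      -- coefficient of degree `i + 1`.
      have key : evalSeries Q (X * truncMul Q' (X ^ i)) +
          PowerSeries.coeff (i + 1) Q' * PowerSeries.coeff 0 Q =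
          PowerSeries.coeff (i + 1) (Q * Q') := by
        rw [mul_comm Q, PowerSeries.coeff_mul, Finset.Nat.antidiagonal_succ', Finset.sum_cons,
          Finset.sum_map, truncMul_X_pow, Finset.mul_sum, map_sum, add_comm]
        congr 1
        refine Finset.sum_congr rfl fun p _ => ?_
        rw [mul_smul_comm, map_smul, ← pow_succ', evalSeries_X_pow]
        simp
      rw [pow_succ', truncMul_X_mul, truncMul_X_mul Q', map_add, truncMul_X_mul, ← ih, add_assoc,
        truncMul_C, ← C_add, ← pow_succ', evalSeries_X_pow, evalSeries_X_pow, key]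
  exact LinearMap.congr_fun this f

theorem coeff_zero_truncMul (Q : PowerSeries S) (f : S[X]) :
    (truncMul Q f).coeff 0 = evalSeries Q f := by
  have : constCoeff.comp (truncMul Q) = evalSeries Q := by
    refine linearMap_ext_X_pow fun i => ?_
    rw [LinearMap.comp_apply, constCoeff_apply, evalSeries_X_pow, truncMul_X_pow, finsetSum_coeff,
      Finset.sum_eq_single (i, 0)]
    · simp
    · rintro ⟨j, k⟩ h hne
      have : k ≠ 0 := by
        rintro rfl
        exact hne (by simpa using h)
      simp [coeff_X_pow, this.symm]
    · simp
  exact LinearMap.congr_fun this f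

theorem evalSeries_mul (Q Q' : PowerSeries S) (f : S[X]) :
    evalSeries (Q * Q') f = evalSeries Q (truncMul Q' f) := by
  rw [← coeff_zero_truncMul, truncMul_mul, coeff_zero_truncMul]

theorem truncMul_one_series (f : S[X]) : truncMul 1 f = f := by
  have : truncMul (1 : PowerSeries S) = LinearMap.id := by
    refine linearMap_ext_X_pow fun i => ?_
    rw [truncMul_X_pow, Finset.sum_eq_single (0, i)]
    · simp
    · rintro ⟨j, k⟩ h hne
      have : j ≠ 0 := by
        rintro rfl
        exact hne (by simpa using h)
      simp [PowerSeries.coeff_one, this]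
    · simp
  exact LinearMap.congr_fun this f

/-- Multiplying `X * f` by `1 + c X⁻¹` creates no negative power, so nothing is truncated. -/
theorem truncMul_linear (c : S) (f : S[X]) :
    truncMul (1 + PowerSeries.C c * PowerSeries.X) (X * f) = (X + C c) * f := by
  have : (truncMul (1 + PowerSeries.C c * PowerSeries.X)).comp mulX = mulX + c • LinearMap.id := by
    refine linearMap_ext_X_pow fun i => ?_
    rw [LinearMap.comp_apply, mulX_apply, ← pow_succ', truncMul_X_pow,
      Finset.Nat.antidiagonal_succ, Finset.sum_cons, Finset.sum_map, Finset.sum_eq_single (0, i)]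
    · simp [mulX_apply, pow_succ', PowerSeries.coeff_succ_mul_X, PowerSeries.coeff_one]
    · rintro ⟨j, k⟩ h hne
      have : j ≠ 0 := by
        rintro rfl
        exact hne (by simpa using h)
      simp [PowerSeries.coeff_succ_mul_X, PowerSeries.coeff_one, PowerSeries.coeff_C, this]
    · simp
  have h := LinearMap.congr_fun this f
  rw [add_mul, ← smul_eq_C_mul]
  exact h

/-- `Q = (1 + x z) / (1 - x z)`. -/
def IsLetterSeries (x : S) (Q : PowerSeries S) : Prop :=
  Q * (1 + PowerSeries.C (-x) * PowerSeries.X) = 1 + PowerSeries.C x * PowerSeries.X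

/-- In terms of `X` the series is `(X + x) / (X - x)`: it exchanges the two linear factors. -/
theorem truncMul_sub {x : S} {Q : PowerSeries S} (hQ : IsLetterSeries x Q) (f : S[X]) :
    truncMul Q ((X - C x) * f) = (X + C x) * f := by
  rw [sub_eq_add_neg, ← C_neg, ← truncMul_linear, ← truncMul_mul, hQ, truncMul_linear]

/-! ### Factorial powers -/

variable (a : ℕ → S)

/-- The factorial power `(X + a_0) ⋯ (X + a_{r-1})`. -/
def facPow (r : ℕ) : S[X] := ∏ i ∈ Finset.range r, (X + C (a i))

theorem facPow_succ (r : ℕ) : facPow a (r + 1) = (X + C (a r)) * facPow a r := by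
  rw [facPow, Finset.prod_range_succ, mul_comm]; rfl

theorem facPow_zero : facPow a 0 = 1 := rfl

theorem coeff_zero_facPow (ha : a 0 = 0) {r : ℕ} (hr : 0 < r) : (facPow a r).coeff 0 = 0 := by
  obtain ⟨r, rfl⟩ := Nat.exists_eq_succ_of_ne_zero hr.ne'
  rw [facPow, Finset.prod_range_succ', ha]
  simp

/-- The coefficients of `X ^ i` in the basis of factorial powers. -/
def facCoeff : ℕ → ℕ → S
  | 0, k => if k = 0 then 1 else 0
  | i + 1, 0 => -(a 0) * facCoeff i 0
  | i + 1, k + 1 => facCoeff i k - a (k + 1) * facCoeff i (k + 1)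

/-- The coordinates in the basis of factorial powers. -/
def facCoord (k : ℕ) : S[X] →ₗ[S] S := powMap fun i => facCoeff a i k

theorem facCoord_one (k : ℕ) : facCoord a k 1 = if k = 0 then 1 else 0 := by
  rw [← pow_zero X, facCoord, powMap_X_pow, facCoeff]

theorem facCoord_C (k : ℕ) (c : S) : facCoord a k (C c) = if k = 0 then c else 0 := by
  rw [← mul_one (C c), ← smul_eq_C_mul, map_smul, facCoord_one]
  simp

theorem facCoord_zero_X_mul (f : S[X]) : facCoord a 0 (X * f) = -(a 0) * facCoord a 0 f := by
  have : (facCoord a 0).comp mulX = (-(a 0)) • facCoord a 0 := by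
    refine linearMap_ext_X_pow fun i => ?_
    simp only [LinearMap.comp_apply, mulX_apply, ← pow_succ', LinearMap.smul_apply, facCoord,
      powMap_X_pow, facCoeff, smul_eq_mul]
  exact LinearMap.congr_fun this f

theorem facCoord_succ_X_mul (k : ℕ) (f : S[X]) :
    facCoord a (k + 1) (X * f) = facCoord a k f - a (k + 1) * facCoord a (k + 1) f := by
  have : (facCoord a (k + 1)).comp mulX = facCoord a k - a (k + 1) • facCoord a (k + 1) := by
    refine linearMap_ext_X_pow fun i => ?_
    simp only [LinearMap.comp_apply, mulX_apply, ← pow_succ', LinearMap.smul_apply,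
      LinearMap.sub_apply, facCoord, powMap_X_pow, facCoeff, smul_eq_mul]
  exact LinearMap.congr_fun this f

theorem facCoord_C_mul (k : ℕ) (c : S) (f : S[X]) : facCoord a k (C c * f) = c * facCoord a k f := by
  rw [← smul_eq_C_mul, map_smul, smul_eq_mul]

theorem facCoord_facPow (r k : ℕ) : facCoord a k (facPow a r) = if r = k then 1 else 0 := by
  induction r generalizing k with
  | zero => rw [facPow_zero, facCoord_one]; simp [eq_comm]
  | succ r ih =>
    rw [facPow_succ, add_mul, map_add, facCoord_C_mul]
    cases k with
    | zero =>
      rw [facCoord_zero_X_mul, ih]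
      by_cases h : r = 0 <;> simp [h]
    | succ k =>
      rw [facCoord_succ_X_mul, ih, ih]
      by_cases h : r = k
      · simp [h]
      · by_cases h2 : r = k + 1 <;> simp [h, h2]

/-- Every factorial power of positive degree is divisible by `X + a_0 = X`. -/
theorem facCoord_zero_eq (ha : a 0 = 0) (f : S[X]) : facCoord a 0 f = f.coeff 0 := by
  have : facCoord a 0 = constCoeff := by
    refine linearMap_ext_X_pow fun i => ?_
    rw [constCoeff_apply, facCoord, powMap_X_pow]
    cases i with
    | zero => simp [facCoeff]
    | succ i => simp [facCoeff, ha]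
  rw [this, constCoeff_apply]

theorem facCoord_truncMul_zero (ha : a 0 = 0) (Q : PowerSeries S) (r : ℕ) :
    facCoord a 0 (truncMul Q (facPow a r)) = evalSeries Q (facPow a r) := by
  rw [facCoord_zero_eq a ha, coeff_zero_truncMul]

/-- The matrix of `truncMul Q` in the basis of factorial powers. -/
theorem facCoord_truncMul (ha : a 0 = 0) (Q : PowerSeries S) (hQ : PowerSeries.coeff 0 Q = 1)
    (r k : ℕ) :
    facCoord a k (truncMul Q (facPow a r)) =
      if k = r then 1 else if k < r then
        evalSeries Q (X * ∏ i ∈ Finset.Ico (k + 1) r, (X + C (a i))) else 0 := by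
  have h0 : ∀ r, 0 < r → facPow a r = X * ∏ i ∈ Finset.Ico 1 r, (X + C (a i)) := by
    intro r hr
    rw [facPow, Finset.range_eq_Ico, Finset.prod_eq_prod_Ico_succ_bot hr, ha]
    simp
  induction r generalizing k with
  | zero =>
    rw [facPow_zero, truncMul_one, facCoord_C, hQ]
    by_cases hk : k = 0 <;> simp [hk]
  | succ r ih =>
    cases k with
    | zero =>
      rw [facCoord_truncMul_zero a ha, h0 _ r.succ_pos]
      simp
    | succ k =>
      rw [facPow_succ, add_mul, map_add, truncMul_X_mul, ← smul_eq_C_mul, map_smul, smul_eq_C_mul,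
        map_add, map_add, facCoord_succ_X_mul, facCoord_C, facCoord_C_mul, ih, ih]
      rcases lt_trichotomy (k + 1) r with h | h | h
      · have c1 : ¬ k = r := by omega
        have c2 : k < r := by omega
        have c3 : ¬ k + 1 = r + 1 := by omega
        have c4 : k + 1 < r + 1 := by omega
        simp only [c1, c2, c3, c4, h, h.ne, if_true, if_false]
        rw [Finset.prod_Ico_succ_top (by omega : k + 1 + 1 ≤ r),
          Finset.prod_eq_prod_Ico_succ_bot (by omega : k + 1 < r)]
        generalize ∏ i ∈ Finset.Ico (k + 1 + 1) r, (X + C (a i)) = s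
        -- Passing from row `r` to row `r + 1` replaces the factor with `a (k + 1)` by one with `a
        -- r`. Both products split into the same leading part and a multiple of `X * s`.
        have e1 : (X : S[X]) * ((X + C (a (k + 1))) * s) = X * (X * s) + a (k + 1) • (X * s) := by
          rw [smul_eq_C_mul]; ring
        have e2 : (X : S[X]) * (s * (X + C (a r))) = X * (X * s) + a r • (X * s) := by
          rw [smul_eq_C_mul]; ring
        rw [e1, e2, map_add, map_add, map_smul, map_smul]
        simp only [smul_eq_mul, if_neg (Nat.succ_ne_zero k)]
        ring
      · subst h
        simp
      · by_cases h2 : k = r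
        · subst h2
          simp
        · have c2 : ¬ k < r := by omega
          have c3 : ¬ k + 1 = r := by omega
          have c4 : ¬ k + 1 < r := by omega
          simp [h2, c2, c3, c4]

/-! ### Letters -/

theorem boxWeight_zero (w : ℕ → S) (j : ℕ) : boxWeight w 0 j = if j = 0 then 1 else 0 := by
  by_cases h : j = 0
  · subst h; simp [boxWeight, rowWeight]
  · simp [boxWeight, rowWeight, h]

theorem boxWeight_succ (w : ℕ → S) (r j : ℕ) :
    boxWeight w (r + 1) j = (if j = r + 1 then 1 else 0) + if j = r then w r else 0 := by
  rcases lt_trichotomy j r with h | h | h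
  · rw [boxWeight, if_neg (by omega), if_neg (by omega), if_neg (by omega), add_zero]
  · subst h
    simp [boxWeight, rowWeight]
  · by_cases h2 : j = r + 1
    · subst h2
      simp [boxWeight, rowWeight]
    · rw [boxWeight, if_pos (by omega), rowWeight, if_neg (by omega), if_neg h2, if_neg (by omega),
        add_zero]

theorem rowWeight_succ (w : ℕ → S) (r k : ℕ) :
    rowWeight w (r + 1) k = (if k = r + 1 then 1 else 0) + w r * rowWeight w r k := by
  by_cases h : k = r + 1
  · subst h
    simp [rowWeight]
  · rw [if_neg h, zero_add]
    by_cases h2 : k ≤ r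
    · rw [rowWeight, rowWeight, if_pos h2, if_pos (by omega), Finset.prod_Ico_succ_top h2, mul_comm]
    · rw [rowWeight, rowWeight, if_neg h2, if_neg (by omega), mul_zero]

/-- The weight `x - a_c` trades the last factor `X + a_c` of a factorial power for `X + x`. The row
of length `0` is exceptional because no box can be removed from it. -/
theorem sum_boxWeight (x : S) {P r : ℕ} (hr : r < P) :
    ∑ j ∈ Finset.range P, boxWeight (fun c => x - a c) r j • facPow a j =
      if r = 0 then 1 else (X + C x) * facPow a (r - 1) := by
  cases r with
  | zero =>
    simp only [boxWeight_zero, ite_smul, one_smul, zero_smul]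
    rw [Finset.sum_ite_eq' , if_pos (Finset.mem_range.2 hr), facPow_zero]
    simp
  | succ r =>
    simp only [boxWeight_succ, add_smul, ite_smul, one_smul, zero_smul, Finset.sum_add_distrib]
    rw [Finset.sum_ite_eq', Finset.sum_ite_eq', if_pos (Finset.mem_range.2 hr),
      if_pos (Finset.mem_range.2 (by omega)), facPow_succ, smul_eq_C_mul, C_sub]
    simp only [Nat.succ_ne_zero, if_false, Nat.add_sub_cancel]
    ring

/-- The operator `(1 + x z) / (1 - x z)` is the product of the transition matrices of an unprimed
and a primed letter. -/
theorem sum_rowWeight {x : S} {Q : PowerSeries S} (hQ : IsLetterSeries x Q)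
    (hQ0 : PowerSeries.coeff 0 Q = 1) {P r : ℕ} (hr : r < P) :
    ∑ k ∈ Finset.range P, rowWeight (fun c => x + a c) r k •
      ∑ j ∈ Finset.range P, boxWeight (fun c => x - a c) k j • facPow a j =
      truncMul Q (facPow a r) := by
  induction r with
  | zero =>
    rw [Finset.sum_eq_single 0, sum_boxWeight a x hr, rowWeight_self, facPow_zero, truncMul_one, hQ0]
    · simp
    · intro k _ hk
      rw [rowWeight_of_lt _ (Nat.pos_of_ne_zero hk), zero_smul]
    · intro h
      exact absurd (Finset.mem_range.2 hr) h
  | succ r ih =>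
    -- The factor `X + a r` is split as `(X - x) + (x + a r)`. The series turns the first part into
    -- `(X + x) * facPow a r`, the primed row of length `r + 1`; the second part extends the
    -- unprimed row by one box.
    have e : facPow a (r + 1) = (X - C x) * facPow a r + (x + a r) • facPow a r := by
      rw [facPow_succ, smul_eq_C_mul, C_add]; ring
    rw [e, map_add, map_smul, truncMul_sub hQ, ← ih (by omega), Finset.smul_sum]
    simp only [rowWeight_succ, add_smul, Finset.sum_add_distrib, ite_smul, one_smul, zero_smul,
      mul_smul]
    rw [Finset.sum_ite_eq', if_pos (Finset.mem_range.2 hr), sum_boxWeight a x hr]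
    simp

end Operators

/-! ### The alternating form behind the two-row functions -/

section PairForm

open Polynomial

variable {S : Type*} [CommRing S]

/-- `Q = (1 + u z + z²) / (1 - u z + z²)`. -/
def IsPairSeries (u : S) (Q : PowerSeries S) : Prop :=
  Q * (1 - PowerSeries.C u * PowerSeries.X + PowerSeries.X ^ 2) =
    1 + PowerSeries.C u * PowerSeries.X + PowerSeries.X ^ 2

theorem IsPairSeries.coeff_zero {u : S} {Q : PowerSeries S} (h : IsPairSeries u Q) :
    PowerSeries.coeff 0 Q = 1 := by
  have := congrArg (PowerSeries.coeff 0) h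
  simpa [PowerSeries.coeff_zero_eq_constantCoeff] using this

theorem IsPairSeries.expand {u : S} {Q : PowerSeries S} (h : IsPairSeries u Q) :
    Q = 1 + PowerSeries.C u * PowerSeries.X + PowerSeries.X ^ 2 +
      PowerSeries.C u * (Q * PowerSeries.X) - Q * PowerSeries.X * PowerSeries.X := by
  have h' : Q * (1 - PowerSeries.C u * PowerSeries.X + PowerSeries.X ^ 2) =
    1 + PowerSeries.C u * PowerSeries.X + PowerSeries.X ^ 2 := h
  linear_combination h'

theorem IsPairSeries.coeff_one {u : S} {Q : PowerSeries S} (h : IsPairSeries u Q) :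
    PowerSeries.coeff 1 Q = 2 * u := by
  have := congrArg (PowerSeries.coeff (0 + 1)) h.expand
  simp only [map_add, map_sub, PowerSeries.coeff_C_mul, PowerSeries.coeff_succ_mul_X,
    PowerSeries.coeff_X_pow, PowerSeries.coeff_one, h.coeff_zero,
    PowerSeries.coeff_zero_mul_X] at this
  simp at this
  rw [this]; ring

theorem IsPairSeries.coeff_add_two {u : S} {Q : PowerSeries S} (h : IsPairSeries u Q) (i : ℕ) :
    PowerSeries.coeff (i + 2) Q = (if i = 0 then 1 else 0) + u * PowerSeries.coeff (i + 1) Q -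
      PowerSeries.coeff i Q := by
  have := congrArg (PowerSeries.coeff (i + 1 + 1)) h.expand
  simp only [map_add, map_sub, PowerSeries.coeff_C_mul, PowerSeries.coeff_succ_mul_X,
    PowerSeries.coeff_X_pow, PowerSeries.coeff_one] at this
  simp at this
  rw [this]

/-- The denominator `1 - u z + z²` gives a three-term recurrence for the coefficients. The constant
term of `f` accounts for the numerator in degree `2`. -/
theorem IsPairSeries.evalSeries {u : S} {Q : PowerSeries S} (h : IsPairSeries u Q) (f : S[X]) :
    evalSeries Q (X * (X * f)) = f.coeff 0 + u * evalSeries Q (X * f) - evalSeries Q f := by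
  have : ((SymplecticQ.evalSeries Q).comp mulX).comp mulX =
      constCoeff + u • (SymplecticQ.evalSeries Q).comp mulX - SymplecticQ.evalSeries Q := by
    refine linearMap_ext_X_pow fun i => ?_
    simp only [LinearMap.comp_apply, mulX_apply, LinearMap.add_apply, LinearMap.sub_apply,
      LinearMap.smul_apply, constCoeff_apply, ← pow_succ', evalSeries_X_pow, h.coeff_add_two i]
    simp [coeff_X_pow, eq_comm]
  exact LinearMap.congr_fun this f

variable (Q : ℕ → PowerSeries S)

/-- The product of the first `k` terms of a sequence of power series. -/
def serProd (k : ℕ) : PowerSeries S := ∏ i ∈ Finset.range k, Q i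

theorem serProd_succ (k : ℕ) : serProd Q (k + 1) = serProd Q k * Q k :=
  Finset.prod_range_succ _ _

/-- The alternating form giving the two-row functions. -/
def pairForm : ℕ → S[X] →ₗ[S] S[X] →ₗ[S] S
  | 0 => 0
  | k + 1 => (pairForm k).compl₁₂ (truncMul (Q k)) (truncMul (Q k)) +
      ((evalSeries (Q k)).smulRight constCoeff - constCoeff.smulRight (evalSeries (Q k)))

theorem pairForm_succ (k : ℕ) (f g : S[X]) :
    pairForm Q (k + 1) f g = pairForm Q k (truncMul (Q k) f) (truncMul (Q k) g) +
      (evalSeries (Q k) f * g.coeff 0 - f.coeff 0 * evalSeries (Q k) g) := rfl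

theorem pairForm_antisymm (k : ℕ) (f g : S[X]) : pairForm Q k f g = -pairForm Q k g f := by
  induction k generalizing f g with
  | zero => simp [pairForm]
  | succ k ih => rw [pairForm_succ, pairForm_succ, ih]; ring

theorem pairForm_self (k : ℕ) (f : S[X]) : pairForm Q k f f = 0 := by
  induction k generalizing f with
  | zero => simp [pairForm]
  | succ k ih => rw [pairForm_succ, ih]; ring

variable {Q} {u : ℕ → S} (hQ : ∀ k, IsPairSeries (u k) (Q k))
include hQ

theorem coeff_zero_serProd (k : ℕ) : PowerSeries.coeff 0 (serProd Q k) = 1 := by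
  rw [serProd, PowerSeries.coeff_zero_eq_constantCoeff, map_prod]
  refine Finset.prod_eq_one fun i _ => ?_
  rw [← PowerSeries.coeff_zero_eq_constantCoeff]
  exact (hQ i).coeff_zero

/-- Pairing with `1` telescopes along the recursion and produces the one-row functional. This links
`K` to the column of `M` for `k = 0`, and explains why an added zero part behaves like a completing
zero. -/
theorem pairForm_one (k : ℕ) (f : S[X]) :
    pairForm Q k f 1 = evalSeries (serProd Q k) f - f.coeff 0 := by
  induction k generalizing f with
  | zero =>
    have : serProd Q 0 = 1 := rfl
    rw [this, ← coeff_zero_truncMul, truncMul_one_series]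
    simp [pairForm]
  | succ k ih =>
    rw [pairForm_succ, truncMul_one, (hQ k).coeff_zero, C_1, ih, serProd_succ, evalSeries_mul,
      coeff_zero_truncMul, evalSeries_one, (hQ k).coeff_zero]
    simp

/-- The boundary case of `pairForm_X_X`. It is needed there because truncation of a multiple of `X`
creates constants, and hence multiples of `X` after a further multiplication. -/
theorem pairForm_X (k : ℕ) (g : S[X]) :
    pairForm Q k X (X * g) = 2 * (evalSeries (serProd Q k) (X * (X * g)) +
      evalSeries (serProd Q k) g - g.coeff 0) -
      evalSeries (serProd Q k) X * evalSeries (serProd Q k) (X * g) := by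
  induction k generalizing g with
  | zero =>
    have : serProd Q 0 = 1 := rfl
    simp only [this, ← coeff_zero_truncMul, truncMul_one_series]
    simp [pairForm]
  | succ k ih =>
    have hX : truncMul (Q k) X = X + C (2 * u k) := by
      have := truncMul_X_mul (Q k) 1
      rw [mul_one, truncMul_one, (hQ k).coeff_zero, C_1, mul_one, ← pow_one X, evalSeries_X_pow,
        (hQ k).coeff_one, pow_one] at this
      exact this
    have hC : ∀ (c : S) (f : S[X]), pairForm Q k f (C c) =
        c * (evalSeries (serProd Q k) f - f.coeff 0) := by
      intro c f
      rw [← mul_one (C c), ← smul_eq_C_mul, map_smul, pairForm_one hQ, smul_eq_mul]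
    have hC' : ∀ (c : S) (f : S[X]), pairForm Q k (C c) f =
        -(c * (evalSeries (serProd Q k) f - f.coeff 0)) := by
      intro c f
      rw [pairForm_antisymm, hC]
    have hXC : ∀ c : S, X * C c = c • (X : S[X]) := fun c => by rw [X_mul_C, smul_eq_C_mul]
    have h1 := (hQ k).evalSeries g
    rw [pairForm_succ, hX, truncMul_X_mul]
    simp only [serProd_succ, evalSeries_mul, hX, truncMul_X_mul, map_add, LinearMap.add_apply, hC,
      hC', ih, mul_add, h1, evalSeries_C, coeff_zero_serProd hQ]
    simp only [hXC, map_smul, smul_eq_mul, coeff_X_mul_zero, coeff_X_zero, coeff_C_zero,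
      coeff_zero_truncMul]
    ring

/-- Writing `D` for multiplication by `X + X⁻¹`, `B` for the form and `L` for the one-row
functional, this says `B(D f', g') + B(f', D g') = L(f') L(D g') - L(D f') L(g')` for `f' = X f`,
`g' = X g`. It is the counterpart of `(u_i + u_j) * ((u_j - u_i) / (u_j + u_i)) = u_j - u_i`. The
induction on the number of pairs reduces to the same identity for the truncated arguments. -/
theorem pairForm_X_X (k : ℕ) (f g : S[X]) :
    pairForm Q k (X * (X * f)) (X * g) + pairForm Q k f (X * g) +
      pairForm Q k (X * f) (X * (X * g)) + pairForm Q k (X * f) g =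
    evalSeries (serProd Q k) (X * f) *
      (evalSeries (serProd Q k) (X * (X * g)) + evalSeries (serProd Q k) g) -
    (evalSeries (serProd Q k) (X * (X * f)) + evalSeries (serProd Q k) f) *
      evalSeries (serProd Q k) (X * g) := by
  induction k generalizing f g with
  | zero =>
    have : serProd Q 0 = 1 := rfl
    simp only [this, ← coeff_zero_truncMul, truncMul_one_series]
    simp [pairForm]
  | succ k ih =>
    have hC : ∀ (c : S) (f : S[X]), pairForm Q k f (C c) =
        c * (evalSeries (serProd Q k) f - f.coeff 0) := by
      intro c f
      rw [← mul_one (C c), ← smul_eq_C_mul, map_smul, pairForm_one hQ, smul_eq_mul]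
    have hC' : ∀ (c : S) (f : S[X]), pairForm Q k (C c) f =
        -(c * (evalSeries (serProd Q k) f - f.coeff 0)) := by
      intro c f
      rw [pairForm_antisymm, hC]
    have h1 := (hQ k).evalSeries g
    have h2 := (hQ k).evalSeries f
    have h3 : ∀ f, pairForm Q k (X * f) X = -pairForm Q k X (X * f) := fun f =>
      pairForm_antisymm _ _ _ _
    have ih := ih (truncMul (Q k) f) (truncMul (Q k) g)
    have hXC : ∀ c : S, X * C c = c • (X : S[X]) := fun c => by rw [X_mul_C, smul_eq_C_mul]
    simp only [pairForm_succ, serProd_succ, evalSeries_mul, truncMul_X_mul, map_add,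
      LinearMap.add_apply, hC, hC', mul_add, evalSeries_C, coeff_zero_serProd hQ]
    simp only [hXC, map_smul, LinearMap.smul_apply, smul_eq_mul, coeff_smul,
      coeff_X_mul_zero, coeff_X_zero, h3, pairForm_X hQ,
      coeff_C_zero, coeff_zero_truncMul, h1, h2]
    linear_combination ih

end PairForm

/-! ### The universal recursion for two-row functions -/

section Psi

/-- The sequence with its zeroth term replaced by `0`. -/
def dropZero {A : Type*} [CommRing A] (q : ℕ → A) (k : ℕ) : A := if k = 0 then 0 else q k

/-- The two-row functions as polynomials in the one-row functions `q_k`. -/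
def twoRow {A : Type*} [CommRing A] (q : ℕ → A) : ℕ → ℕ → A
  | 0, _ => 0
  | _ + 1, 0 => 0
  | 1, s + 1 => 2 * (q (s + 2) + dropZero q s) - q 1 * q (s + 1)
  | r + 2, s + 1 => -twoRow q r (s + 1) - twoRow q (r + 1) (s + 2) - twoRow q (r + 1) s +
      q (r + 1) * (q (s + 2) + dropZero q s) - (q (r + 2) + dropZero q r) * q (s + 1)

theorem map_dropZero {A B : Type*} [CommRing A] [CommRing B] (F : A →+* B) (q : ℕ → A) (k : ℕ) :
    F (dropZero q k) = dropZero (F ∘ q) k := by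
  rw [dropZero, dropZero]
  split_ifs <;> simp

theorem map_twoRow {A B : Type*} [CommRing A] [CommRing B] (F : A →+* B) (q : ℕ → A) (r s : ℕ) :
    F (twoRow q r s) = twoRow (F ∘ q) r s := by
  induction r, s using twoRow.induct with
  | case1 => simp [twoRow]
  | case2 => simp [twoRow]
  | case3 s => simp [twoRow, map_dropZero, (map_ofNat F 2 : F 2 = 2)]
  | case4 r s h1 h2 h3 => simp [twoRow, map_dropZero, h1, h2, h3]

/-- The recursion determines the two-row functions. -/
theorem eq_twoRow {A : Type*} [CommRing A] {q : ℕ → A} {F : ℕ → ℕ → A} (h0 : ∀ s, F 0 s = 0)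
    (h0' : ∀ r, F r 0 = 0)
    (h1 : ∀ s, F 1 (s + 1) = 2 * (q (s + 2) + dropZero q s) - q 1 * q (s + 1))
    (h2 : ∀ r s, F (r + 2) (s + 1) = -F r (s + 1) - F (r + 1) (s + 2) - F (r + 1) s +
      q (r + 1) * (q (s + 2) + dropZero q s) - (q (r + 2) + dropZero q r) * q (s + 1))
    (r s : ℕ) : F r s = twoRow q r s := by
  induction r, s using twoRow.induct with
  | case1 => simp [twoRow, h0]
  | case2 => simp [twoRow, h0']
  | case3 s => rw [h1, twoRow]
  | case4 r s e1 e2 e3 => rw [h2, twoRow, e1, e2, e3]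

-- The form does not vanish when one exponent is `0`, while `twoRow` does. The discrepancy is a
-- one-row function times `q 0 = 1`, and replacing `q 0` by `0` through `dropZero` compensates for
-- it.
open Polynomial in
theorem pairForm_X_pow {S : Type*} [CommRing S] {Q : ℕ → PowerSeries S} {u : ℕ → S}
    (hQ : ∀ k, IsPairSeries (u k) (Q k)) (k r s : ℕ) :
    pairForm Q k (X ^ (r + 1)) (X ^ (s + 1)) =
      twoRow (fun i => PowerSeries.coeff i (serProd Q k)) (r + 1) (s + 1) := by
  set q : ℕ → S := fun i => PowerSeries.coeff i (serProd Q k) with hq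
  have hq0 : q 0 = 1 := coeff_zero_serProd hQ k
  have hd : ∀ i, dropZero q i = q i - if i = 0 then 1 else 0 := by
    intro i
    rw [dropZero]
    split_ifs with h
    · rw [h, hq0, sub_self]
    · rw [sub_zero]
  have hL : ∀ i, evalSeries (serProd Q k) (X ^ i) = q i := fun i => evalSeries_X_pow _ _
  have hz : ∀ i, (pairForm Q k (X ^ (i + 1))) (X ^ 0) = q (i + 1) := by
    intro i
    rw [pow_zero, pairForm_one hQ, hL]
    simp
  have hz' : ∀ i, (pairForm Q k (X ^ 0)) (X ^ (i + 1)) = -q (i + 1) := by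
    intro i
    rw [pairForm_antisymm, hz]
  rw [← eq_twoRow (q := q)
    (F := fun r s => if r = 0 ∨ s = 0 then 0 else pairForm Q k (X ^ r) (X ^ s))]
  · simp
  · simp
  · simp
  · intro s
    have := pairForm_X hQ k (X ^ s)
    simp only [← pow_succ', hL] at this
    rw [if_neg (by simp), pow_one, this, hd]
    have h1 : evalSeries (serProd Q k) X = q 1 := by rw [← hL, pow_one]
    rw [h1]
    simp [coeff_X_pow, eq_comm]
    ring
  · intro r s
    have := pairForm_X_X hQ k (X ^ r) (X ^ s)
    simp only [← pow_succ', hL] at this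
    rw [if_neg (by simp), hd, hd]
    have e3 : pairForm Q k X 1 = q 1 := by simpa using hz 0
    have e4 : pairForm Q k 1 X = -q 1 := by simpa using hz' 0
    have z1 : ∀ i, pairForm Q k (X ^ (i + 1)) 1 = q (i + 1) := by simpa using hz
    have z2 : ∀ i, pairForm Q k 1 (X ^ (i + 1)) = -q (i + 1) := by simpa using hz'
    rcases r with _ | r <;> rcases s with _ | s <;>
    · simp [z1, z2, e3, e4, hq0] at this ⊢
      linear_combination this

end Psi

/-! ### Dropping a zero part from the Pfaffian -/

section Remove

variable {S : Type*} [CommRing S] [Algebra ℚ S]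

theorem matrixForm_antisymm {τ : Type*} {G : τ → τ → S} (hG : ∀ i j, G i j = -G j i)
    (v w : τ →₀ S) : matrixForm G v w = -matrixForm G w v := by
  have : matrixForm G = -(matrixForm G).flip := by
    refine Finsupp.lhom_ext fun i b => ?_
    refine Finsupp.lhom_ext fun j c => ?_
    rw [LinearMap.neg_apply, LinearMap.neg_apply, LinearMap.flip_apply, matrixForm_single,
      matrixForm_single, hG i j]
    ring
  exact LinearMap.congr_fun (LinearMap.congr_fun this v) w

/-- Removing two consecutive indices with the same row up to their mutual entry. -/
theorem pfaffian_remove {τ : Type*} {G : τ → τ → S} (hG : ∀ i j, G i j = -G j i) {M : ℕ}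
    (idx : Fin (M + 2) → τ) (p : Fin (M + 1))
    (h1 : G (idx p.castSucc) (idx p.succ) = 1) (h0 : G (idx p.castSucc) (idx p.castSucc) = 0)
    (hp : ∀ i, i ≠ p.castSucc → i ≠ p.succ → G (idx p.succ) (idx i) = G (idx p.castSucc) (idx i)) :
    pfaffian (Matrix.of fun i j => G (idx i) (idx j)) =
      pfaffian (Matrix.of fun i j => G (idx (p.succ.succAbove (p.succAbove i)))
        (idx (p.succ.succAbove (p.succAbove j)))) := by
  set v : Fin (M + 2) → τ →₀ S := fun i => Finsupp.single (idx i) 1 with hv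
  have hB : ∀ i j, matrixForm G (v i) (v j) = G (idx i) (idx j) := fun i j => by
    rw [hv, matrixForm_single, one_mul, one_mul]
  -- Subtracting one vector from its neighbour does not change an alternating map. The new row has a
  -- single nonzero entry, equal to `-1`, which cancels the sign of the expansion.
  set v' := Function.update v p.succ (v p.succ - v p.castSucc) with hv'
  have hne : p.castSucc ≠ p.succ := (Fin.castSucc_lt_succ (i := p)).ne
  have e1 : pfAlt (matrixForm G) (M + 2) v = pfAlt (matrixForm G) (M + 2) v' := by
    rw [hv', AlternatingMap.map_update_sub, Function.update_eq_self,
      AlternatingMap.map_update_self _ _ hne.symm, sub_zero]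
  have e4 : p.succ.succAbove p = p.castSucc :=
    Fin.succAbove_of_castSucc_lt _ _ Fin.castSucc_lt_succ
  have e2 : ∀ i, i ≠ p.succ → v' i = v i := fun i hi => Function.update_of_ne hi _ _
  have e3 : v' p.succ = v p.succ - v p.castSucc := Function.update_self _ _ _
  simp only [pfAlt_apply, hB] at e1
  rw [e1, pfaffian_expand_single (Matrix.of fun i j => matrixForm G (v' i) (v' j))
    (fun i j => matrixForm_antisymm hG _ _) p.succ p]
  · rw [e4]
    simp only [Matrix.of_apply, Matrix.submatrix]
    rw [e3, e2 _ hne, map_sub, LinearMap.sub_apply, hB, hB, h0, hG, h1]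
    have e5 : ((-1 : S)) ^ ((p.succ : ℕ) + p) = -1 := by
      rw [Fin.val_succ, show (p : ℕ) + 1 + p = 2 * p + 1 by ring, pow_succ, pow_mul]
      simp
    rw [e5]
    simp only [sub_zero, mul_neg, mul_one, neg_neg, one_mul]
    congr 1
    ext i j
    simp only [Matrix.of_apply]
    rw [e2 _ (Fin.succAbove_ne _ _), e2 _ (Fin.succAbove_ne _ _), hB]
  · intro j hj
    have e6 : p.succ.succAbove j ≠ p.castSucc := by
      rw [← e4]
      exact fun h => hj (Fin.succAbove_right_injective h)
    rw [Matrix.of_apply, e3, e2 _ (Fin.succAbove_ne _ _), map_sub, LinearMap.sub_apply, hB, hB,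
      hp _ e6 (Fin.succAbove_ne _ _), sub_self]

theorem blockForm_antisymm {ι : Type*} {K : ℕ → ℕ → S} {M : ℕ → ι → S}
    (hK : ∀ i j, K i j = -K j i) (i j : ℕ ⊕ ι) : blockForm K M i j = -blockForm K M j i := by
  rcases i with i | i <;> rcases j with j | j <;> simp [blockForm, ← hK]

theorem blockIdx_of_lt {ι : Type*} {l s : ℕ} (nu : Fin l → ℕ) (c : Fin s → ι) {i : Fin (l + s)}
    (h : (i : ℕ) < l) : blockIdx nu c i = Sum.inl (nu ⟨i, h⟩) := by
  obtain ⟨i, hi⟩ := i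
  exact Fin.append_left (Sum.inl ∘ nu) (Sum.inr ∘ c : Fin s → ℕ ⊕ ι) ⟨i, h⟩

theorem blockIdx_of_eq {ι : Type*} {l s : ℕ} (nu : Fin l → ℕ) (c : Fin s → ι) {i : Fin (l + s)}
    {j : Fin s} (h : (i : ℕ) = l + j) : blockIdx nu c i = Sum.inr (c j) := by
  obtain rfl : i = Fin.natAdd l j := Fin.ext h
  rw [blockIdx, Fin.append_right]
  rfl

/-- A last row index `x` and a first column index `y` are adjacent in the block matrix. Under these
hypotheses their rows agree except at these two indices, where they pair to `1`, so both can be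
deleted. Adjacency is the reason for listing the columns in reversed order. -/
theorem blockPfaffian_remove {K : ℕ → ℕ → S} {M : ℕ → ℕ → S} (hK : ∀ i j, K i j = -K j i)
    {l s : ℕ} (nu : Fin l → ℕ) (c : Fin s → ℕ) {x y : ℕ} (hx : K x x = 0) (hxy : M x y = 1)
    (hnu : ∀ i, K x (nu i) = -M (nu i) y) (hc : ∀ j, M x (c j) = 0) :
    pfaffian (Matrix.of fun i j => blockForm K M
        (blockIdx (Fin.snoc nu x : Fin (l + 1) → ℕ) (Fin.cons y c : Fin (s + 1) → ℕ) i)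
        (blockIdx (Fin.snoc nu x : Fin (l + 1) → ℕ) (Fin.cons y c : Fin (s + 1) → ℕ) j)) =
      pfaffian (Matrix.of fun i j => blockForm K M (blockIdx nu c i) (blockIdx nu c j)) := by
  have h : l + s + 2 = l + 1 + (s + 1) := by ring
  rw [← pfaffian_cast h]
  set J := blockIdx (Fin.snoc nu x : Fin (l + 1) → ℕ) (Fin.cons y c : Fin (s + 1) → ℕ) with hJ
  set p : Fin (l + s + 1) := ⟨l, by omega⟩ with hp
  have j0 : J (Fin.cast h p.castSucc) = Sum.inl x := by
    rw [hJ, blockIdx_of_lt _ _ (by simp [hp])]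
    congr 1
    exact Fin.snoc_last (α := fun _ => ℕ) x nu
  have j1 : J (Fin.cast h p.succ) = Sum.inr y := by
    rw [hJ, blockIdx_of_eq (j := 0) _ _ (by simp [hp])]
    rfl
  have jl : ∀ i : Fin (l + s + 2), ∀ hi : (i : ℕ) < l, J (Fin.cast h i) = Sum.inl (nu ⟨i, hi⟩) := by
    intro i hi
    rw [hJ, blockIdx_of_lt _ _ (by simp; omega)]
    congr 1
    exact Fin.snoc_castSucc (α := fun _ => ℕ) x nu ⟨i, hi⟩
  have jr : ∀ (i : Fin (l + s + 2)) (j : Fin s), (i : ℕ) = l + j + 2 →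
      J (Fin.cast h i) = Sum.inr (c j) := by
    intro i j hi
    rw [hJ, blockIdx_of_eq (j := j.succ) _ _ (by simp [hi]; omega)]
    congr 1
  have key := pfaffian_remove (blockForm_antisymm (M := M) hK) (fun i => J (Fin.cast h i)) p
  rw [j0, j1] at key
  have := key (by simpa [blockForm] using hxy) (by simpa [blockForm] using hx) (by
    intro i h1 h2
    rcases lt_trichotomy (i : ℕ) l with hi | hi | hi
    · rw [jl i hi]
      simp [blockForm, hnu]
    · exact absurd (Fin.ext hi) h1
    · have h3 : (i : ℕ) ≠ l + 1 := fun h3 => h2 (Fin.ext h3)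
      rw [jr i ⟨i - l - 2, by omega⟩ (by simp; omega)]
      simp [blockForm, hc])
  refine this.trans ?_
  congr 1
  have hval : ∀ i : Fin (l + s), J (Fin.cast h (p.succ.succAbove (p.succAbove i))) =
      blockIdx nu c i := by
    intro i
    by_cases hi : (i : ℕ) < l
    · have e1 : p.succAbove i = i.castSucc := Fin.succAbove_of_castSucc_lt _ _ hi
      have e2 : p.succ.succAbove i.castSucc = i.castSucc.castSucc :=
        Fin.succAbove_of_castSucc_lt _ _ (by
          rw [Fin.lt_def]; simp [hp]; omega)
      rw [e1, e2, jl _ hi, blockIdx_of_lt _ _ hi]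
      rfl
    · have e1 : p.succAbove i = i.succ := Fin.succAbove_of_le_castSucc _ _ (by
          rw [Fin.le_def]; simp [hp]; omega)
      have e2 : p.succ.succAbove i.succ = i.succ.succ :=
        Fin.succAbove_of_le_castSucc _ _ (by rw [Fin.le_def]; simp [hp]; omega)
      rw [e1, e2, jr _ ⟨i - l, by omega⟩ (by simp; omega),
        blockIdx_of_eq (j := ⟨i - l, by omega⟩) _ _ (by simp; omega)]
  ext i j
  simp only [Matrix.of_apply, hval]

/-- The Pfaffian attached to the sequences `lam` and `mu`, the second one completed by a zero if
necessary. -/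
def skewPf (K M : ℕ → ℕ → S) {l m : ℕ} (lam : Fin l → ℕ) (mu : Fin m → ℕ) : S :=
  if Even (l + m) then
    blockPfaffian (Matrix.of fun i j => K (lam i) (lam j))
      (Matrix.of fun i j => M (lam i) (mu (Fin.rev j)))
  else
    blockPfaffian (Matrix.of fun i j => K (lam i) (lam j))
      (Matrix.of fun i j => M (lam i) ((Fin.cons 0 fun j => mu (Fin.rev j) : Fin (m + 1) → ℕ) j))

/-- Adding a zero part changes the parity. In the even case a completing zero appears beside it and
the two cancel. In the odd case the completing zero disappears and the new part takes its place,
with the same row, since pairing with the part `0` is minus the column of `M` for `0`. -/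
theorem skewPf_snoc_zero {K M : ℕ → ℕ → S} (hK : ∀ i j, K i j = -K j i) (hK0 : K 0 0 = 0)
    (hM : ∀ j, M 0 j = if j = 0 then 1 else 0) (hKM : ∀ i, 0 < i → K 0 i = -M i 0) {l m : ℕ}
    {nu : Fin l → ℕ} (hnu : ∀ i, 0 < nu i) {mu : Fin m → ℕ} (hmu : ∀ j, 0 < mu j) :
    skewPf K M (Fin.snoc nu 0 : Fin (l + 1) → ℕ) mu = skewPf K M nu mu := by
  have hpar : Even (l + 1 + m) ↔ ¬ Even (l + m) := by
    rw [show l + 1 + m = l + m + 1 by ring, Nat.even_add_one]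
  rw [skewPf, skewPf]
  by_cases he : Even (l + m)
  · rw [if_pos he, if_neg (by rw [hpar]; simpa using he), blockPfaffian_eq, blockPfaffian_eq]
    exact blockPfaffian_remove hK nu _ hK0 (by simp [hM]) (fun i => hKM _ (hnu i))
      (fun j => by simp [hM, (hmu _).ne'])
  · rw [if_neg he, if_pos (hpar.2 he), blockPfaffian_eq, blockPfaffian_eq]
    have h : l + 1 + m = l + (m + 1) := by ring
    rw [← pfaffian_cast h]
    congr 1
    have hcase : ∀ i : Fin (l + 1 + m),
        (∃ k : Fin l, blockIdx (Fin.snoc nu 0 : Fin (l + 1) → ℕ) (fun j => mu (Fin.rev j)) i =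
            Sum.inl (nu k) ∧
          blockIdx nu (Fin.cons 0 fun j => mu (Fin.rev j) : Fin (m + 1) → ℕ) (Fin.cast h i) =
            Sum.inl (nu k)) ∨
        (blockIdx (Fin.snoc nu 0 : Fin (l + 1) → ℕ) (fun j => mu (Fin.rev j)) i = Sum.inl 0 ∧
          blockIdx nu (Fin.cons 0 fun j => mu (Fin.rev j) : Fin (m + 1) → ℕ) (Fin.cast h i) =
            Sum.inr 0) ∨
        (∃ k : Fin m, blockIdx (Fin.snoc nu 0 : Fin (l + 1) → ℕ) (fun j => mu (Fin.rev j)) i =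
            Sum.inr (mu k) ∧
          blockIdx nu (Fin.cons 0 fun j => mu (Fin.rev j) : Fin (m + 1) → ℕ) (Fin.cast h i) =
            Sum.inr (mu k)) := by
      intro i
      rcases lt_trichotomy (i : ℕ) l with hi | hi | hi
      · refine Or.inl ⟨⟨i, hi⟩, ?_, blockIdx_of_lt _ _ hi⟩
        rw [blockIdx_of_lt _ _ (by omega)]
        congr 1
        exact Fin.snoc_castSucc (α := fun _ => ℕ) 0 nu ⟨i, hi⟩
      · refine Or.inr (Or.inl ⟨?_, ?_⟩)
        · rw [blockIdx_of_lt _ _ (by omega)]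
          congr 1
          have : (⟨i, by omega⟩ : Fin (l + 1)) = Fin.last l := Fin.ext hi
          rw [this]
          exact Fin.snoc_last (α := fun _ => ℕ) 0 nu
        · rw [blockIdx_of_eq (j := 0) _ _ (by simp [hi])]
          rfl
      · refine Or.inr (Or.inr ⟨Fin.rev ⟨i - l - 1, by omega⟩, ?_, ?_⟩)
        · rw [blockIdx_of_eq (j := ⟨i - l - 1, by omega⟩) _ _ (by simp; omega)]
        · rw [blockIdx_of_eq (j := (⟨i - l - 1, by omega⟩ : Fin m).succ) _ _ (by simp; omega)]
          rfl
    ext i j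
    simp only [Matrix.of_apply, Matrix.submatrix]
    rcases hcase i with ⟨k, e1, e2⟩ | ⟨e1, e2⟩ | ⟨k, e1, e2⟩ <;>
    rcases hcase j with ⟨k', e3, e4⟩ | ⟨e3, e4⟩ | ⟨k', e3, e4⟩ <;>
    rw [e1, e2, e3, e4]
    · simp only [blockForm]
      rw [hK, hKM _ (hnu _), neg_neg]
    · simp only [blockForm]
      rw [hKM _ (hnu _)]
    · simp only [blockForm, hK0]
    · simp only [blockForm]
      rw [hM, if_neg (hmu _).ne']
    · simp only [blockForm]
      rw [hM, if_neg (hmu _).ne', neg_zero]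

end Remove

/-! ### The series of a letter and of a pair of inverse variables -/

section LetterSeries

variable {S : Type*} [CommRing S]

/-- The power series `(1 + x z) / (1 - x z)`. -/
def letterSeries (x : S) : PowerSeries S := PowerSeries.mk fun i => if i = 0 then 1 else 2 * x ^ i

theorem coeff_zero_letterSeries (x : S) : PowerSeries.coeff 0 (letterSeries x) = 1 := by
  simp [letterSeries]

theorem isLetterSeries (x : S) : IsLetterSeries x (letterSeries x) := by
  rw [IsLetterSeries, mul_add, mul_one, mul_left_comm]
  ext i
  rcases i with _ | _ | i
  · simp [letterSeries]
  · simp only [map_add, PowerSeries.coeff_C_mul, PowerSeries.coeff_succ_mul_X, letterSeries,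
      PowerSeries.coeff_mk, PowerSeries.coeff_one]
    simp
    ring
  · simp only [map_add, PowerSeries.coeff_C_mul, PowerSeries.coeff_succ_mul_X, letterSeries,
      PowerSeries.coeff_mk, PowerSeries.coeff_one]
    simp
    ring

/-- The power series `(1 + x z) (1 + x' z) / ((1 - x z) (1 - x' z))`. -/
def pairSeries (x x' : S) : PowerSeries S := letterSeries x * letterSeries x'

/-- For inverse variables the product `(1 ± x z)(1 ± x' z)` depends only on `u = x + x'`; this is
what makes the nodes `x + x⁻¹` appear. -/
theorem isPairSeries {x x' : S} (h : x * x' = 1) : IsPairSeries (x + x') (pairSeries x x') := by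
  have h1 : letterSeries x * (1 + PowerSeries.C (-x) * PowerSeries.X) =
    1 + PowerSeries.C x * PowerSeries.X := isLetterSeries x
  have h2 : letterSeries x' * (1 + PowerSeries.C (-x') * PowerSeries.X) =
    1 + PowerSeries.C x' * PowerSeries.X := isLetterSeries x'
  have h3 : (PowerSeries.C x * PowerSeries.C x' : PowerSeries S) = 1 := by
    rw [← map_mul, h, map_one]
  have h4 := congrArg₂ (· * ·) h1 h2
  simp only [map_neg] at h4
  rw [IsPairSeries, pairSeries, map_add]
  linear_combination h4 + (1 - letterSeries x * letterSeries x') * PowerSeries.X ^ 2 * h3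

theorem isPairSeries_one : IsPairSeries (0 : S) 1 := by simp [IsPairSeries]

theorem map_letterSeries {T : Type*} [CommRing T] (F : S →+* T) (x : S) :
    PowerSeries.map F (letterSeries x) = letterSeries (F x) := by
  ext i
  simp only [letterSeries, PowerSeries.coeff_map, PowerSeries.coeff_mk]
  split_ifs <;> simp [(map_ofNat F 2 : F 2 = 2)]

end LetterSeries

/-! ### The change of basis and the case without variables -/

section MainInduction

open Polynomial

variable {S : Type*} [CommRing S] [Algebra ℚ S]

/-- Form and functionals stay fixed while the polynomials representing rows change through a matrix
`W`. Minor summation then gives the Pfaffian analogue of `skewSum_succ`. -/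
theorem skewPf_step (κ : S[X] →ₗ[S] S[X] →ₗ[S] S) (M : ℕ → S[X] →ₗ[S] S) {f f' : ℕ → S[X]}
    {W : ℕ → ℕ → S} {P : ℕ} (hf : ∀ r, r < P → f' r = ∑ k ∈ Finset.range P, W r k • f k) {l m : ℕ}
    {lam : Fin l → ℕ} (hP : ∀ i, lam i < P) (mu : Fin m → ℕ) :
    skewPf (fun r s => κ (f' r) (f' s)) (fun r c => M c (f' r)) lam mu =
      ∑ nu ∈ antiSeq l P, Matrix.det (Matrix.of fun i j => W (lam i) (nu j)) *
        skewPf (fun r s => κ (f r) (f s)) (fun r c => M c (f r)) nu mu := by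
  have h1 : (Matrix.of fun i j => κ (f' (lam i)) (f' (lam j)) : Matrix (Fin l) (Fin l) S) =
      Matrix.of fun i j => ∑ k ∈ Finset.range P, ∑ k' ∈ Finset.range P,
        W (lam i) k * W (lam j) k' * κ (f k) (f k') := by
    ext i j
    rw [Matrix.of_apply, Matrix.of_apply, hf _ (hP i), hf _ (hP j)]
    simp only [map_sum, map_smul, LinearMap.sum_apply, LinearMap.smul_apply, smul_eq_mul]
    rw [Finset.sum_comm]
    refine Finset.sum_congr rfl fun k _ => ?_
    rw [Finset.mul_sum]
    exact Finset.sum_congr rfl fun k' _ => by ring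
  have h2 : ∀ {s : ℕ} (c : Fin s → ℕ),
      (Matrix.of fun i j => M (c j) (f' (lam i)) : Matrix (Fin l) (Fin s) S) =
      Matrix.of fun i j => ∑ k ∈ Finset.range P, W (lam i) k * M (c j) (f k) := by
    intro s c
    ext i j
    rw [Matrix.of_apply, Matrix.of_apply, hf _ (hP i)]
    simp only [map_sum, map_smul, smul_eq_mul]
  by_cases he : Even (l + m)
  · simp only [skewPf, if_pos he]
    rw [h1, h2]
    exact blockPfaffian_expand (fun r s => κ (f r) (f s)) (fun r c => M c (f r))
      (fun i k => W (lam i) k) _ P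
  · simp only [skewPf, if_neg he]
    rw [h1, h2]
    exact blockPfaffian_expand (fun r s => κ (f r) (f s)) (fun r c => M c (f r))
      (fun i k => W (lam i) k) _ P

theorem skewPf_congr {K K' M M' : ℕ → ℕ → S} {l m : ℕ} {lam : Fin l → ℕ} {mu : Fin m → ℕ}
    (hK : ∀ i j, K (lam i) (lam j) = K' (lam i) (lam j)) (hM : ∀ i c, M (lam i) c = M' (lam i) c) :
    skewPf K M lam mu = skewPf K' M' lam mu := by
  simp only [skewPf, hK, hM]

theorem shiftedDiagram_snoc_zero {l : ℕ} (nu : Fin l → ℕ) :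
    shiftedDiagram (Fin.snoc nu 0 : Fin (l + 1) → ℕ) = shiftedDiagram nu := by
  ext p
  rw [mem_shiftedDiagram, mem_shiftedDiagram]
  constructor
  · rintro ⟨i, h⟩
    induction i using Fin.lastCases with
    | last => simp at h; omega
    | cast i => exact ⟨i, by simpa using h⟩
  · rintro ⟨i, h⟩
    exact ⟨i.castSucc, by simpa using h⟩

theorem eq_of_shiftedDiagram_eq {l m : ℕ} {lam : Fin l → ℕ} {mu : Fin m → ℕ}
    (hlp : ∀ i, 0 < lam i) (hmp : ∀ i, 0 < mu i) (h : shiftedDiagram lam = shiftedDiagram mu) :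
    Set.range lam = Set.range mu := by
  have key : ∀ {l m : ℕ} {lam : Fin l → ℕ} {mu : Fin m → ℕ}, (∀ i, 0 < lam i) →
      shiftedDiagram lam = shiftedDiagram mu → l ≤ m := by
    intro l m lam mu hlp h
    by_contra hlt
    have := (mk_mem_shiftedDiagram (lam := lam) (i := ⟨m, by omega⟩) (j := m)).2
      ⟨le_rfl, by simpa using hlp _⟩
    rw [h, mem_shiftedDiagram] at this
    obtain ⟨i, hi, -⟩ := this
    have := i.2
    simp at hi
    omega
  obtain rfl := le_antisymm (key hlp h) (key hmp h.symm)
  have : lam = mu := funext fun i =>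
    le_antisymm (shiftedDiagram_subset.1 h.le i) (shiftedDiagram_subset.1 h.ge i)
  rw [this]

/-- The last part of the first block meets the first entry of the reversed second block and can be
removed with it. No sign arises, again because of the reversal. -/
theorem skewPf_delta_self {l : ℕ} {mu : Fin l → ℕ} (hmu : Function.Injective mu) :
    skewPf (fun _ _ => 0) (fun r c => if r = c then (1 : S) else 0) mu mu = 1 := by
  rw [skewPf, if_pos ⟨l, rfl⟩, blockPfaffian_eq (fun _ _ => (0 : S))
    (fun r c => if r = c then (1 : S) else 0)]
  induction l with
  | zero => simp [pfaffian]
  | succ l ih =>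
    have e1 : mu = (Fin.snoc (fun i => mu i.castSucc) (mu (Fin.last l)) : Fin (l + 1) → ℕ) :=
      (Fin.snoc_init_self mu).symm
    have e2 : (fun j => mu (Fin.rev j)) =
        (Fin.cons (mu (Fin.last l)) (fun j => mu (Fin.rev j).castSucc) : Fin (l + 1) → ℕ) := by
      funext j
      refine Fin.cases ?_ (fun j => ?_) j
      · simp
      · simp [Fin.rev_succ]
    have := ih (mu := fun i => mu i.castSucc) (hmu.comp (Fin.castSucc_injective l))
    have hne : ∀ i : Fin l, mu i.castSucc ≠ mu (Fin.last l) := fun i h =>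
      (Fin.castSucc_lt_last i).ne (hmu h)
    have key := blockPfaffian_remove (K := fun _ _ => (0 : S))
      (M := fun r c => if r = c then (1 : S) else 0)
      (by simp) (fun i => mu i.castSucc) (fun j => mu (Fin.rev j).castSucc)
      (x := mu (Fin.last l)) (y := mu (Fin.last l)) rfl (by simp) (by simp [hne])
      (by simp [fun i => (hne i).symm])
    rw [← e1, ← e2] at key
    exact key.trans this

/-- If the partitions differ, some index has no partner and its row vanishes. In odd total length
the completing zero is such an index, since all parts are positive. -/
theorem skewPf_delta {l m : ℕ} {lam : Fin l → ℕ} {mu : Fin m → ℕ} (hl : StrictAnti lam)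
    (hlp : ∀ i, 0 < lam i) (hm : StrictAnti mu) (hmp : ∀ i, 0 < mu i) :
    skewPf (fun _ _ => 0) (fun r c => if r = c then (1 : S) else 0) lam mu =
      if shiftedDiagram lam = shiftedDiagram mu then 1 else 0 := by
  split_ifs with h
  · have hr := eq_of_shiftedDiagram_eq hlp hmp h
    have hlm : l = m := by
      have := congrArg Set.ncard hr
      rwa [← Set.image_univ, ← Set.image_univ, Set.ncard_image_of_injective _ hl.injective,
        Set.ncard_image_of_injective _ hm.injective, Set.ncard_univ, Set.ncard_univ,
        Nat.card_fin, Nat.card_fin] at this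
    subst hlm
    rw [strictAnti_eq_of_range_eq hl hm hr]
    exact skewPf_delta_self hm.injective
  · have hanti : ∀ i j : ℕ ⊕ ℕ, blockForm (fun _ _ => (0 : S))
        (fun r c => if r = c then (1 : S) else 0) i j = -blockForm (fun _ _ => (0 : S))
        (fun r c => if r = c then (1 : S) else 0) j i := blockForm_antisymm (by simp)
    have hrow : ∀ {s : ℕ} (c : Fin s → ℕ), (∃ i, ∀ j, lam i ≠ c j) ∨ (∃ j, ∀ i, lam i ≠ c j) →
        pfaffian (Matrix.of fun i j => blockForm (fun _ _ => (0 : S))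
          (fun r c => if r = c then (1 : S) else 0) (blockIdx lam c i) (blockIdx lam c j)) = 0 := by
      rintro s c (⟨i, hi⟩ | ⟨j, hj⟩)
      · refine pfaffian_eq_zero_of_row _ (fun _ _ => hanti _ _) (Fin.castAdd s i) fun j => ?_
        refine Fin.addCases (fun j => ?_) (fun j => ?_) j <;>
          simp [blockIdx, Fin.append_left, Fin.append_right, blockForm, hi]
      · refine pfaffian_eq_zero_of_row _ (fun _ _ => hanti _ _) (Fin.natAdd l j) fun i => ?_
        refine Fin.addCases (fun i => ?_) (fun i => ?_) i <;>
          simp [blockIdx, Fin.append_left, Fin.append_right, blockForm, hj]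
    rw [skewPf]
    split_ifs with he
    · rw [blockPfaffian_eq (fun _ _ => (0 : S)) (fun r c => if r = c then (1 : S) else 0)]
      refine hrow _ ?_
      by_contra hcon
      push Not at hcon
      obtain ⟨h1, h2⟩ := hcon
      refine h ?_
      have hr : Set.range lam = Set.range mu := by
        ext x
        constructor
        · rintro ⟨i, rfl⟩
          obtain ⟨j, hj⟩ := h1 i
          exact ⟨_, hj.symm⟩
        · rintro ⟨j, rfl⟩
          obtain ⟨i, hi⟩ := h2 (Fin.rev j)
          exact ⟨i, by rw [hi, Fin.rev_rev]⟩
      have hlm : l = m := by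
        have := congrArg Set.ncard hr
        rwa [← Set.image_univ, ← Set.image_univ, Set.ncard_image_of_injective _ hl.injective,
          Set.ncard_image_of_injective _ hm.injective, Set.ncard_univ, Set.ncard_univ,
          Nat.card_fin, Nat.card_fin] at this
      subst hlm
      rw [strictAnti_eq_of_range_eq hl hm hr]
    · rw [blockPfaffian_eq (fun _ _ => (0 : S)) (fun r c => if r = c then (1 : S) else 0)]
      exact hrow _ (Or.inr ⟨0, fun i => by simpa using (hlp i).ne'⟩)

end MainInduction

/-! ### The induction on the number of pairs of variables -/

section Main

open Polynomial

variable {R : Type*} [CommRing R]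

/-- The series of the `k`-th pair of variables, which is `1` when there is no such pair. -/
def laurentSeries (R : Type*) [CommRing R] (n k : ℕ) : PowerSeries (Laurent R n) :=
  if h : k < n then pairSeries (lx R n ⟨k, h⟩) (lxInv R n ⟨k, h⟩) else 1

theorem isPairSeries_laurentSeries (n k : ℕ) :
    IsPairSeries (if h : k < n then lx R n ⟨k, h⟩ + lxInv R n ⟨k, h⟩ else 0)
      (laurentSeries R n k) := by
  rw [laurentSeries]
  split_ifs
  · exact isPairSeries (lx_mul_lxInv R n _)
  · exact isPairSeries_one

variable [Algebra ℚ R] (a : ℕ → R)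

/-- The parameters as Laurent polynomials. -/
def laurentParam (n : ℕ) (c : ℕ) : Laurent R n := algebraMap R (Laurent R n) (a c)

theorem letterWeight_primed {n : ℕ} (i : Fin n) (b : Bool) :
    letterWeight a (toLex (i, toLex (b, false)) : Letter n) =
      fun c => (if b then lxInv R n i else lx R n i) - laurentParam a n c := by
  funext c
  simp [letterWeight, Letter.barred, Letter.unprimed, Letter.index, laurentParam, sub_eq_add_neg]
  rfl

theorem letterWeight_unprimed {n : ℕ} (i : Fin n) (b : Bool) :
    letterWeight a (toLex (i, toLex (b, true)) : Letter n) =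
      fun c => (if b then lxInv R n i else lx R n i) + laurentParam a n c := by
  funext c
  simp [letterWeight, Letter.barred, Letter.unprimed, Letter.index, laurentParam]
  rfl

-- One letter at a time: if the rows `f'` arise from the rows `f` through the transition matrix of
-- `γ`, then the Pfaffian and the tableau sum both advance by `γ`.
variable {a} in
theorem skewSum_step {n k l m : ℕ} {mu : Fin m → ℕ} (hm : StrictAnti mu) {γ : Letter n}
    (hγ : (γ.index : ℕ) = k) (κ : (Laurent R n)[X] →ₗ[Laurent R n] (Laurent R n)[X] →ₗ[Laurent R n]
      Laurent R n) (M : ℕ → (Laurent R n)[X] →ₗ[Laurent R n] Laurent R n)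
    {f f' : ℕ → (Laurent R n)[X]} {P : ℕ}
    (hf : ∀ r, r < P → f' r = ∑ k ∈ Finset.range P,
      stepWeight γ.unprimed (letterWeight a γ) r k • f k)
    (h : ∀ nu : Fin l → ℕ, StrictAnti nu → (∀ i, nu i < P) →
      skewPf (fun r s => κ (f r) (f s)) (fun r c => M c (f r)) nu mu =
        skewSum a n γ.code k nu mu)
    (lam : Fin l → ℕ) (hl : StrictAnti lam) (hP : ∀ i, lam i < P) :
      skewPf (fun r s => κ (f' r) (f' s)) (fun r c => M c (f' r)) lam mu =
        skewSum a n (γ.code + 1) k lam mu := by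
  rw [skewPf_step κ M hf hP, skewSum_succ a hl hm hP hγ]
  refine Finset.sum_congr rfl fun nu hnu => ?_
  rw [h nu (mem_antiSeq.1 hnu).2 (mem_antiSeq.1 hnu).1]

/-- Adding one pair of variables. -/
theorem skewPf_add_pair {n k l m : ℕ} (hk : k < n) {mu : Fin m → ℕ} (hm : StrictAnti mu)
    (κ : (Laurent R n)[X] →ₗ[Laurent R n] (Laurent R n)[X] →ₗ[Laurent R n] Laurent R n)
    (M : ℕ → (Laurent R n)[X] →ₗ[Laurent R n] Laurent R n) {P : ℕ}
    (h : ∀ nu : Fin l → ℕ, StrictAnti nu → (∀ i, nu i < P) →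
      skewPf (fun r s => κ (facPow (laurentParam a n) r) (facPow (laurentParam a n) s))
        (fun r c => M c (facPow (laurentParam a n) r)) nu mu = skewSum a n (4 * k) k nu mu)
    (lam : Fin l → ℕ) (hl : StrictAnti lam) (hP : ∀ i, lam i < P) :
      skewPf (fun r s => κ (truncMul (laurentSeries R n k) (facPow (laurentParam a n) r))
          (truncMul (laurentSeries R n k) (facPow (laurentParam a n) s)))
        (fun r c => M c (truncMul (laurentSeries R n k) (facPow (laurentParam a n) r))) lam mu =
        skewSum a n (4 * k + 4) k lam mu := by
  set b := laurentParam a n with hb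
  set i : Fin n := ⟨k, hk⟩ with hi
  have hx := isLetterSeries (lx R n i)
  have hy := isLetterSeries (lxInv R n i)
  have hQ : laurentSeries R n k = letterSeries (lx R n i) * letterSeries (lxInv R n i) := by
    rw [laurentSeries, dif_pos hk]; rfl
  set f1 : ℕ → (Laurent R n)[X] := fun r => ∑ j ∈ Finset.range P,
    boxWeight (fun c => lx R n i - b c) r j • facPow b j with hf1
  set f2 : ℕ → (Laurent R n)[X] := fun r => truncMul (letterSeries (lx R n i)) (facPow b r) with hf2
  set f3 : ℕ → (Laurent R n)[X] := fun r => ∑ j ∈ Finset.range P,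
    boxWeight (fun c => lxInv R n i - b c) r j • f2 j with hf3
  set f4 : ℕ → (Laurent R n)[X] := fun r => truncMul (laurentSeries R n k) (facPow b r) with hf4
  -- The four letters `k'`, `k`, `k̄'`, `k̄` are added in increasing order. After an unprimed letter
  -- the rows have undergone a full series `(1 + x z) / (1 - x z)`; after a primed one they are only
  -- an intermediate basis.
  have s1 := skewSum_step (a := a) (l := l) hm (γ := toLex (i, toLex (false, false))) (k := k) rfl
    κ M (f := facPow b) (f' := f1) (P := P) (fun r _ => by
      simp only [letterWeight_primed]; rfl) (fun nu h1 h2 => h nu h1 h2)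
  have s2 := skewSum_step (a := a) (l := l) hm (γ := toLex (i, toLex (false, true))) (k := k) rfl
    κ M (f := f1) (f' := f2) (P := P) (fun r hr => by
      simp only [letterWeight_unprimed]
      exact (sum_rowWeight b hx (coeff_zero_letterSeries _) hr).symm) s1
  have s3 := skewSum_step (a := a) (l := l) hm (γ := toLex (i, toLex (true, false))) (k := k) rfl
    κ M (f := f2) (f' := f3) (P := P) (fun r _ => by
      simp only [letterWeight_primed]; rfl) s2
  have s4 := skewSum_step (a := a) (l := l) hm (γ := toLex (i, toLex (true, true))) (k := k) rfl
    κ M (f := f3) (f' := f4) (P := P) (fun r hr => by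
      simp only [letterWeight_unprimed]
      rw [hf4, hf3, hf2]
      simp only
      rw [hQ, truncMul_mul, ← sum_rowWeight b hy (coeff_zero_letterSeries _) hr]
      simp only [map_sum, map_smul]
      rfl) s3
  exact s4 lam hl hP

/-- Among strictly decreasing sequences of natural numbers, at most the last entry is zero. Such
sequences occur as inner shapes and are led back to strict partitions. -/
theorem strictAnti_pos_or_snoc_zero {l : ℕ} {nu : Fin l → ℕ} (h : StrictAnti nu) :
    (∀ i, 0 < nu i) ∨ ∃ (l' : ℕ) (hl : l = l' + 1) (nu' : Fin l' → ℕ), StrictAnti nu' ∧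
      (∀ i, 0 < nu' i) ∧ nu = (Fin.snoc nu' 0 : Fin (l' + 1) → ℕ) ∘ Fin.cast hl := by
  cases l with
  | zero => exact Or.inl fun i => i.elim0
  | succ l =>
    by_cases h0 : nu (Fin.last l) = 0
    · refine Or.inr ⟨l, rfl, fun i => nu i.castSucc, fun i j hij => h (by simpa using hij),
        fun i => ?_, ?_⟩
      · exact lt_of_le_of_lt (Nat.zero_le _) (h (Fin.castSucc_lt_last i))
      · rw [← h0]
        exact (Fin.snoc_init_self nu).symm
    · refine Or.inl fun i => ?_
      have := h.antitone (Fin.le_last i)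
      omega

/-- The Pfaffian in the first `k` pairs of variables. -/
def partialPf (n k : ℕ) {l m : ℕ} (lam : Fin l → ℕ) (mu : Fin m → ℕ) : Laurent R n :=
  skewPf (fun r s => pairForm (laurentSeries R n) k (facPow (laurentParam a n) r)
      (facPow (laurentParam a n) s))
    (fun r c => facCoord (laurentParam a n) c (truncMul (serProd (laurentSeries R n) k)
      (facPow (laurentParam a n) r))) lam mu

/-- The length `l` varies in the induction, since an inner shape may have one row fewer than `lam`.
For such a shape the zero part is removed on the Pfaffian side, and has no effect on its diagram. -/
theorem partialPf_eq (ha : a 0 = 0) {n k l m : ℕ} (hk : k ≤ n) {lam : Fin l → ℕ}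
    (hl : StrictAnti lam) (hlp : ∀ i, 0 < lam i) {mu : Fin m → ℕ} (hm : StrictAnti mu)
    (hmp : ∀ i, 0 < mu i) :
    partialPf a n k lam mu =
      if shiftedDiagram mu ⊆ shiftedDiagram lam then tableauSum a n k (skewDiagram lam mu)
      else 0 := by
  have hb0 : laurentParam a n 0 = 0 := by rw [laurentParam, ha, map_zero]
  have hQ := isPairSeries_laurentSeries (R := R) n
  induction k generalizing l lam with
  | zero =>
    have e : ∀ f, truncMul (serProd (laurentSeries R n) 0) f = f := truncMul_one_series
    simp only [partialPf, e, facCoord_facPow]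
    have := skewPf_delta (S := Laurent R n) hl hlp hm hmp
    refine Eq.trans this ?_
    simp only [tableauSum_zero, skewDiagram, Finset.sdiff_eq_empty_iff_subset]
    by_cases h1 : shiftedDiagram mu ⊆ shiftedDiagram lam <;>
    by_cases h2 : shiftedDiagram lam ⊆ shiftedDiagram mu
    · rw [if_pos (subset_antisymm h2 h1), if_pos h1, if_pos h2]
    · rw [if_neg (fun h => h2 h.le), if_pos h1, if_neg h2]
    · rw [if_neg (fun h => h1 h.ge), if_neg h1]
    · rw [if_neg (fun h => h1 h.ge), if_neg h1]
  | succ k ih =>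
    have ih' : ∀ nu : Fin l → ℕ, StrictAnti nu →
        partialPf a n k nu mu = skewSum a n (4 * k) k nu mu := by
      intro nu hnu
      rw [skewSum_eq_tableauSum]
      rcases strictAnti_pos_or_snoc_zero hnu with hpos | ⟨l', rfl, nu', hnu', hpos, rfl⟩
      · exact ih (by omega) hnu hpos
      · simp only [Fin.cast_refl, Function.comp_id, skewDiagram, shiftedDiagram_snoc_zero]
        refine Eq.trans (skewPf_snoc_zero ?_ ?_ ?_ ?_ hpos hmp) (ih (by omega) hnu' hpos)
        · exact fun i j => pairForm_antisymm _ _ _ _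
        · exact pairForm_self _ _ _
        · intro j
          rw [facPow_zero, truncMul_one, coeff_zero_serProd hQ, C_1, ← facPow_zero (laurentParam a n),
            facCoord_facPow]
          simp only [eq_comm]
        · intro i hi
          rw [facPow_zero, pairForm_antisymm, pairForm_one hQ, facCoord_truncMul_zero _ hb0,
            coeff_zero_facPow _ hb0 hi, sub_zero]
    have hP : ∀ i, lam i < ∑ i, lam i + 1 := fun i =>
      Nat.lt_succ_of_le (Finset.single_le_sum (fun _ _ => Nat.zero_le _) (Finset.mem_univ i))
    have key := skewPf_add_pair a (by omega : k < n) hm (pairForm (laurentSeries R n) k)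
      (fun c => (facCoord (laurentParam a n) c).comp (truncMul (serProd (laurentSeries R n) k)))
      (P := ∑ i, lam i + 1) (fun nu hnu _ => ih' nu hnu) lam hl hP
    rw [← skewSum_eq_tableauSum_succ a n k hl hlp hm, ← key]
    refine skewPf_congr (fun i j => ?_) (fun i c => ?_)
    -- The correction term in the recursion for `pairForm` involves constant terms only, and these
    -- vanish for positive parts because `a_0 = 0`.
    · rw [pairForm_succ, coeff_zero_facPow _ hb0 (hlp i), coeff_zero_facPow _ hb0 (hlp j)]
      ring
    · simp only [LinearMap.comp_apply]
      rw [serProd_succ, truncMul_mul]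

end Main

/-! ### Partial fractions at the nodes -/

section Lagrange

variable {K : Type*} [Field K]

/-- The product of `(u_p + u_i) / (u_p - u_i)` over `i ≠ p`. -/
def ratioCoeff {n : ℕ} (u : Fin n → K) (p : Fin n) : K :=
  ∏ i, if i = p then 1 else (u p + u i) / (u p - u i)

theorem ratioCoeff_eq_erase {n : ℕ} (u : Fin n → K) (p : Fin n) :
    ratioCoeff u p = ∏ i ∈ Finset.univ.erase p, (u p + u i) / (u p - u i) := by
  rw [ratioCoeff, ← Finset.mul_prod_erase _ _ (Finset.mem_univ p), if_pos rfl, one_mul]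
  exact Finset.prod_congr rfl fun i hi => if_neg (Finset.ne_of_mem_erase hi)

-- The difference `∏ (X - u_i) - ∏ (X + u_i)` has degree less than `n`, so Lagrange interpolation at
-- the points `-u_i` recovers it. Division by `∏ (v + u_i)` gives the partial fractions.
open Polynomial in
theorem prod_sub_div_add {n : ℕ} {u : Fin n → K} (hu : Function.Injective u) {v : K}
    (hv : ∀ i, v + u i ≠ 0) :
    ∏ i, (v - u i) / (v + u i) = 1 - ∑ i, ratioCoeff u i * (2 * u i / (v + u i)) := by
  set f : K[X] := ∏ i, (X - C (u i)) - ∏ i, (X + C (u i)) with hf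
  have hinj : Set.InjOn (fun i => -u i) (Finset.univ : Finset (Fin n)) :=
    fun i _ j _ h => hu (neg_injective h)
  have hm1 : (∏ i, (X - C (u i))).Monic := monic_prod_of_monic _ _ fun i _ => monic_X_sub_C _
  have hm2 : (∏ i, (X + C (u i))).Monic := monic_prod_of_monic _ _ fun i _ => monic_X_add_C _
  have hd1 : (∏ i, (X - C (u i))).degree = (n : WithBot ℕ) := by
    rw [degree_prod]; simp
  have hd2 : (∏ i, (X + C (u i))).degree = (n : WithBot ℕ) := by
    rw [degree_prod]; simp
  have hdeg : f.degree < (Finset.univ : Finset (Fin n)).card := by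
    rw [Finset.card_univ, Fintype.card_fin, ← hd1]
    exact degree_sub_lt_left (hd1.trans hd2.symm) hm1.ne_zero (by rw [hm1, hm2])
  have key := congrArg (eval v) (Lagrange.eq_interpolate hinj hdeg)
  have hprod : ∏ i, (v + u i) ≠ 0 := Finset.prod_ne_zero_iff.2 fun i _ => hv i
  rw [Finset.prod_div_distrib, div_eq_iff hprod, sub_mul, one_mul, eq_sub_iff_add_eq,
    ← eq_sub_iff_add_eq']
  have e1 : eval v f = ∏ i, (v - u i) - ∏ i, (v + u i) := by
    simp [hf, eval_prod]
  rw [e1, Lagrange.interpolate_apply, eval_finsetSum] at key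
  rw [← neg_sub, key, ← Finset.sum_neg_distrib, Finset.sum_mul]
  refine Finset.sum_congr rfl fun i _ => ?_
  have e2 : eval (-u i) f = -(2 * u i) * ∏ j ∈ Finset.univ.erase i, (-u i - u j) := by
    rw [hf, eval_sub, eval_prod, eval_prod, Finset.prod_eq_zero (i := i) (s := Finset.univ)
      (f := fun j => eval (-u i) (X + C (u j))) (Finset.mem_univ i) (by simp), sub_zero,
      ← Finset.mul_prod_erase _ _ (Finset.mem_univ i)]
    simp only [eval_sub, eval_X, eval_C]
    ring
  rw [eval_mul, eval_C, e2, Lagrange.basis, eval_prod, ← Finset.mul_prod_erase _ (fun j => v + u j)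
    (Finset.mem_univ i), ratioCoeff_eq_erase]
  simp only [Lagrange.basisDivisor, eval_mul, eval_C, eval_sub, eval_X, sub_neg_eq_add]
  have e3 : ∀ j ∈ Finset.univ.erase i, (u i + u j) / (u i - u j) =
      (-u i - u j) * (-u i + u j)⁻¹ := by
    intro j hj
    rw [show -u i - u j = -(u i + u j) by ring, show -u i + u j = -(u i - u j) by ring, inv_neg,
      neg_mul_neg, div_eq_mul_inv]
  rw [Finset.prod_congr rfl e3, Finset.prod_mul_distrib, Finset.prod_mul_distrib]
  have := hv i
  field_simp

/-- The partial fraction expansion at `v = 0`. -/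
theorem sum_ratioCoeff [CharZero K] {n : ℕ} {u : Fin n → K} (hu : Function.Injective u)
    (h0 : ∀ i, u i ≠ 0) : 2 * ∑ i, ratioCoeff u i = 1 - (-1) ^ n := by
  have h := prod_sub_div_add hu (v := 0) (by simpa using h0)
  have e : ∀ i, (0 - u i) / (0 + u i) = -1 := fun i => by
    rw [zero_sub, zero_add, neg_div, div_self (h0 i)]
  have e' : ∀ i, ratioCoeff u i * (2 * u i / (0 + u i)) = 2 * ratioCoeff u i := fun i => by
    have := h0 i
    rw [zero_add]
    field_simp
  simp only [e, e', Finset.prod_const, Finset.card_univ, Fintype.card_fin, ← Finset.mul_sum] at h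
  rw [h]; ring

/-- The partial fraction expansion at a node `v = u j`, where the product vanishes. -/
theorem sum_ratioCoeff_div {n : ℕ} {u : Fin n → K} (hu : Function.Injective u)
    (h0 : ∀ i j, u i + u j ≠ 0) (j : Fin n) :
    ∑ i, ratioCoeff u i * (2 * u i / (u i + u j)) = 1 := by
  have h := prod_sub_div_add hu (v := u j) (fun i => h0 j i)
  rw [Finset.prod_eq_zero (Finset.mem_univ j) (by simp), eq_comm, sub_eq_zero] at h
  rw [h]
  simp only [add_comm (u j)]

end Lagrange

/-! ### Schur's Pfaffian -/

section Schur

variable {K : Type*} [Field K]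

/-- Distinct elements with nonzero sums, all nonzero except perhaps the first one. -/
structure IsGeneric {n : ℕ} (u : Fin n → K) : Prop where
  injective : Function.Injective u
  add_ne : ∀ i j, i ≠ j → u i + u j ≠ 0
  ne_zero : ∀ i : Fin n, (i : ℕ) ≠ 0 → u i ≠ 0

theorem IsGeneric.comp {n m : ℕ} {u : Fin n → K} (hu : IsGeneric u) {f : Fin m → Fin n}
    (hf : Function.Injective f) (h0 : ∀ i : Fin m, (i : ℕ) ≠ 0 → (f i : ℕ) ≠ 0) : IsGeneric (u ∘ f) :=
  ⟨hu.injective.comp hf, fun _ _ h => hu.add_ne _ _ fun h' => h (hf h'),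
    fun i hi => hu.ne_zero _ (h0 i hi)⟩

theorem IsGeneric.succAbove {n : ℕ} {u : Fin (n + 1) → K} (hu : IsGeneric u) (p : Fin (n + 1)) :
    IsGeneric (u ∘ p.succAbove) := by
  refine hu.comp Fin.succAbove_right_injective fun i hi => ?_
  rw [Fin.succAbove]
  split_ifs <;> simp [hi]

theorem IsGeneric.succ {n : ℕ} {u : Fin (n + 1) → K} (hu : IsGeneric u) :
    IsGeneric (u ∘ Fin.succ) := hu.comp (Fin.succ_injective n) fun i _ => by simp

/-- The matrix `(u_j - u_i) / (u_j + u_i)`. -/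
def schurMatrix {n : ℕ} (u : Fin n → K) : Matrix (Fin n) (Fin n) K :=
  Matrix.of fun i j => (u j - u i) / (u j + u i)

theorem schurMatrix_antisymm {n : ℕ} (u : Fin n → K) (i j : Fin n) :
    schurMatrix u i j = -schurMatrix u j i := by
  rw [schurMatrix, Matrix.of_apply, Matrix.of_apply, ← neg_div, neg_sub, add_comm]

/-- The product of the entries of `schurMatrix u` above the diagonal. -/
def schurDelta {n : ℕ} (u : Fin n → K) : K := ∏ i : Fin n, ∏ j ∈ Finset.Ioi i, schurMatrix u i j

theorem schurDelta_eq {n : ℕ} (u : Fin n → K) :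
    schurDelta u = ∏ i : Fin n, ∏ j : Fin n, if i < j then schurMatrix u i j else 1 := by
  refine Finset.prod_congr rfl fun i _ => ?_
  rw [← Finset.prod_filter]
  refine Finset.prod_congr ?_ fun _ _ => rfl
  ext j; simp

theorem schurDelta_succ {n : ℕ} (u : Fin (n + 1) → K) :
    schurDelta u = (∏ j : Fin n, schurMatrix u 0 j.succ) * schurDelta (u ∘ Fin.succ) := by
  rw [schurDelta_eq, schurDelta_eq, Fin.prod_univ_succ]
  congr 1
  · rw [Fin.prod_univ_succ]
    simp
  · refine Finset.prod_congr rfl fun i _ => ?_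
    rw [Fin.prod_univ_succ]
    simp [schurMatrix]

theorem prod_ite_lt_succAbove {n : ℕ} (p : Fin (n + 1)) :
    ∏ i : Fin n, (if p < p.succAbove i then (-1 : K) else 1) = (-1) ^ (n - p : ℕ) := by
  have h : ∀ i : Fin n, (if p < p.succAbove i then (-1 : K) else 1) =
      if (p : ℕ) ≤ i then -1 else 1 := by
    intro i
    refine if_congr ?_ rfl rfl
    rw [Fin.lt_succAbove_iff_le_castSucc]
    rfl
  simp only [h]
  rw [Fin.prod_univ_eq_prod_range (fun i => if (p : ℕ) ≤ i then (-1 : K) else 1),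
    Finset.prod_ite, Finset.prod_const_one, mul_one, Finset.prod_const]
  congr 1
  have : (Finset.range n).filter (fun i => (p : ℕ) ≤ i) = Finset.Ico (p : ℕ) n := by
    ext; simp; tauto
  rw [this, Nat.card_Ico]

/-- Removing the node `p` removes the factors involving `u p`. Up to the orientation of those with
larger index, they form the inverse of `ratioCoeff u p`. -/
theorem schurDelta_succAbove {n : ℕ} {u : Fin (n + 1) → K} (hu : IsGeneric u) (p : Fin (n + 1)) :
    schurDelta (u ∘ p.succAbove) = (-1) ^ (n - p : ℕ) * ratioCoeff u p * schurDelta u := by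
  have h1 : schurDelta u = (∏ i : Fin n, (if p < p.succAbove i then (-1 : K) else 1) *
      ((u p - u (p.succAbove i)) / (u p + u (p.succAbove i)))) *
        schurDelta (u ∘ p.succAbove) := by
    rw [schurDelta_eq, schurDelta_eq, Fin.prod_univ_succAbove _ p, Fin.prod_univ_succAbove _ p,
      if_neg (lt_irrefl p), one_mul]
    have : ∀ i : Fin n, ∏ j, (if p.succAbove i < j then schurMatrix u (p.succAbove i) j else 1) =
        (if p.succAbove i < p then schurMatrix u (p.succAbove i) p else 1) *
        ∏ j, if i < j then schurMatrix (u ∘ p.succAbove) i j else 1 := by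
      intro i
      rw [Fin.prod_univ_succAbove _ p]
      congr 1
      refine Finset.prod_congr rfl fun j _ => if_congr (Fin.succAbove_lt_succAbove_iff) rfl rfl
    simp only [this]
    rw [Finset.prod_mul_distrib, ← mul_assoc, ← Finset.prod_mul_distrib]
    congr 1
    refine Finset.prod_congr rfl fun i _ => ?_
    rcases lt_or_gt_of_ne (Fin.succAbove_ne p i) with h | h
    · rw [if_neg h.not_gt, if_pos h, if_neg h.not_gt]
      simp [schurMatrix]
    · rw [if_pos h, if_neg h.not_gt, if_pos h, mul_one, schurMatrix_antisymm]
      simp only [schurMatrix, Matrix.of_apply]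
      ring
  have h2 : ratioCoeff u p = ∏ i : Fin n,
      (u p + u (p.succAbove i)) / (u p - u (p.succAbove i)) := by
    rw [ratioCoeff, Fin.prod_univ_succAbove _ p, if_pos rfl, one_mul]
    exact Finset.prod_congr rfl fun i _ => if_neg (Fin.succAbove_ne p i)
  rw [h1, Finset.prod_mul_distrib, prod_ite_lt_succAbove, h2]
  have h3 : (∏ i : Fin n, (u p + u (p.succAbove i)) / (u p - u (p.succAbove i))) *
      ∏ i : Fin n, (u p - u (p.succAbove i)) / (u p + u (p.succAbove i)) = 1 := by
    rw [← Finset.prod_mul_distrib]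
    refine Finset.prod_eq_one fun i _ => ?_
    have e1 := hu.add_ne p _ (Fin.succAbove_ne p i).symm
    have e2 : u p - u (p.succAbove i) ≠ 0 :=
      sub_ne_zero.2 fun h => (Fin.succAbove_ne p i) (hu.injective h).symm
    field_simp
  have h4 : ((-1 : K) ^ (n - p : ℕ)) * (-1) ^ (n - p : ℕ) = 1 := by
    rw [← mul_pow]; simp
  linear_combination (-schurDelta (u ∘ p.succAbove)) * h4 - ((-1 : K) ^ (n - p : ℕ)) *
    (-1) ^ (n - p : ℕ) * schurDelta (u ∘ p.succAbove) * h3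

/-- The expansion sign combines with the orientation sign into `(-1) ^ n`, independent of the
position; so row expansions become unsigned sums over nodes. -/
theorem sign_schurDelta_succAbove {n : ℕ} {u : Fin (n + 1) → K} (hu : IsGeneric u)
    (p : Fin (n + 1)) :
    (-1) ^ (p : ℕ) * schurDelta (u ∘ p.succAbove) = (-1) ^ n * ratioCoeff u p * schurDelta u := by
  rw [schurDelta_succAbove hu, ← mul_assoc, ← mul_assoc, ← pow_add,
    show (p : ℕ) + (n - p) = n by have := p.2; omega]

theorem ratioCoeff_succAbove {n : ℕ} {u : Fin (n + 1) → K} (hu : IsGeneric u) (p : Fin (n + 1))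
    (i : Fin n) : ratioCoeff (u ∘ p.succAbove) i =
      ratioCoeff u (p.succAbove i) * ((u (p.succAbove i) - u p) / (u (p.succAbove i) + u p)) := by
  have e : ratioCoeff u (p.succAbove i) =
      (u (p.succAbove i) + u p) / (u (p.succAbove i) - u p) * ratioCoeff (u ∘ p.succAbove) i := by
    rw [ratioCoeff, ratioCoeff, Fin.prod_univ_succAbove _ p,
      if_neg (Fin.succAbove_ne p i).symm]
    congr 1
    exact Finset.prod_congr rfl fun j _ => if_congr Fin.succAbove_right_inj rfl rfl
  have e1 := hu.add_ne _ p (Fin.succAbove_ne p i)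
  have e2 : u (p.succAbove i) - u p ≠ 0 :=
    sub_ne_zero.2 fun h => (Fin.succAbove_ne p i) (hu.injective h)
  rw [e]
  field_simp

variable [Algebra ℚ K]

/-- The entry in row `0` is `2 u_j / (u_0 + u_j) - 1`. The sum of the first parts is the partial
fraction expansion at `v = u_0`, and the sum of the coefficients comes from `v = 0`, where the
remaining nodes must be nonzero. -/
theorem sum_ratioCoeff_schur {n : ℕ} (hn : Even n) {u : Fin (n + 2) → K} (hu : IsGeneric u) :
    ∑ j : Fin (n + 1), ratioCoeff (u ∘ Fin.succ) j * schurMatrix u 0 j.succ =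
      ∏ j : Fin (n + 1), schurMatrix u 0 j.succ := by
  have : CharZero K := algebraRat.charZero K
  have h0 : ∀ i, (u ∘ Fin.succ) i ≠ 0 := fun i => hu.ne_zero _ (by simp)
  have h1 : ∀ i, u 0 + (u ∘ Fin.succ) i ≠ 0 := fun i => hu.add_ne _ _ (Fin.succ_ne_zero i).symm
  have e1 := sum_ratioCoeff hu.succ.injective h0
  have e2 := prod_sub_div_add hu.succ.injective h1
  have e3 : ∀ j : Fin (n + 1), schurMatrix u 0 j.succ =
      2 * (u ∘ Fin.succ) j / (u 0 + (u ∘ Fin.succ) j) - 1 := by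
    intro j
    have := h1 j
    simp only [Function.comp_apply] at this ⊢
    rw [schurMatrix, Matrix.of_apply, add_comm (u j.succ), eq_sub_iff_add_eq, div_add_one this]
    congr 1
    ring
  have e4 : ∀ j : Fin (n + 1), schurMatrix u 0 j.succ =
      (-1) * ((u 0 - (u ∘ Fin.succ) j) / (u 0 + (u ∘ Fin.succ) j)) := by
    intro j
    rw [schurMatrix, Matrix.of_apply, add_comm (u j.succ), neg_one_mul, ← neg_div, neg_sub]
    rfl
  rw [Finset.prod_congr rfl fun j _ => e4 j, Finset.sum_congr rfl fun j _ => by rw [e3 j],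
    Finset.prod_mul_distrib, e2]
  simp only [mul_sub, mul_one, Finset.sum_sub_distrib, Finset.prod_const, Finset.card_univ,
    Fintype.card_fin]
  have e5 : ((-1 : K)) ^ (n + 1) = -1 := hn.add_one.neg_one_pow
  rw [e5] at e1 ⊢
  -- The number `n + 1` of remaining nodes is odd.
  have e6 : ∑ i, ratioCoeff (u ∘ Fin.succ) i = 1 := by
    have h2 : (2 : K) ≠ 0 := two_ne_zero
    apply mul_left_cancel₀ h2
    rw [e1]; ring
  rw [e6]; ring

/-- Schur's Pfaffian. -/
theorem pfaffian_schurMatrix {n : ℕ} (hn : Even n) {u : Fin n → K} (hu : IsGeneric u) :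
    pfaffian (schurMatrix u) = schurDelta u := by
  induction n using Nat.twoStepInduction with
  | zero => simp [pfaffian, schurDelta]
  | one => simp at hn
  | more n ih _ =>
    have hn' : Even n := by simpa [Nat.even_add] using hn
    rw [pfaffian_expand_zero _ (schurMatrix_antisymm u), schurDelta_succ,
      ← sum_ratioCoeff_schur hn' hu, Finset.sum_mul]
    refine Finset.sum_congr rfl fun j _ => ?_
    have h1 : (schurMatrix u).submatrix (fun i => (j.succAbove i).succ)
        (fun i => (j.succAbove i).succ) = schurMatrix ((u ∘ Fin.succ) ∘ j.succAbove) := rfl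
    have h2 := sign_schurDelta_succAbove hu.succ j
    rw [hn'.neg_one_pow, one_mul] at h2
    rw [h1, ih hn' (hu.succ.succAbove j), mul_right_comm, h2]
    ring

end Schur

/-! ### Expansion of block Pfaffians along a column -/

section BlockExpand

variable {S : Type*} [CommRing S] [Algebra ℚ S]

theorem fromBlocks_antisymm {l m : ℕ} {K : Matrix (Fin l) (Fin l) S} (hK : ∀ i j, K i j = -K j i)
    (W : Matrix (Fin l) (Fin m) S) (i j : Fin (l + m)) :
    Matrix.reindex finSumFinEquiv finSumFinEquiv (Matrix.fromBlocks K W (-W.transpose) 0) i j =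
      -Matrix.reindex finSumFinEquiv finSumFinEquiv (Matrix.fromBlocks K W (-W.transpose) 0) j i := by
  rw [Matrix.reindex_apply, Matrix.submatrix_apply, Matrix.submatrix_apply]
  rcases finSumFinEquiv.symm i with i | i <;> rcases finSumFinEquiv.symm j with j | j <;>
    simp [← hK]

theorem blockPfaffian_zero_cols {l : ℕ} (K : Matrix (Fin l) (Fin l) S)
    (W : Matrix (Fin l) (Fin 0) S) : blockPfaffian K W = pfaffian K := by
  rw [blockPfaffian]
  congr 1
  ext i j
  rw [Matrix.reindex_apply, Matrix.submatrix_apply]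
  have h : ∀ i : Fin l, finSumFinEquiv.symm (show Fin (l + 0) from i) = Sum.inl i := fun i =>
    finSumFinEquiv.symm_apply_eq.2 rfl
  rw [h, h]
  rfl

/-- Expansion of a block Pfaffian along its last column. -/
theorem blockPfaffian_expand_last {n l : ℕ} {K : Matrix (Fin (n + 1)) (Fin (n + 1)) S}
    (hK : ∀ i j, K i j = -K j i) (W : Matrix (Fin (n + 1)) (Fin (l + 1)) S) :
    blockPfaffian K W = ∑ j : Fin (n + 1), (-1) ^ (j : ℕ) * W j (Fin.last l) *
      blockPfaffian (K.submatrix j.succAbove j.succAbove)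
        (W.submatrix j.succAbove Fin.castSucc) := by
  by_cases he : Even (n + l)
  swap
  · have h0 : ∀ {N : ℕ} (A : Matrix (Fin N) (Fin N) S), ¬ Even N → pfaffian A = 0 :=
      fun A h => by rw [pfaffian_eq, if_neg h]
    rw [blockPfaffian, h0 _ (by rwa [show n + 1 + (l + 1) = n + l + 2 by ring, Nat.even_add,
      iff_true_right even_two])]
    refine (Finset.sum_eq_zero fun j _ => ?_).symm
    rw [blockPfaffian, h0 _ he, mul_zero]
  have hN : n + l + 2 = n + 1 + (l + 1) := by ring
  set A := Matrix.reindex finSumFinEquiv finSumFinEquiv (Matrix.fromBlocks K W (-W.transpose) 0)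
    with hA
  have hAapp : ∀ i j, A i j = Matrix.fromBlocks K W (-W.transpose) 0 (finSumFinEquiv.symm i)
    (finSumFinEquiv.symm j) := fun _ _ => rfl
  have hr : ∀ (i : Fin (n + 1 + (l + 1))) (j : Fin (l + 1)), (i : ℕ) = n + 1 + j →
      finSumFinEquiv.symm i = Sum.inr j :=
    fun i j hi => finSumFinEquiv.symm_apply_eq.2 (Fin.ext (by simp [hi]))
  rw [blockPfaffian, ← pfaffian_cast hN,
    pfaffian_expand (A.submatrix (Fin.cast hN) (Fin.cast hN))
      (fun i j => fromBlocks_antisymm hK W _ _) (Fin.last (n + l + 1)), Fin.val_last]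
  -- This sign of the last row cancels the one from the lower left block `-Wᵗ`.
  have hsign : (-1 : S) ^ (n + l + 1) = -1 := he.add_one.neg_one_pow
  rw [hsign, neg_one_mul, ← Finset.sum_neg_distrib]
  have hlast : finSumFinEquiv.symm (Fin.cast hN (Fin.last (n + l + 1))) =
      (Sum.inr (Fin.last l) : Fin (n + 1) ⊕ Fin (l + 1)) := hr _ _ (by simp)
  rw [← (finCongr (show n + 1 + l = n + l + 1 by ring)).sum_comp, Fin.sum_univ_add]
  rw [Finset.sum_eq_zero (s := (Finset.univ : Finset (Fin l))), add_zero]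
  · refine Finset.sum_congr rfl fun j _ => ?_
    have e1 : Fin.cast hN ((Fin.last (n + l + 1)).succAbove (Fin.cast (by ring) (Fin.castAdd l j)))
        = Fin.castAdd (l + 1) j := by
      rw [Fin.succAbove_last]
      exact Fin.ext (by simp)
    simp only [finCongr_apply]
    rw [Matrix.submatrix_apply, e1, hAapp, hlast,
      finSumFinEquiv_symm_apply_castAdd, Matrix.fromBlocks_apply₂₁, Matrix.neg_apply,
      Matrix.transpose_apply, Fin.val_cast, Fin.val_castAdd, mul_neg, neg_mul, neg_neg]
    congr 1
    rw [blockPfaffian]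
    congr 1
    have hval : ∀ i : Fin (n + l), finSumFinEquiv.symm (Fin.cast hN ((Fin.last (n + l + 1)).succAbove
        ((Fin.cast (by ring) (Fin.castAdd l j) : Fin (n + l + 1)).succAbove i))) =
        Sum.map j.succAbove Fin.castSucc (finSumFinEquiv.symm i : Fin n ⊕ Fin l) := by
      intro i
      rw [Fin.succAbove_last]
      refine Fin.addCases (fun i => ?_) (fun i => ?_) i
      · rw [finSumFinEquiv_symm_apply_castAdd, Sum.map_inl, finSumFinEquiv.symm_apply_eq]
        refine Fin.ext ?_
        simp [Fin.succAbove, Fin.lt_def]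
        split_ifs <;> simp
      · rw [finSumFinEquiv_symm_apply_natAdd, Sum.map_inr, finSumFinEquiv.symm_apply_eq]
        refine Fin.ext ?_
        have := j.2
        simp [Fin.succAbove, Fin.lt_def]
        rw [if_neg (by omega)]
        simp
        omega
    ext i k
    simp only [Matrix.submatrix_apply, hAapp, hval, Matrix.reindex_apply]
    rcases (finSumFinEquiv.symm i : Fin n ⊕ Fin l) with i | i <;>
    rcases (finSumFinEquiv.symm k : Fin n ⊕ Fin l) with k | k <;> simp
  · intro j _
    have e1 : finSumFinEquiv.symm (Fin.cast hN ((Fin.last (n + l + 1)).succAbove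
        (Fin.cast (by ring) (Fin.natAdd (n + 1) j)))) = Sum.inr j.castSucc := by
      rw [Fin.succAbove_last]
      exact hr _ _ (by simp)
    simp only [finCongr_apply]
    rw [Matrix.submatrix_apply, hAapp, hlast, e1]
    simp

/-- Moving the last index to the front with a change of sign. -/
theorem pfaffian_last_to_zero {N : ℕ} (hN : Even N) {F L : Matrix (Fin (N + 2)) (Fin (N + 2)) S}
    (hF : ∀ i j, F i j = -F j i) (hL : ∀ i j, L i j = -L j i)
    (h : ∀ i j : Fin (N + 1), F i.castSucc j.castSucc = L i.succ j.succ)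
    (h' : ∀ j : Fin (N + 1), F j.castSucc (Fin.last _) = L 0 j.succ) : pfaffian F = pfaffian L := by
  rw [pfaffian_expand F hF (Fin.last _), pfaffian_expand_zero L hL, Fin.val_last,
    hN.add_one.neg_one_pow, neg_one_mul, ← Finset.sum_neg_distrib]
  refine Finset.sum_congr rfl fun j _ => ?_
  simp only [Fin.succAbove_last]
  rw [hF, h']
  have : (F.submatrix (fun i => (j.succAbove i).castSucc) fun i => (j.succAbove i).castSucc) =
      L.submatrix (fun i => (j.succAbove i).succ) fun i => (j.succAbove i).succ := by
    ext i k
    exact h _ _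
  rw [this]
  ring

end BlockExpand

/-! ### Nimmo-type Pfaffians with one and two columns -/

section RowFormulas

variable {K : Type*} [Field K] [Algebra ℚ K]

/-- The minors in the expansion along the column are Schur Pfaffians with one node removed. -/
theorem blockPfaffian_one_col {n : ℕ} (hn : Odd n) {u : Fin n → K} (hu : IsGeneric u)
    (W : Matrix (Fin n) (Fin 1) K) :
    blockPfaffian (schurMatrix u) W = (∑ i, ratioCoeff u i * W i 0) * schurDelta u := by
  obtain ⟨k, rfl⟩ := hn
  have he : Even (2 * k) := even_two_mul k
  rw [blockPfaffian_expand_last (schurMatrix_antisymm u), Finset.sum_mul]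
  refine Finset.sum_congr rfl fun j _ => ?_
  have h2 := sign_schurDelta_succAbove hu j
  rw [he.neg_one_pow, one_mul] at h2
  have h1 : (schurMatrix u).submatrix j.succAbove j.succAbove = schurMatrix (u ∘ j.succAbove) := rfl
  rw [blockPfaffian_zero_cols, h1, pfaffian_schurMatrix he (hu.succAbove j), mul_right_comm, h2]
  simp only [Fin.last_zero]
  ring

/-- After expansion along the second column the one-column formula applies to the remaining nodes.
The coefficient of a node changes by the factor coming from the removed one, which is a Schur matrix
entry up to sign. -/
theorem blockPfaffian_two_cols {n : ℕ} (hn : Even n) {u : Fin n → K} (hu : IsGeneric u)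
    (W : Matrix (Fin n) (Fin 2) K) :
    blockPfaffian (schurMatrix u) W =
      (∑ i, ∑ j, ratioCoeff u i * ratioCoeff u j * schurMatrix u i j * (W i 0 * W j 1)) *
        schurDelta u := by
  cases n with
  | zero =>
    rw [blockPfaffian]
    refine (pfaffian_eq_zero_of_row _ (fromBlocks_antisymm (schurMatrix_antisymm u) W)
      (Fin.natAdd 0 0) fun j => ?_).trans (by simp)
    refine Fin.addCases (fun i => i.elim0) (fun i => ?_) j
    rw [Matrix.reindex_apply, Matrix.submatrix_apply, finSumFinEquiv_symm_apply_natAdd,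
      finSumFinEquiv_symm_apply_natAdd]
    rfl
  | succ n =>
    have ho : Odd n := by rwa [Nat.even_add_one, Nat.not_even_iff_odd] at hn
    rw [blockPfaffian_expand_last (schurMatrix_antisymm u), Finset.sum_comm, Finset.sum_mul]
    refine Finset.sum_congr rfl fun j _ => ?_
    have h2 := sign_schurDelta_succAbove hu j
    rw [ho.neg_one_pow] at h2
    have h1 : (schurMatrix u).submatrix j.succAbove j.succAbove = schurMatrix (u ∘ j.succAbove) :=
      rfl
    have h3 : schurMatrix u j j = 0 := by simp [schurMatrix]
    have h4 : ∑ i, ratioCoeff u (j.succAbove i) * ratioCoeff u j * schurMatrix u (j.succAbove i) j *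
        (W (j.succAbove i) 0 * W j 1) = -(ratioCoeff u j * W j 1) *
        ∑ i, ratioCoeff (u ∘ j.succAbove) i * W (j.succAbove i) 0 := by
      rw [Finset.mul_sum]
      refine Finset.sum_congr rfl fun i _ => ?_
      rw [ratioCoeff_succAbove hu, schurMatrix, Matrix.of_apply, ← neg_sub (u (j.succAbove i)),
        add_comm (u j), neg_div]
      ring
    rw [h1, blockPfaffian_one_col ho (hu.succAbove j), Fin.sum_univ_succAbove _ j, h4, h3]
    simp only [Matrix.submatrix_apply, Fin.castSucc_zero]
    have h5 : Fin.last 1 = 1 := rfl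
    rw [h5]
    linear_combination W j 1 *
      (∑ i, ratioCoeff (u ∘ j.succAbove) i * W (j.succAbove i) 0) * h2

end RowFormulas

/-! ### The other parity: a column of ones as a zero node -/

section Border

variable {K : Type*} [Field K] [Algebra ℚ K]

theorem schurDelta_ne_zero {n : ℕ} {u : Fin n → K} (hu : Function.Injective u)
    (h0 : ∀ i j, u i + u j ≠ 0) : schurDelta u ≠ 0 :=
  Finset.prod_ne_zero_iff.2 fun i _ => Finset.prod_ne_zero_iff.2 fun j hj =>
    div_ne_zero (sub_ne_zero.2 fun h => (Finset.mem_Ioi.1 hj).ne' (hu h)) (h0 j i)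

theorem ne_zero_of_add_ne {n : ℕ} {u : Fin n → K} (h0 : ∀ i j, u i + u j ≠ 0) (i : Fin n) :
    u i ≠ 0 := fun h => h0 i i (by rw [h, add_zero])

theorem isGeneric_of_add_ne {n : ℕ} {u : Fin n → K} (hu : Function.Injective u)
    (h0 : ∀ i j, u i + u j ≠ 0) : IsGeneric u :=
  ⟨hu, fun i j _ => h0 i j, fun i _ => ne_zero_of_add_ne h0 i⟩

/-- The use of a zero node is the reason for allowing the first node to vanish in `IsGeneric`: its
row `(u_j - 0) / (u_j + 0)` consists of ones off the diagonal. -/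
theorem isGeneric_cons_zero {n : ℕ} {u : Fin n → K} (hu : Function.Injective u)
    (h0 : ∀ i j, u i + u j ≠ 0) : IsGeneric (Fin.cons 0 u : Fin (n + 1) → K) := by
  have hz := ne_zero_of_add_ne h0
  refine ⟨Fin.cons_injective_iff.2 ⟨?_, hu⟩, fun i j => ?_, fun i hi => ?_⟩
  · rintro ⟨i, hi⟩
    exact hz i hi
  · refine Fin.cases ?_ (fun i => ?_) i <;> refine Fin.cases ?_ (fun j => ?_) j <;>
      simp [hz, h0]
  · obtain ⟨i, rfl⟩ := Fin.exists_succ_eq.2 (fun h => hi (by rw [h]; rfl) : i ≠ 0)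
    simpa using hz i

theorem schurDelta_cons_zero {n : ℕ} {u : Fin n → K} (h0 : ∀ i, u i ≠ 0) :
    schurDelta (Fin.cons 0 u : Fin (n + 1) → K) = schurDelta u := by
  rw [schurDelta_succ, Finset.prod_eq_one, one_mul]
  · rfl
  · intro j _
    simp [schurMatrix, h0]

theorem ratioCoeff_cons_zero {n : ℕ} {u : Fin n → K} (h0 : ∀ i, u i ≠ 0) (i : Fin n) :
    ratioCoeff (Fin.cons 0 u : Fin (n + 1) → K) i.succ = ratioCoeff u i := by
  rw [ratioCoeff, ratioCoeff, Fin.prod_univ_succ, if_neg (Fin.succ_ne_zero i).symm]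
  simp [h0]

/-- A column of ones can be replaced by a zero node. -/
theorem blockPfaffian_ones {n l : ℕ} (hnl : Odd (n + l)) {u : Fin n → K} (h0 : ∀ i, u i ≠ 0)
    (W : Matrix (Fin n) (Fin (l + 1)) K) (hW : ∀ i, W i (Fin.last l) = 1) :
    blockPfaffian (schurMatrix u) W = blockPfaffian (schurMatrix (Fin.cons 0 u : Fin (n + 1) → K))
      (Matrix.of (Fin.cons 0 fun i j => W i j.castSucc)) := by
  obtain ⟨N, hN⟩ : ∃ N, n + l = N + 1 := ⟨n + l - 1, by have := hnl.pos; omega⟩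
  have hNe : Even N := by
    rw [hN] at hnl
    simpa [Nat.odd_add_one] using hnl
  have h1 : N + 2 = n + (l + 1) := by omega
  have h2 : N + 2 = n + 1 + l := by omega
  rw [blockPfaffian, blockPfaffian, ← pfaffian_cast h1, ← pfaffian_cast h2]
  have c1 : ∀ i : Fin (N + 1), finSumFinEquiv.symm (Fin.cast h1 i.castSucc) =
      Sum.map id Fin.castSucc (finSumFinEquiv.symm (Fin.cast hN.symm i) : Fin n ⊕ Fin l) := by
    intro i
    obtain ⟨i, rfl⟩ := (finCongr hN).surjective i
    refine Fin.addCases (fun i => ?_) (fun i => ?_) i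
    · rw [finCongr_apply, Fin.cast_cast, Fin.cast_refl, id, finSumFinEquiv_symm_apply_castAdd,
        Sum.map_inl, finSumFinEquiv.symm_apply_eq]
      exact Fin.ext (by simp)
    · rw [finCongr_apply, Fin.cast_cast, Fin.cast_refl, id, finSumFinEquiv_symm_apply_natAdd,
        Sum.map_inr, finSumFinEquiv.symm_apply_eq]
      exact Fin.ext (by simp)
  have c2 : ∀ i : Fin (N + 1), finSumFinEquiv.symm (Fin.cast h2 i.succ) =
      Sum.map Fin.succ id (finSumFinEquiv.symm (Fin.cast hN.symm i) : Fin n ⊕ Fin l) := by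
    intro i
    obtain ⟨i, rfl⟩ := (finCongr hN).surjective i
    refine Fin.addCases (fun i => ?_) (fun i => ?_) i
    · rw [finCongr_apply, Fin.cast_cast, Fin.cast_refl, id, finSumFinEquiv_symm_apply_castAdd,
        Sum.map_inl, finSumFinEquiv.symm_apply_eq]
      exact Fin.ext (by simp)
    · rw [finCongr_apply, Fin.cast_cast, Fin.cast_refl, id, finSumFinEquiv_symm_apply_natAdd,
        Sum.map_inr, finSumFinEquiv.symm_apply_eq]
      exact Fin.ext (by simp; omega)
  have c3 : finSumFinEquiv.symm (Fin.cast h1 (Fin.last _)) = (Sum.inr (Fin.last l) :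
      Fin n ⊕ Fin (l + 1)) := by
    rw [finSumFinEquiv.symm_apply_eq]
    exact Fin.ext (by simp)
  have c4 : finSumFinEquiv.symm (Fin.cast h2 0) = (Sum.inl 0 : Fin (n + 1) ⊕ Fin l) := by
    rw [finSumFinEquiv.symm_apply_eq]
    exact Fin.ext (by simp)
  refine pfaffian_last_to_zero hNe (fun i j => fromBlocks_antisymm (schurMatrix_antisymm u) W _ _)
    (fun i j => fromBlocks_antisymm (schurMatrix_antisymm _) _ _ _) (fun i j => ?_) (fun j => ?_)
  · simp only [Matrix.submatrix_apply, Matrix.reindex_apply, c1, c2]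
    rcases (finSumFinEquiv.symm (Fin.cast hN.symm i) : Fin n ⊕ Fin l) with i | i <;>
    rcases (finSumFinEquiv.symm (Fin.cast hN.symm j) : Fin n ⊕ Fin l) with j | j <;>
    simp [schurMatrix]
  · simp only [Matrix.submatrix_apply, Matrix.reindex_apply, c1, c2, c3, c4]
    rcases (finSumFinEquiv.symm (Fin.cast hN.symm j) : Fin n ⊕ Fin l) with j | j <;>
    simp [schurMatrix, hW, h0]

/-- The added zero node changes neither the product of Schur entries nor the other coefficients, and
its own entry in the remaining column is `0`. The answer is therefore the same in both parities. -/
theorem blockPfaffian_one_col_ones {n : ℕ} (hn : Even n) {u : Fin n → K}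
    (hu : Function.Injective u) (h0 : ∀ i j, u i + u j ≠ 0) (W : Matrix (Fin n) (Fin 2) K)
    (hW : ∀ i, W i 1 = 1) :
    blockPfaffian (schurMatrix u) W = (∑ i, ratioCoeff u i * W i 0) * schurDelta u := by
  have hz := ne_zero_of_add_ne h0
  rw [blockPfaffian_ones hn.add_one hz W hW, blockPfaffian_one_col hn.add_one
    (isGeneric_cons_zero hu h0), schurDelta_cons_zero hz, Fin.sum_univ_succ]
  simp [ratioCoeff_cons_zero hz]

theorem blockPfaffian_two_cols_ones {n : ℕ} (hn : Odd n) {u : Fin n → K}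
    (hu : Function.Injective u) (h0 : ∀ i j, u i + u j ≠ 0) (W : Matrix (Fin n) (Fin 3) K)
    (hW : ∀ i, W i 2 = 1) :
    blockPfaffian (schurMatrix u) W =
      (∑ i, ∑ j, ratioCoeff u i * ratioCoeff u j * schurMatrix u i j * (W i 0 * W j 1)) *
        schurDelta u := by
  have hz := ne_zero_of_add_ne h0
  rw [blockPfaffian_ones (hn.add_even even_two) hz W hW, blockPfaffian_two_cols hn.add_one
    (isGeneric_cons_zero hu h0), schurDelta_cons_zero hz, Fin.sum_univ_succ]
  simp only [Fin.sum_univ_succ (n := n), ratioCoeff_cons_zero hz]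
  simp [schurMatrix]

end Border

/-! ### Generating functions for the sums over nodes -/

section Generating

variable {K : Type*} [Field K]

theorem map_ratioCoeff {L : Type*} [Field L] (F : K →+* L) {n : ℕ} (u : Fin n → K) (i : Fin n) :
    ratioCoeff (fun i => F (u i)) i = F (ratioCoeff u i) := by
  rw [ratioCoeff, ratioCoeff, map_prod]
  refine Finset.prod_congr rfl fun j _ => ?_
  split_ifs <;> simp

/-- In the fraction field, substitute `v = -(z + z⁻¹)`. Then `(v - u_i) / (v + u_i)` is the pair
series of `u_i`, and the partial fraction formula becomes an expansion of the product. -/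
theorem prod_pairSeries_eq {n : ℕ} {u : Fin n → K} (hu : Function.Injective u)
    {P : Fin n → PowerSeries K} (hP : ∀ i, IsPairSeries (u i) (P i)) :
    ∏ i, P i = 1 + ∑ i, PowerSeries.C (ratioCoeff u i) * (P i - 1) := by
  set F := algebraMap (PowerSeries K) (FractionRing (PowerSeries K)) with hF
  have hinj : Function.Injective F := IsFractionRing.injective _ _
  set G : K →+* FractionRing (PowerSeries K) := F.comp PowerSeries.C with hG
  have hz : F PowerSeries.X ≠ 0 := (map_ne_zero_iff F hinj).2 PowerSeries.X_ne_zero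
  set z := F PowerSeries.X with hzdef
  set v := -(1 + z ^ 2) / z with hv
  have hvz : v * z = -(1 + z ^ 2) := div_mul_cancel₀ _ hz
  have hne : ∀ i, v + G (u i) ≠ 0 := by
    intro i h
    have h1 : F (1 - PowerSeries.C (u i) * PowerSeries.X + PowerSeries.X ^ 2) = 0 := by
      rw [map_add, map_sub, map_mul, map_pow, map_one]
      have : (v + G (u i)) * z = 0 := by rw [h, zero_mul]
      change 1 - G (u i) * z + z ^ 2 = 0
      linear_combination -this + hvz
    have h2 := (map_eq_zero_iff F hinj).1 h1
    have h3 := congrArg (PowerSeries.coeff 0) h2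
    simp at h3
  have hdiv : ∀ i, (v - G (u i)) / (v + G (u i)) = F (P i) := by
    intro i
    rw [div_eq_iff (hne i)]
    have h1 := congrArg F (hP i)
    rw [map_mul, map_add, map_sub, map_add, map_add, map_mul, map_pow, map_one] at h1
    change F (P i) * (1 - G (u i) * z + z ^ 2) = 1 + G (u i) * z + z ^ 2 at h1
    apply mul_right_cancel₀ hz
    linear_combination (1 - F (P i)) * hvz + h1
  have hdiv' : ∀ i, 2 * G (u i) / (v + G (u i)) = 1 - F (P i) := by
    intro i
    rw [← hdiv, eq_sub_iff_add_eq, ← add_div, div_eq_one_iff_eq (hne i)]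
    ring
  have key := prod_sub_div_add (u := fun i => G (u i)) (G.injective.comp hu) hne
  simp only [hdiv, hdiv', map_ratioCoeff] at key
  apply hinj
  rw [map_prod, key, map_add, map_one, map_sum, sub_eq_add_neg, ← Finset.sum_neg_distrib]
  congr 1
  refine Finset.sum_congr rfl fun i _ => ?_
  rw [map_mul, map_sub, map_one]
  change -(G (ratioCoeff u i) * _) = G (ratioCoeff u i) * _
  ring

theorem IsPairSeries.dropZero_add_two {u : K} {Q : PowerSeries K} (h : IsPairSeries u Q) (r : ℕ) :
    dropZero (fun i => PowerSeries.coeff i Q) (r + 2) =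
      u * dropZero (fun i => PowerSeries.coeff i Q) (r + 1) -
        dropZero (fun i => PowerSeries.coeff i Q) r := by
  simp only [dropZero, h.coeff_add_two]
  rcases r with _ | r <;> simp [h.coeff_zero]

theorem IsPairSeries.dropZero_one {u : K} {Q : PowerSeries K} (h : IsPairSeries u Q) :
    dropZero (fun i => PowerSeries.coeff i Q) 1 = 2 * u := by
  simp [dropZero, h.coeff_one]

/-- Both sequences start with `0` and `2 u`, where `u = x + x⁻¹`, and satisfy the same three-term
recurrence. -/
theorem dropZero_gTilde {x : K} (h : x - x⁻¹ ≠ 0) {Q : PowerSeries K}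
    (hQ : IsPairSeries (x + x⁻¹) Q) (d : ℕ) :
    dropZero (fun d => gTilde d x) d = dropZero (fun i => PowerSeries.coeff i Q) d := by
  have hx : x ≠ 0 := by
    rintro rfl
    simp at h
  have hG : ∀ d, dropZero (fun d => gTilde d x) d =
      2 * (x ^ d - x⁻¹ ^ d) * (x + x⁻¹) / (x - x⁻¹) := by
    intro d
    rcases d with _ | d <;> simp [dropZero, gTilde]
  induction d using Nat.twoStepInduction with
  | zero => simp [dropZero]
  | one =>
    rw [hG, hQ.dropZero_one, pow_one, pow_one, mul_right_comm, mul_div_assoc, div_self h, mul_one]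
  | more d h1 h2 =>
    rw [hQ.dropZero_add_two, ← h1, ← h2, hG, hG, hG]
    have e : x ^ (d + 2) - x⁻¹ ^ (d + 2) = (x + x⁻¹) * (x ^ (d + 1) - x⁻¹ ^ (d + 1)) -
        (x ^ d - x⁻¹ ^ d) := by
      have hxx : x * x⁻¹ = 1 := mul_inv_cancel₀ hx
      linear_combination (x⁻¹ ^ d - x ^ d) * hxx
    rw [e]
    ring

variable {n : ℕ} {u : Fin n → K} (hu : Function.Injective u) {P : Fin n → PowerSeries K}
  (hP : ∀ i, IsPairSeries (u i) (P i))
include hu hP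

theorem sum_ratioCoeff_dropZero (r : ℕ) :
    ∑ i, ratioCoeff u i * dropZero (fun r => PowerSeries.coeff r (P i)) r =
      dropZero (fun r => PowerSeries.coeff r (∏ i, P i)) r := by
  rcases r with _ | r
  · simp [dropZero]
  · simp only [dropZero, Nat.succ_ne_zero, if_false]
    rw [prod_pairSeries_eq hu hP, map_add, map_sum]
    simp [PowerSeries.coeff_one]

/-- The coefficients at each node satisfy `g (r + 2) + g r = u g (r + 1)`, and the Schur entry
satisfies `A_ij (u_i + u_j) = u_j - u_i`. Summing over both nodes gives the recursion of `twoRow`;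
its initial row uses `sum_ratioCoeff_div`. -/
theorem sum_schurMatrix (h0 : ∀ i j, u i + u j ≠ 0) (r s : ℕ) :
    ∑ i, ∑ j, ratioCoeff u i * ratioCoeff u j * schurMatrix u i j *
      (dropZero (fun r => PowerSeries.coeff r (P i)) r *
        dropZero (fun r => PowerSeries.coeff r (P j)) s) =
      twoRow (fun r => PowerSeries.coeff r (∏ i, P i)) r s := by
  have hd := sum_ratioCoeff_dropZero hu hP
  set q : ℕ → K := fun r => PowerSeries.coeff r (∏ i, P i) with hq
  set g : Fin n → ℕ → K := fun i => dropZero fun r => PowerSeries.coeff r (P i) with hg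
  have hg0 : ∀ i, g i 0 = 0 := fun i => by simp [hg, dropZero]
  have hg1 : ∀ i, g i 1 = 2 * u i := fun i => (hP i).dropZero_one
  have hg2 : ∀ i r, g i (r + 2) + g i r = u i * g i (r + 1) := fun i r => by
    rw [hg]
    simp only
    rw [(hP i).dropZero_add_two]
    ring
  have hqs : ∀ r, q (r + 1) = ∑ i, ratioCoeff u i * g i (r + 1) := fun r => by
    rw [hd]; simp [dropZero]
  have hqs' : ∀ r, dropZero q r = ∑ i, ratioCoeff u i * g i r := fun r => by rw [← hd]
  have hqq : ∀ r, q (r + 2) + dropZero q r = ∑ i, ratioCoeff u i * (u i * g i (r + 1)) := fun r => by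
    rw [hqs, hqs', ← Finset.sum_add_distrib]
    exact Finset.sum_congr rfl fun i _ => by rw [← hg2]; ring
  refine eq_twoRow (F := fun r s => ∑ i, ∑ j, ratioCoeff u i * ratioCoeff u j * schurMatrix u i j *
    (g i r * g j s)) ?_ ?_ ?_ ?_ r s
  · simp [hg0]
  · simp [hg0]
  · intro s
    have e : ∀ j, ∑ i, ratioCoeff u i * ratioCoeff u j * schurMatrix u i j *
        (g i 1 * g j (s + 1)) = 2 * (ratioCoeff u j * (u j * g j (s + 1))) -
          q 1 * (ratioCoeff u j * g j (s + 1)) := by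
      intro j
      have h1 := sum_ratioCoeff_div hu h0 j
      have h2 : q 1 = ∑ i, ratioCoeff u i * (2 * u i) := by
        rw [hqs]
        simp only [zero_add, hg1]
      -- This uses `u_j - u_i = 2 u_j - (u_i + u_j)` to separate a sum evaluated by interpolation
      -- from a one-row function.
      have h3 : ∀ i, ratioCoeff u i * ratioCoeff u j * schurMatrix u i j * (g i 1 * g j (s + 1)) =
          (2 * u j * (ratioCoeff u j * g j (s + 1))) *
            (ratioCoeff u i * (2 * u i / (u i + u j))) -
          (ratioCoeff u j * g j (s + 1)) * (ratioCoeff u i * (2 * u i)) := by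
        intro i
        have := h0 i j
        rw [schurMatrix, Matrix.of_apply, hg1, add_comm (u j)]
        field_simp
        ring
      rw [Finset.sum_congr rfl fun i _ => h3 i, Finset.sum_sub_distrib, ← Finset.mul_sum,
        ← Finset.mul_sum, h1, ← h2]
      ring
    rw [Finset.sum_comm, Finset.sum_congr rfl fun j _ => e j, Finset.sum_sub_distrib,
      ← Finset.mul_sum, ← Finset.mul_sum, hqq, ← hqs s]
  · intro r s
    have e : ∀ i j, ratioCoeff u i * ratioCoeff u j * schurMatrix u i j *
        (g i (r + 2) * g j (s + 1)) = -(ratioCoeff u i * ratioCoeff u j * schurMatrix u i j *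
        (g i r * g j (s + 1))) - ratioCoeff u i * ratioCoeff u j * schurMatrix u i j *
        (g i (r + 1) * g j (s + 2)) - ratioCoeff u i * ratioCoeff u j * schurMatrix u i j *
        (g i (r + 1) * g j s) + (ratioCoeff u i * g i (r + 1)) *
          (ratioCoeff u j * (u j * g j (s + 1))) - (ratioCoeff u i * (u i * g i (r + 1))) *
          (ratioCoeff u j * g j (s + 1)) := by
      intro i j
      have h1 : schurMatrix u i j * (u i + u j) = u j - u i := by
        rw [schurMatrix, Matrix.of_apply, add_comm (u j)]
        exact div_mul_cancel₀ _ (h0 i j)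
      linear_combination ratioCoeff u i * ratioCoeff u j * schurMatrix u i j * g j (s + 1) *
        hg2 i r + ratioCoeff u i * ratioCoeff u j * schurMatrix u i j * g i (r + 1) * hg2 j s +
        ratioCoeff u i * ratioCoeff u j * g i (r + 1) * g j (s + 1) * h1
    simp only [e, Finset.sum_add_distrib, Finset.sum_sub_distrib, Finset.sum_neg_distrib,
      ← Finset.mul_sum, ← Finset.sum_mul]
    rw [← hqs, ← hqs, ← hqq, ← hqq]

end Generating

/-! ### One-row and two-row symplectic functions in finitely many variables -/

section SymplecticRows

/-- Reading off coefficients at the monomials `x_j` is enough to show that the nodes are distinct,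
that their sums are nonzero, and that `x_i` differs from `x_i⁻¹`. -/
theorem lx_coeff (n : ℕ) (i j : Fin n) :
    (lx ℚ n i).coeff (Finsupp.single j 1) = if i = j then 1 else 0 := by
  rw [lx, AddMonoidAlgebra.coeff_single, Finsupp.single_apply]
  refine if_congr ?_ rfl rfl
  rw [Finsupp.single_left_inj one_ne_zero]

theorem lxInv_coeff (n : ℕ) (i j : Fin n) : (lxInv ℚ n i).coeff (Finsupp.single j 1) = 0 := by
  rw [lxInv, AddMonoidAlgebra.coeff_single, Finsupp.single_apply, if_neg]
  intro h
  have := DFunLike.congr_fun h j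
  rw [Finsupp.single_apply, Finsupp.single_eq_same] at this
  split_ifs at this
  omega

theorem fx_inv (n : ℕ) (i : Fin n) :
    (fx n i)⁻¹ = algebraMap (Laurent ℚ n) (RatFun n) (lxInv ℚ n i) := by
  refine inv_eq_of_mul_eq_one_right ?_
  rw [fx, ← map_mul, lx_mul_lxInv, map_one]

/-- The nodes `x_i + x_i⁻¹`. -/
def nodes (n : ℕ) (i : Fin n) : RatFun n := fx n i + (fx n i)⁻¹

theorem nodes_eq (n : ℕ) (i : Fin n) :
    nodes n i = algebraMap (Laurent ℚ n) (RatFun n) (lx ℚ n i + lxInv ℚ n i) := by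
  rw [nodes, fx_inv, map_add, fx]

theorem algebraMap_ratFun_injective (n : ℕ) :
    Function.Injective (algebraMap (Laurent ℚ n) (RatFun n)) := IsFractionRing.injective _ _

theorem nodes_injective (n : ℕ) : Function.Injective (nodes n) := by
  intro i j h
  rw [nodes_eq, nodes_eq] at h
  have := DFunLike.congr_fun (congrArg AddMonoidAlgebra.coeff (algebraMap_ratFun_injective n h))
    (Finsupp.single i 1)
  rw [AddMonoidAlgebra.coeff_add, AddMonoidAlgebra.coeff_add, Finsupp.add_apply, Finsupp.add_apply,
    lx_coeff, lx_coeff, lxInv_coeff, lxInv_coeff] at this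
  by_contra hne
  simp [Ne.symm hne] at this

theorem nodes_add_ne (n : ℕ) (i j : Fin n) : nodes n i + nodes n j ≠ 0 := by
  intro h
  rw [nodes_eq, nodes_eq, ← map_add, map_eq_zero_iff _ (algebraMap_ratFun_injective n)] at h
  have := DFunLike.congr_fun (congrArg AddMonoidAlgebra.coeff h) (Finsupp.single i 1)
  rw [AddMonoidAlgebra.coeff_add, AddMonoidAlgebra.coeff_add, AddMonoidAlgebra.coeff_add,
    Finsupp.add_apply, Finsupp.add_apply, Finsupp.add_apply, lx_coeff, lx_coeff, lxInv_coeff,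
    lxInv_coeff] at this
  by_cases hij : j = i <;> simp [hij] at this

theorem fx_sub_ne (n : ℕ) (i : Fin n) : fx n i - (fx n i)⁻¹ ≠ 0 := by
  intro h
  rw [fx_inv, fx, ← map_sub, map_eq_zero_iff _ (algebraMap_ratFun_injective n), sub_eq_zero] at h
  have := DFunLike.congr_fun (congrArg AddMonoidAlgebra.coeff h) (Finsupp.single i 1)
  rw [lx_coeff, lxInv_coeff] at this
  simp at this

theorem matA_eq (n : ℕ) : matA n = schurMatrix (nodes n) := rfl

theorem deltaTilde_eq (n : ℕ) : deltaTilde n = schurDelta (nodes n) := rfl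

/-- The series whose coefficients are the one-row functions. -/
def rowSeries (R : Type*) [CommRing R] (n : ℕ) : PowerSeries (Laurent R n) :=
  serProd (laurentSeries R n) n

theorem rowSeries_eq (R : Type*) [CommRing R] (n : ℕ) :
    rowSeries R n = ∏ i, pairSeries (lx R n i) (lxInv R n i) := by
  rw [rowSeries, serProd, ← Fin.prod_univ_eq_prod_range]
  exact Finset.prod_congr rfl fun i _ => by rw [laurentSeries, dif_pos i.2]

theorem map_rowSeries (n : ℕ) :
    PowerSeries.map (algebraMap (Laurent ℚ n) (RatFun n)) (rowSeries ℚ n) =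
      ∏ i, pairSeries (fx n i) (fx n i)⁻¹ := by
  rw [rowSeries_eq, map_prod]
  refine Finset.prod_congr rfl fun i _ => ?_
  rw [pairSeries, map_mul, map_letterSeries, map_letterSeries, fx_inv]
  rfl

theorem isPairSeries_fx (n : ℕ) (i : Fin n) :
    IsPairSeries (nodes n i) (pairSeries (fx n i) (fx n i)⁻¹) :=
  isPairSeries (mul_inv_cancel₀ fun h => fx_sub_ne n i (by rw [h]; simp))

theorem gTilde_fx (n : ℕ) (i : Fin n) {r : ℕ} (hr : 0 < r) : gTilde r (fx n i) =
    dropZero (fun r => PowerSeries.coeff r (pairSeries (fx n i) (fx n i)⁻¹)) r := by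
  rw [← dropZero_gTilde (fx_sub_ne n i) (isPairSeries_fx n i), dropZero, if_neg hr.ne']

/-- When a zero part has to be appended, its column consists of ones because `g̃_0 = 1`, and the
bordered formula gives the same sum over nodes. -/
theorem symplecticQ_one (n : ℕ) {r : ℕ} (hr : 0 < r) : symplecticQ n ![r] =
    algebraMap (Laurent ℚ n) (RatFun n) (PowerSeries.coeff r (rowSeries ℚ n)) := by
  have hu := nodes_injective n
  have h0 := nodes_add_ne n
  have hd := schurDelta_ne_zero hu h0
  have key : ∑ i, ratioCoeff (nodes n) i * gTilde r (fx n i) =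
      algebraMap (Laurent ℚ n) (RatFun n) (PowerSeries.coeff r (rowSeries ℚ n)) := by
    rw [← PowerSeries.coeff_map, map_rowSeries]
    have := sum_ratioCoeff_dropZero hu (isPairSeries_fx n) r
    simp only [← gTilde_fx n _ hr] at this
    rw [this, dropZero, if_neg hr.ne']
  rw [symplecticQ, matA_eq, deltaTilde_eq, ← key]
  split_ifs with he
  · have ho : Odd n := by rwa [Nat.even_add_one, Nat.not_even_iff_odd] at he
    rw [blockPfaffian_one_col ho (isGeneric_of_add_ne hu h0), mul_div_assoc, div_self hd, mul_one]
    rfl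
  · have ho : Even n := by rwa [Nat.even_add_one, not_not] at he
    rw [blockPfaffian_one_col_ones ho hu h0, mul_div_assoc, div_self hd, mul_one]
    · rfl
    · intro i
      simp [matW, Fin.snoc, gTilde]

theorem symplecticQ_two (n : ℕ) {r s : ℕ} (hr : 0 < r) (hs : 0 < s) : symplecticQ n ![r, s] =
    algebraMap (Laurent ℚ n) (RatFun n)
      (twoRow (fun r => PowerSeries.coeff r (rowSeries ℚ n)) r s) := by
  have hu := nodes_injective n
  have h0 := nodes_add_ne n
  have hd := schurDelta_ne_zero hu h0
  have key : ∑ i, ∑ j, ratioCoeff (nodes n) i * ratioCoeff (nodes n) j * schurMatrix (nodes n) i j *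
      (gTilde r (fx n i) * gTilde s (fx n j)) = algebraMap (Laurent ℚ n) (RatFun n)
      (twoRow (fun r => PowerSeries.coeff r (rowSeries ℚ n)) r s) := by
    have := sum_schurMatrix hu (isPairSeries_fx n) h0 r s
    simp only [← gTilde_fx n _ hr, ← gTilde_fx n _ hs] at this
    rw [this, map_twoRow, ← map_rowSeries]
    rfl
  rw [symplecticQ, matA_eq, deltaTilde_eq, ← key]
  have h2 : Even (n + 2) ↔ Even n := by rw [Nat.even_add, iff_true_right even_two]
  split_ifs with he
  · have ho : Even n := h2.1 he
    rw [blockPfaffian_two_cols ho (isGeneric_of_add_ne hu h0), mul_div_assoc, div_self hd, mul_one]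
    rfl
  · have ho : Odd n := Nat.not_even_iff_odd.1 fun h => he (h2.2 h)
    rw [blockPfaffian_two_cols_ones ho hu h0, mul_div_assoc, div_self hd, mul_one]
    · rfl
    · intro i
      simp [matW, Fin.snoc, gTilde]

end SymplecticRows

/-! ### Existence of the universal one-row and two-row functions -/

section Symmetric

/-- The power series whose coefficient at a monomial of degree `r` is `2` to the number of
variables occurring in it. -/
def oneRowSeries (r : ℕ) : MvPowerSeries ℕ ℚ :=
  fun m => if m.degree = r then 2 ^ m.support.card else 0

theorem coeff_oneRowSeries (r : ℕ) (m : ℕ →₀ ℕ) : MvPowerSeries.coeff m (oneRowSeries r) =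
    if m.degree = r then 2 ^ m.support.card else 0 := rfl

theorem rename_oneRowSeries (r : ℕ) (σ : Equiv.Perm ℕ) :
    MvPowerSeries.renameEquiv ℚ σ (oneRowSeries r) = oneRowSeries r := by
  ext m
  obtain ⟨m, rfl⟩ : ∃ m', m = Finsupp.embDomain σ.toEmbedding m' :=
    ⟨Finsupp.embDomain σ.symm.toEmbedding m, by
      ext i
      obtain ⟨i, rfl⟩ := σ.surjective i
      have h1 := Finsupp.embDomain_apply_self σ.toEmbedding
        (Finsupp.embDomain σ.symm.toEmbedding m) i
      have h2 := Finsupp.embDomain_apply_self σ.symm.toEmbedding m (σ i)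
      simp only [Equiv.coe_toEmbedding, Equiv.symm_apply_apply] at h1 h2
      rw [h1, h2]⟩
  refine (MvPowerSeries.coeff_embDomain_rename σ.toEmbedding (oneRowSeries r) m).trans ?_
  rw [coeff_oneRowSeries, coeff_oneRowSeries, Finsupp.support_embDomain,
    Finset.card_map, Finsupp.embDomain_eq_mapDomain, Finsupp.degree_mapDomain]

/-- The one-row symmetric function `q_r`. -/
def oneRowSym (r : ℕ) : SymFun ℚ :=
  ⟨oneRowSeries r, ⟨r, fun m hm => by
    by_contra h
    exact hm (if_neg fun h' => h h'.le)⟩, rename_oneRowSeries r⟩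

theorem coeff_restrictFun {R : Type*} [CommRing R] (n : ℕ) (f : SymFun R)
    (m : Fin n ⊕ Fin n →₀ ℕ) : MvPolynomial.coeff m (SymFun.restrictFun n f) =
      MvPowerSeries.coeff (Finsupp.embDomain (varEmb n) m) f.1 := by
  rw [← MvPolynomial.coeff_coe, SymFun.coe_restrictFun, MvPowerSeries.coeff_killCompl]

theorem restrictFun_oneRowSym (n r : ℕ) : SymFun.restrictFun n (oneRowSym r) =
    ∑ m ∈ (Finset.univ : Finset (Fin n ⊕ Fin n)).finsuppAntidiag r,
      MvPolynomial.monomial m (2 ^ m.support.card) := by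
  ext m
  rw [coeff_restrictFun, MvPolynomial.coeff_sum]
  simp only [MvPolynomial.coeff_monomial]
  rw [Finset.sum_ite_eq']
  have h : m ∈ (Finset.univ : Finset (Fin n ⊕ Fin n)).finsuppAntidiag r ↔ m.degree = r := by
    rw [Finset.mem_finsuppAntidiag, Finsupp.degree_eq_sum]
    simp
  simp only [h]
  rw [oneRowSym, coeff_oneRowSeries, Finsupp.support_embDomain, Finset.card_map,
    Finsupp.embDomain_eq_mapDomain, Finsupp.degree_mapDomain]

/-- In the product of the series `(1 + t z) / (1 - t z)` over the `2n` variables, each variable with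
positive exponent contributes a factor `2`. -/
theorem proj_oneRowSym (n r : ℕ) :
    proj ℚ n (oneRowSym r) = PowerSeries.coeff r (rowSeries ℚ n) := by
  have h1 : rowSeries ℚ n = ∏ t : Fin n ⊕ Fin n, letterSeries (Sum.elim (lx ℚ n) (lxInv ℚ n) t) := by
    rw [rowSeries_eq, Fintype.prod_sum_type, ← Finset.prod_mul_distrib]
    rfl
  have h2 : proj ℚ n (oneRowSym r) = MvPolynomial.aeval (Sum.elim (lx ℚ n) (lxInv ℚ n))
    (SymFun.restrictFun n (oneRowSym r)) := rfl
  rw [h1, PowerSeries.coeff_prod, h2, restrictFun_oneRowSym, map_sum]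
  refine Finset.sum_congr rfl fun m _ => ?_
  rw [MvPolynomial.aeval_monomial, Finsupp.prod_fintype _ _ (fun _ => pow_zero _), map_pow]
  have h3 : algebraMap ℚ (Laurent ℚ n) 2 ^ m.support.card =
      ∏ t : Fin n ⊕ Fin n, if m t = 0 then 1 else 2 := by
    rw [Finset.prod_ite, Finset.prod_const_one, one_mul, Finset.prod_const, map_ofNat]
    congr 2
    ext t; simp
  rw [h3, ← Finset.prod_mul_distrib]
  refine Finset.prod_congr rfl fun t _ => ?_
  rw [letterSeries, PowerSeries.coeff_mk]
  split_ifs with h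
  · simp [h]
  · rfl

variable (R : Type*) [CommRing R] [Algebra ℚ R]

/-- Extension of coefficients for Laurent polynomials. -/
def laurentOfRat (n : ℕ) : Laurent ℚ n →+* Laurent R n :=
  AddMonoidAlgebra.mapRingHom (Fin n →₀ ℤ) (algebraMap ℚ R)

theorem laurentOfRat_lx (n : ℕ) (i : Fin n) : laurentOfRat R n (lx ℚ n i) = lx R n i := by
  simp [laurentOfRat, lx]

theorem laurentOfRat_lxInv (n : ℕ) (i : Fin n) : laurentOfRat R n (lxInv ℚ n i) = lxInv R n i := by
  simp [laurentOfRat, lxInv]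

theorem laurentOfRat_coeff_rowSeries (n r : ℕ) :
    laurentOfRat R n (PowerSeries.coeff r (rowSeries ℚ n)) =
      PowerSeries.coeff r (rowSeries R n) := by
  rw [← PowerSeries.coeff_map, rowSeries_eq, rowSeries_eq, map_prod]
  congr 1
  refine Finset.prod_congr rfl fun i _ => ?_
  rw [pairSeries, map_mul, map_letterSeries, map_letterSeries, laurentOfRat_lx, laurentOfRat_lxInv]
  rfl

theorem proj_ofRat (n : ℕ) (f : SymFun ℚ) :
    proj R n (SymFun.ofRat R f) = laurentOfRat R n (proj ℚ n f) := by
  have h1 : SymFun.restrictFun n (SymFun.ofRat R f) =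
      MvPolynomial.map (algebraMap ℚ R) (SymFun.restrictFun n f) := by
    ext m
    rw [MvPolynomial.coeff_map, coeff_restrictFun, coeff_restrictFun]
    exact MvPowerSeries.coeff_map _ _ _
  change MvPolynomial.aeval _ (SymFun.restrictFun n (SymFun.ofRat R f)) =
    laurentOfRat R n (MvPolynomial.aeval _ (SymFun.restrictFun n f))
  rw [h1]
  generalize SymFun.restrictFun n f = p
  induction p using MvPolynomial.induction_on with
  | C c =>
    rw [MvPolynomial.map_C, MvPolynomial.aeval_C, MvPolynomial.aeval_C]
    simp [laurentOfRat]
  | add p q hp hq => rw [map_add, map_add, map_add, map_add, hp, hq]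
  | mul_X p i hp =>
    rw [map_mul, map_mul, map_mul, map_mul, hp, MvPolynomial.map_X, MvPolynomial.aeval_X,
      MvPolynomial.aeval_X]
    rcases i with i | i
    · simp [laurentOfRat_lx]
    · simp [laurentOfRat_lxInv]

/-- The choice made in `universalQ` has prescribed projections once some function with these
projections exists. Comparing projections then suffices, because Laurent polynomials embed in their
fraction field. -/
theorem proj_universalQ {l : ℕ} {lam : Fin l → ℕ} {f : SymFun ℚ} (hf : IsUniversalQ lam f) (n : ℕ) :
    proj ℚ n (universalQ lam) = proj ℚ n f := by
  have h : IsUniversalQ lam (universalQ lam) := Classical.epsilon_spec ⟨f, hf⟩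
  exact algebraMap_ratFun_injective n ((h n).trans (hf n).symm)

theorem proj_universalQ_one (n : ℕ) {r : ℕ} (hr : 0 < r) :
    proj R n (SymFun.ofRat R (universalQ ![r])) = PowerSeries.coeff r (rowSeries R n) := by
  rw [proj_ofRat, proj_universalQ (f := oneRowSym r), proj_oneRowSym, laurentOfRat_coeff_rowSeries]
  intro n
  rw [proj_oneRowSym, symplecticQ_one n hr]

/-- `twoRow` is polynomial in its input, so applying it to the one-row symmetric functions produces
a witness inside the ring of symmetric functions. -/
theorem proj_universalQ_two (n : ℕ) {r s : ℕ} (hr : 0 < r) (hs : 0 < s) :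
    proj R n (SymFun.ofRat R (universalQ ![r, s])) =
      twoRow (fun r => PowerSeries.coeff r (rowSeries R n)) r s := by
  have h : ∀ n, proj ℚ n (twoRow oneRowSym r s) =
      twoRow (fun r => PowerSeries.coeff r (rowSeries ℚ n)) r s := by
    intro n
    rw [← RingHom.coe_coe, map_twoRow]
    congr 1
    funext r
    exact proj_oneRowSym n r
  rw [proj_ofRat, proj_universalQ (f := twoRow oneRowSym r s), h, map_twoRow]
  · congr 1
    funext r
    exact laurentOfRat_coeff_rowSeries R n r
  · intro n
    rw [h, symplecticQ_two n hr hs]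

end Symmetric

/-! ### Factorial one-row and two-row functions -/

section FacRows

open Polynomial

variable {R : Type*} [CommRing R] (a : ℕ → R)

theorem coeff_facPow (r k : ℕ) : (facPow a r).coeff k = elemSym a r k := by
  have h1 : facPow a r =
      (Multiset.map (fun c => X + C c) ((Multiset.range r).map a)).prod := by
    rw [Multiset.map_map]; rfl
  rw [elemSym]
  split_ifs with h
  · rw [h1, Multiset.prod_X_add_C_coeff _ (by simpa using h)]
    simp
  · refine coeff_eq_zero_of_natDegree_lt (lt_of_le_of_lt ?_ (not_le.1 h))
    rw [facPow]
    refine (natDegree_prod_le _ _).trans ((Finset.sum_le_card_nsmul _ _ 1 fun i _ => ?_).trans ?_)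
    · exact (natDegree_add_le _ _).trans (max_le natDegree_X_le (by simp))
    · simp

theorem elemSym_zero (ha : a 0 = 0) {r : ℕ} (hr : 0 < r) : elemSym a r 0 = 0 := by
  rw [← coeff_facPow, coeff_zero_facPow a ha hr]

theorem elemSym_of_lt {p q : ℕ} (h : p < q) : elemSym a p q = 0 := if_neg (not_le.2 h)

theorem facPow_laurentParam (n r : ℕ) :
    facPow (laurentParam a n) r = (facPow a r).map (algebraMap R (Laurent R n)) := by
  rw [facPow, facPow, Polynomial.map_prod]
  exact Finset.prod_congr rfl fun i _ => by simp [laurentParam]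

/-- The absence of the exponent `0`, due to `a_0 = 0`, matches the requirement that the partitions
`μ` have as many parts as `λ`. The upper bound `N` is free so that two factorial powers can be
expanded over the same range. -/
theorem facPow_laurentParam_eq_sum (ha : a 0 = 0) (n : ℕ) {r N : ℕ} (hr : 0 < r) (hN : r ≤ N) :
    facPow (laurentParam a n) r =
      ∑ k ∈ Finset.Icc 1 N, algebraMap R (Laurent R n) (elemSym a r k) • X ^ k := by
  ext k
  rw [facPow_laurentParam, coeff_map, coeff_facPow, finsetSum_coeff]
  simp only [coeff_smul, coeff_X_pow, smul_eq_mul, mul_ite, mul_one, mul_zero]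
  rw [Finset.sum_ite_eq]
  split_ifs with h
  · rfl
  · rcases Nat.eq_zero_or_pos k with h0 | h0
    · rw [h0, elemSym_zero a ha hr, map_zero]
    · rw [elemSym_of_lt a (by simp at h; omega), map_zero]

variable [Algebra ℚ R]

theorem mem_strictBelow {l : ℕ} {lam mu : Fin l → ℕ} :
    mu ∈ strictBelow lam ↔ (∀ i, 1 ≤ mu i ∧ mu i ≤ lam i) ∧ IsStrictPartition mu := by
  simp [strictBelow]

theorem proj_universalFacQ_one (ha : a 0 = 0) (n : ℕ) {r : ℕ} (hr : 0 < r) :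
    proj R n (universalFacQ a ![r]) =
      evalSeries (rowSeries R n) (facPow (laurentParam a n) r) := by
  rw [facPow_laurentParam_eq_sum a ha n hr le_rfl, universalFacQ, map_sum, map_sum]
  refine Finset.sum_bij' (fun mu _ => mu 0) (fun k _ => ![k]) ?_ ?_ ?_ ?_ ?_
  · intro mu hmu
    simpa using (mem_strictBelow.1 hmu).1 0
  · intro k hk
    rw [mem_strictBelow]
    refine ⟨fun i => ?_, Subsingleton.strictAnti _, fun i => ?_⟩ <;> rw [Subsingleton.elim i 0]
    · simpa using hk
    · simp at hk ⊢; omega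
  · intro mu _
    funext i
    rw [Subsingleton.elim i 0]; rfl
  · intro k _; rfl
  · intro mu hmu
    have h1 : mu = ![mu 0] := by
      funext i
      rw [Subsingleton.elim i 0]; rfl
    have h2 := (mem_strictBelow.1 hmu).1 0
    rw [map_smul, map_smul, evalSeries_X_pow, h1, proj_universalQ_one R n h2.1,
      dCoeff, Matrix.det_fin_one, Algebra.smul_def, smul_eq_mul]
    rfl

/-- Grouping `(k, l)` with `(l, k)` turns a bilinear expansion of an alternating form into `2 × 2`
minors, which are the coefficients `dCoeff`. -/
theorem sum_alternating {S : Type*} [CommRing S] {κ : ℕ → ℕ → S} (hκ : ∀ k l, κ k l = -κ l k)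
    (h0 : ∀ k, κ k k = 0) (α β : ℕ → S) (I : Finset ℕ) :
    ∑ k ∈ I, ∑ l ∈ I, α k * (β l * κ k l) =
      ∑ p ∈ I ×ˢ I with p.2 < p.1, (α p.1 * β p.2 - α p.2 * β p.1) * κ p.1 p.2 := by
  rw [Finset.sum_filter, Finset.sum_product]
  have h1 : ∀ k l, (if l < k then (α k * β l - α l * β k) * κ k l else 0) =
      (if l < k then α k * (β l * κ k l) else 0) +
        (if l < k then α l * (β k * κ l k) else 0) := by
    intro k l
    split_ifs
    · rw [hκ l k]; ring
    · rw [add_zero]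
  simp only [h1, Finset.sum_add_distrib]
  rw [Finset.sum_comm (s := I) (t := I) (f := fun k l => if l < k then α l * (β k * κ l k) else 0),
    ← Finset.sum_add_distrib]
  refine Finset.sum_congr rfl fun k _ => ?_
  rw [← Finset.sum_add_distrib]
  refine Finset.sum_congr rfl fun l _ => ?_
  rcases lt_trichotomy k l with h | h | h
  · rw [if_neg h.not_gt, if_pos h, zero_add]
  · subst h
    simp [h0]
  · rw [if_pos h, if_neg h.not_gt, add_zero]

theorem proj_universalFacQ_two (ha : a 0 = 0) (n : ℕ) {r s : ℕ} (hs : 0 < s) (hrs : s < r) :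
    proj R n (universalFacQ a ![r, s]) = pairForm (laurentSeries R n) n
      (facPow (laurentParam a n) r) (facPow (laurentParam a n) s) := by
  have hQ := isPairSeries_laurentSeries (R := R) n
  set ψ := algebraMap R (Laurent R n) with hψ
  set κ : ℕ → ℕ → Laurent R n := fun k l => pairForm (laurentSeries R n) n (X ^ k) (X ^ l) with hκ
  have h1 : pairForm (laurentSeries R n) n (facPow (laurentParam a n) r)
      (facPow (laurentParam a n) s) = ∑ k ∈ Finset.Icc 1 r, ∑ l ∈ Finset.Icc 1 r,
        ψ (elemSym a r k) * (ψ (elemSym a s l) * κ k l) := by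
    rw [facPow_laurentParam_eq_sum a ha n (hs.trans hrs) le_rfl,
      facPow_laurentParam_eq_sum a ha n hs hrs.le]
    simp only [map_sum, map_smul, LinearMap.sum_apply, LinearMap.smul_apply, smul_eq_mul]
    simp only [Finset.mul_sum]
    rw [Finset.sum_comm]
    refine Finset.sum_congr rfl fun k _ => Finset.sum_congr rfl fun l _ => ?_
    rw [hκ, hψ]
    ring
  have hval : ∀ mu ∈ strictBelow ![r, s],
      proj R n (dCoeff a ![r, s] mu • SymFun.ofRat R (universalQ mu)) =
      (ψ (elemSym a r (mu 0)) * ψ (elemSym a s (mu 1)) -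
        ψ (elemSym a r (mu 1)) * ψ (elemSym a s (mu 0))) * κ (mu 0) (mu 1) := by
    intro mu hmu
    obtain ⟨h2, h3⟩ := mem_strictBelow.1 hmu
    have h4 : mu = ![mu 0, mu 1] := by
      funext i
      fin_cases i <;> rfl
    have h5 : ∀ k l : ℕ, 0 < k → 0 < l → κ k l =
        twoRow (fun i => PowerSeries.coeff i (rowSeries R n)) k l := by
      intro k l hk hl
      obtain ⟨k, rfl⟩ := Nat.exists_eq_succ_of_ne_zero hk.ne'
      obtain ⟨l, rfl⟩ := Nat.exists_eq_succ_of_ne_zero hl.ne'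
      exact pairForm_X_pow hQ n k l
    rw [map_smul, h5 _ _ (h3.2 0) (h3.2 1), ← proj_universalQ_two R n (h3.2 0) (h3.2 1), ← h4,
      dCoeff, Matrix.det_fin_two, Algebra.smul_def, map_sub, map_mul, map_mul]
    rfl
  rw [h1, sum_alternating (fun k l => pairForm_antisymm _ _ _ _) (fun k => pairForm_self _ _ _)
    (fun k => ψ (elemSym a r k)) (fun k => ψ (elemSym a s k)), universalFacQ, map_sum]
  -- The square of exponents also contains pairs with second entry larger than `s`, which are not
  -- strict partitions inside `(r, s)`. For these both products of elementary symmetric polynomials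
  -- vanish.
  refine Finset.sum_bij_ne_zero (fun mu _ _ => (mu 0, mu 1)) ?_ ?_ ?_ ?_
  · intro mu hmu _
    obtain ⟨h2, h3⟩ := mem_strictBelow.1 hmu
    have e0 := h2 0
    have e1 := h2 1
    have e2 : mu 1 < mu 0 := h3.1 (by decide)
    simp at e0 e1 ⊢
    omega
  · intro mu _ _ nu _ _ h
    funext i
    fin_cases i
    · exact congrArg Prod.fst h
    · exact congrArg Prod.snd h
  · rintro ⟨k, l⟩ hkl hne
    simp only [Finset.mem_filter, Finset.mem_product, Finset.mem_Icc] at hkl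
    have hl : l ≤ s := by
      by_contra hl
      rw [elemSym_of_lt a (by omega : s < l), elemSym_of_lt a (by omega : s < k)] at hne
      simp at hne
    have hmem : ![k, l] ∈ strictBelow ![r, s] := by
      rw [mem_strictBelow]
      refine ⟨fun i => ?_, ?_, fun i => ?_⟩
      · fin_cases i
        · exact hkl.1.1
        · exact ⟨hkl.1.2.1, hl⟩
      · intro i j hij
        fin_cases i <;> fin_cases j <;> simp at hij ⊢
        exact hkl.2
      · fin_cases i
        · exact hkl.1.1.1
        · exact hkl.1.2.1
    exact ⟨![k, l], hmem, by rw [hval _ hmem]; exact hne, rfl⟩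
  · intro mu hmu _
    exact hval mu hmu

theorem proj_pairQ (ha : a 0 = 0) (n : ℕ) {r s : ℕ} (hr : 0 < r) (hs : 0 < s) :
    proj R n (pairQ a r s) = pairForm (laurentSeries R n) n
      (facPow (laurentParam a n) r) (facPow (laurentParam a n) s) := by
  rw [pairQ, if_neg hs.ne', if_neg hr.ne']
  split_ifs with h1 h2
  · rw [h1, pairForm_self, map_zero]
  · exact proj_universalFacQ_two a ha n hs h2
  · rw [map_neg, proj_universalFacQ_two a ha n hr (by omega), pairForm_antisymm, neg_neg]

/-- For `1 ≤ k < r` the matrix entry evaluates the series at `X (X + a_{k+1}) ⋯ (X + a_{r-1})`. This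
is the factorial power of degree `r - k` for the parameters `0, a_{k+1}, …`, which explains the
shifted parameters in the definition. -/
theorem proj_universalR (ha : a 0 = 0) (n : ℕ) {r : ℕ} (hr : 0 < r) (k : ℕ) :
    proj R n (universalR a r k) = facCoord (laurentParam a n) k
      (truncMul (rowSeries R n) (facPow (laurentParam a n) r)) := by
  have hb0 : laurentParam a n 0 = 0 := by rw [laurentParam, ha, map_zero]
  have hQ0 : PowerSeries.coeff 0 (rowSeries R n) = 1 :=
    coeff_zero_serProd (isPairSeries_laurentSeries n) n
  rcases Nat.eq_zero_or_pos k with rfl | hk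
  · rw [facCoord_truncMul_zero _ hb0, universalR, if_neg hr.ne, if_pos rfl,
      proj_universalFacQ_one a ha n hr]
  · rw [facCoord_truncMul _ hb0 _ hQ0, universalR,
      if_neg hk.ne']
    split_ifs with h1 h2
    · exact map_one _
    · rw [proj_universalFacQ_one (fun i => if i = 0 then 0 else a (k + i)) (if_pos rfl) n (by omega)]
      congr 1
      rw [facPow, Finset.range_eq_Ico, Finset.prod_eq_prod_Ico_succ_bot (by omega)]
      congr 1
      · simp [laurentParam]
      · rw [show r = k + (r - k) by omega, Nat.add_sub_cancel_left, zero_add, add_comm k 1,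
          add_comm k, ← Finset.prod_Ico_add]
        refine Finset.prod_congr rfl fun i hi => ?_
        have : i ≠ 0 := by
          rw [Finset.mem_Ico] at hi
          omega
        simp [laurentParam, this]
    · exact map_zero _

end FacRows

/-! ### Projection of the skew Pfaffian -/

section Assembly

theorem map_pfaffian {S T : Type*} [CommRing S] [Algebra ℚ S] [CommRing T] [Algebra ℚ T]
    (F : S →+* T) {N : ℕ} (A : Matrix (Fin N) (Fin N) S) : F (pfaffian A) = pfaffian (A.map F) := by
  rw [pfaffian_eq, pfaffian_eq]
  split_ifs
  · rw [map_rat_smul, map_sum]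
    simp [pfTerm]
  · exact map_zero F

theorem map_blockPfaffian {S T : Type*} [CommRing S] [Algebra ℚ S] [CommRing T] [Algebra ℚ T]
    (F : S →+* T) {l m : ℕ} (K : Matrix (Fin l) (Fin l) S) (M : Matrix (Fin l) (Fin m) S) :
    F (blockPfaffian K M) = blockPfaffian (K.map F) (M.map F) := by
  rw [blockPfaffian, blockPfaffian, map_pfaffian]
  congr 1
  ext i j
  simp only [Matrix.reindex_apply, Matrix.submatrix_apply, Matrix.map_apply]
  rcases finSumFinEquiv.symm i with i | i <;> rcases finSumFinEquiv.symm j with j | j <;> simp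

variable {R : Type*} [CommRing R] [Algebra ℚ R] (a : ℕ → R)

theorem skewFacQ_eq_partialPf (ha : a 0 = 0) (n : ℕ) {l m : ℕ} {lam : Fin l → ℕ}
    (hlam : ∀ i, 0 < lam i) (mu : Fin m → ℕ) :
    skewFacQ n a lam mu = partialPf a n n lam mu := by
  have hK : (matK a lam).map (proj R n) = Matrix.of fun i j => pairForm (laurentSeries R n) n
      (facPow (laurentParam a n) (lam i)) (facPow (laurentParam a n) (lam j)) := by
    refine Matrix.ext fun i j => ?_
    exact proj_pairQ a ha n (hlam i) (hlam j)
  have hM : ∀ {s : ℕ} (c : Fin s → ℕ), (matM a lam c).map (proj R n) = Matrix.of fun i j =>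
      facCoord (laurentParam a n) (c (Fin.rev j)) (truncMul (serProd (laurentSeries R n) n)
        (facPow (laurentParam a n) (lam i))) := by
    intro s c
    refine Matrix.ext fun i j => ?_
    exact proj_universalR a ha n (hlam i) _
  rw [skewFacQ, universalSkewQ, partialPf, skewPf]
  split_ifs with he
  · refine (map_blockPfaffian (proj R n : SymFun R →+* Laurent R n) _ _).trans ?_
    exact congrArg₂ blockPfaffian hK (hM mu)
  · refine (map_blockPfaffian (proj R n : SymFun R →+* Laurent R n) _ _).trans ?_
    refine congrArg₂ blockPfaffian hK ((hM _).trans ?_)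
    -- A zero appended to `mu` becomes the first column after reversal, which is the convention of
    -- `skewPf`.
    refine Matrix.ext fun i j => ?_
    rw [Matrix.of_apply, Matrix.of_apply]
    congr 2
    refine Fin.cases ?_ (fun j => ?_) j
    · rw [Fin.rev_zero, Fin.snoc_last]; rfl
    · rw [Fin.rev_succ, Fin.snoc_castSucc]; rfl

end Assembly

end SymplecticQ

end

theorem mainTheorem1 {R : Type*} [CommRing R] [Algebra ℚ R] (a : ℕ → R) (ha : a 0 = 0) (n : ℕ)
    {l m : ℕ} (lam : Fin l → ℕ) (hlam : SymplecticQ.IsStrictPartition lam)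
    (mu : Fin m → ℕ) (hmu : SymplecticQ.IsStrictPartition mu) :
    SymplecticQ.skewFacQ n a lam mu =
      ∑ T ∈ SymplecticQ.tableaux n lam mu, SymplecticQ.facWeight a T := by
  rw [SymplecticQ.skewFacQ_eq_partialPf a ha n hlam.2,
    SymplecticQ.partialPf_eq a ha le_rfl hlam.1 hlam.2 hmu.1 hmu.2, SymplecticQ.sum_tableaux]
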